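/- Setting. Let $0<\alpha\le 1$, let $m$ be Lebesgue measure on $[0,1]$, and let $T_a:[0,1]\to[0,1]$, $a\in[0,1]$, be a family of maps with partition points $0=b_0(a)<b_1(a)<\dots<b_{p}(a)=1$ such that each $T_a$ is $C^{1+\alpha}$ on every interval $(b_{k-1}(a),b_k(a))$, with $|T_a'(x)-T_a'(y)|\le C|x-y|^\alpha$ for $x,y$ in the same interval and $\lambda\le|T_a'|\le\Lambda$ there, where $C$ and $1<\lambda\le\Lambda<\infty$ do not depend on $a$. Every $T_a$ has exactly one absolutely continuous invariant probability measure $\mu_a$; let $K(a)$ be its support. Assume: (i) the number $p$ does not depend on $a$, and each $b_k$ is Lipschitz on $[0,1]$; (ii) if $x\in[0,1]$ and $J\subset[0,1]$ is an interval with $b_k(a)\ne x$ for all $a\in J$ and all $k$, then $a\mapsto T_a(x)$ is $C^{1+\alpha}$ on $J$ and $a\mapsto\partial_xT_a(x)$ is $\alpha$-Hölder on $J$, with Hölder constants independent of $x$ and $J$; the maps $x\mapsto\partial_aT_a(x)$ are $\alpha$-Hölder on each $(b_{k-1}(a),b_k(a))$, uniformly in $a$ and $k$; (iii) the number of connected components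 of $K(a)\setminus\{b_0(a),\dots,b_p(a)\}$ is finite and independent of $a$, and their boundary points are $\alpha$-Hölder in $a$. Fix $A>0$. For $\varphi\in L^1(m)$ real-valued put $\operatorname{osc}(\varphi,\delta,x)=\operatorname{ess\,sup}\varphi-\operatorname{ess\,inf}\varphi$, both over $(x-\delta,x+\delta)\cap[0,1]$, and $$|\varphi|_\alpha=\sup_{0<\delta\le A}\delta^{-\alpha}\int_0^1\operatorname{osc}(\varphi,\delta,x)\,dx,\qquad \|\varphi\|_\alpha=|\varphi|_\alpha+\|\varphi\|_{L^1(m)},\qquad V_\alpha=\{\varphi\in L^1(m):|\varphi|_\alpha<\infty\}.$$ Let $\mathcal L_a\varphi(x)=\sum_{T_a(y)=x}\varphi(y)/|T_a'(y)|$ be the transfer operator. Assume condition (II) with a constant $0<\epsilon\le1$: the map $T_0$ is topologically mixing on $K(0)$, and there are $C\ge1$ and $0<\tilde\rho<1$ such that $\|\mathcal L_a^n\varphi\|_\alpha\le C\tilde\rho^{\,n}\|\varphi\|_\alpha+C\|\varphi\|_{L^1(m)}$ for all $a\in[0,\epsilon]$, $n\ge1$ and $\varphi\in V_\alpha$. Since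 the values of $T_0$ at its partition points are arbitrary, topologically mixing on $K(0)$ means: for all open $U,V$ that meet $K(0)$ there is $N$ such that for every $n\ge N$ some $x\in U\cap K(0)$ has $T_0^n(x)\in V\cap K(0)$ and $T_0^i(x)\notin\{b_0(0),\dots,b_p(0)\}$ for $0\le i<n$. For $\varphi\in V_\alpha$ let $\sigma_a(\varphi)\ge0$ be defined by $$\sigma_a(\varphi)^2=\int\Big(\varphi-\int\varphi\,d\mu_a\Big)^2d\mu_a+2\sum_{i\ge1}\int\Big(\varphi-\int\varphi\,d\mu_a\Big)\Big(\varphi-\int\varphi\,d\mu_a\Big)\circ T_a^i\,d\mu_a .$$ Say that correlations decay uniformly on $[0,\epsilon']$ if there are $C\ge1$ and $0<\rho<1$ such that for all $a\in[0,\epsilon']$, $\varphi\in V_\alpha$, $\psi\in L^1(m)$ and $n\ge1$, $$\Big|\int_0^1\varphi\;\psi\circ T_a^n\,dm-\int_0^1\varphi\,dm\int_0^1\psi\,d\mu_a\Big|\le C\|\varphi\|_\alpha\|\psi\|_{L^1(m)}\rho^n .$$ Lemma 4.5. Under these assumptions there is $\epsilon'\in(0,\epsilon]$ such that correlations decay uniformly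 on $[0,\epsilon']$. For every such $\epsilon'$ and every $\varphi\in V_\alpha$, the series defining $\sigma_a(\varphi)^2$ converges absolutely and its value is nonnegative for all $a\in[0,\epsilon']$, and there are constants $C$ and $\kappa>0$ such that $$|\sigma_a(\varphi)-\sigma_{a'}(\varphi)|\le C|a-a'|^\kappa\qquad\text{for all }a,a'\in[0,\epsilon'].$$ -/

import Mathlib

open MeasureTheory Set

noncomputable section

namespace PiecewiseExpanding

/-- Lebesgue measure on the unit interval. -/
def leb : Measure ℝ := volume.restrict (Icc (0 : ℝ) 1)

/-- The essential oscillation `osc(φ, δ, x)`: essential supremum minus essential infimum of `φ`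
on the part of `(x - δ, x + δ)` that lies in the unit interval. It may be infinite. -/
def osc (φ : ℝ → ℝ) (δ x : ℝ) : ENNReal :=
  (essSup (fun y => (φ y : EReal)) (leb.restrict (Ioo (x - δ) (x + δ)))
    - essInf (fun y => (φ y : EReal)) (leb.restrict (Ioo (x - δ) (x + δ)))).toENNReal

/-- The generalised variation `|φ|_α = sup_{0 < δ ≤ A} δ^{-α} ∫₀¹ osc(φ, δ, x) dx`. -/
def gbvSeminorm (α A : ℝ) (φ : ℝ → ℝ) : ENNReal :=
  ⨆ δ ∈ Ioc (0 : ℝ) A, (∫⁻ x, osc φ δ x ∂leb) / ENNReal.ofReal (δ ^ α)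

/-- The norm `‖φ‖_α = |φ|_α + ‖φ‖_{L¹}`. -/
def gbvNorm (α A : ℝ) (φ : ℝ → ℝ) : ENNReal :=
  gbvSeminorm α A φ + eLpNorm φ 1 leb

/-- `φ` (a representative of a class in `L¹`) belongs to the space `V_α`. -/
def MemV (α A : ℝ) (φ : ℝ → ℝ) : Prop :=
  Integrable φ leb ∧ gbvSeminorm α A φ < ⊤

/-- The transfer operator `(ℒφ)(x) = ∑_{T y = x} φ(y) / |T'(y)|` of a map `T` of the unit interval
whose partition points form the finite set `B`. At the points of `B` the derivative need not exist;
they are left out, which changes `ℒφ` on a finite set only. -/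
def transfer (T : ℝ → ℝ) (B : Set ℝ) (φ : ℝ → ℝ) (x : ℝ) : ℝ :=
  ∑ᶠ y ∈ {y : ℝ | y ∈ Icc (0 : ℝ) 1 ∧ y ∉ B ∧ T y = x}, φ y / |deriv T y|

/-- `ν` is an absolutely continuous invariant probability measure of `T`. -/
structure IsACIP (T : ℝ → ℝ) (ν : Measure ℝ) : Prop where
  isProb : IsProbabilityMeasure ν
  ac : ν ≪ leb
  inv : ν.map T = ν

/-- Topological mixing on `K` of a map with partition points `B`. Such a map is only determined by
its branches off `B` (its values on `B` are arbitrary), so the orbit segments that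
go from `U` to `V` are those that do not meet `B`. -/
def TopMixingOn (T : ℝ → ℝ) (B K : Set ℝ) : Prop :=
  ∀ U V : Set ℝ, IsOpen U → IsOpen V → (U ∩ K).Nonempty → (V ∩ K).Nonempty →
    ∃ N : ℕ, ∀ n ≥ N, ∃ x ∈ U ∩ K, (∀ i < n, T^[i] x ∉ B) ∧ T^[n] x ∈ V ∩ K

/-- The set `{b_0(a), …, b_p(a)}` of partition points at the parameter `a`. -/
def partitionPoints {p : ℕ} (b : Fin (p + 1) → ℝ → ℝ) (a : ℝ) : Set ℝ :=
  range fun k => b k a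

/-- The open branch interval `(b_{k-1}(a), b_k(a))`, for `k = 1, …, p`, numbered from `0`. -/
def branch {p : ℕ} (b : Fin (p + 1) → ℝ → ℝ) (k : Fin p) (a : ℝ) : Set ℝ :=
  Ioo (b k.castSucc a) (b k.succ a)

/-- The derivative `∂_a T_a(x)` in the parameter (one-sided at the parameters `0` and `1`). -/
def paramDeriv (T : ℝ → ℝ → ℝ) (a x : ℝ) : ℝ :=
  derivWithin (fun s => T s x) (Icc 0 1) a

/-- The connected components of `K \ B`, i.e. the monotonicity intervals of a map on `K`. -/
def monotonicityIntervals (K B : Set ℝ) : Set (Set ℝ) :=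
  {D | ∃ x ∈ K \ B, D = connectedComponentIn (K \ B) x}

/-- A one-parameter family `T_a : [0,1] → [0,1]`, `a ∈ [0,1]`, of uniformly expanding piecewise
`C^{1+α}` maps with partition points `b_k(a)` and unique acip `μ_a`, with regular
dependence on the parameter. Nothing is said about values outside the unit interval. -/
structure ExpandingFamily (α : ℝ) (p : ℕ) (T : ℝ → ℝ → ℝ) (b : Fin (p + 1) → ℝ → ℝ)
    (μ : ℝ → Measure ℝ) : Prop where
  alpha_pos : 0 < α
  alpha_le : α ≤ 1
  mapsTo : ∀ a ∈ Icc (0 : ℝ) 1, MapsTo (T a) (Icc 0 1) (Icc 0 1)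
  b_zero : ∀ a ∈ Icc (0 : ℝ) 1, b 0 a = 0
  b_last : ∀ a ∈ Icc (0 : ℝ) 1, b (Fin.last p) a = 1
  b_strictMono : ∀ a ∈ Icc (0 : ℝ) 1, StrictMono fun k => b k a
  differentiableOn : ∀ a ∈ Icc (0 : ℝ) 1, ∀ k : Fin p, DifferentiableOn ℝ (T a) (branch b k a)
  deriv_holder : ∃ C : ℝ, ∀ a ∈ Icc (0 : ℝ) 1, ∀ k : Fin p,
    ∀ x ∈ branch b k a, ∀ y ∈ branch b k a,
      |deriv (T a) x - deriv (T a) y| ≤ C * |x - y| ^ α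
  expanding : ∃ l L : ℝ, 1 < l ∧ l ≤ L ∧ ∀ a ∈ Icc (0 : ℝ) 1, ∀ k : Fin p,
    ∀ x ∈ branch b k a, l ≤ |deriv (T a) x| ∧ |deriv (T a) x| ≤ L
  /-- (i) the partition points depend Lipschitz continuously on the parameter -/
  b_lipschitz : ∃ L : ℝ, ∀ k : Fin (p + 1), ∀ a ∈ Icc (0 : ℝ) 1, ∀ a' ∈ Icc (0 : ℝ) 1,
    |b k a - b k a'| ≤ L * |a - a'|
  /-- (ii) on a parameter interval `J` on which no partition point equals `x`, the map
  `a ↦ T_a(x)` is `C^{1+α}` and `a ↦ ∂_x T_a(x)` is `α`-Hölder, uniformly in `x` -/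
  param_regular : ∃ C : ℝ, ∀ x ∈ Icc (0 : ℝ) 1, ∀ J ⊆ Icc (0 : ℝ) 1, J.OrdConnected →
    (∀ a ∈ J, x ∉ partitionPoints b a) →
      (∀ a ∈ J, DifferentiableWithinAt ℝ (fun s => T s x) (Icc 0 1) a) ∧
      ∀ a ∈ J, ∀ a' ∈ J,
        |paramDeriv T a x - paramDeriv T a' x| ≤ C * |a - a'| ^ α ∧
        |deriv (T a) x - deriv (T a') x| ≤ C * |a - a'| ^ α
  /-- (ii), continued: `x ↦ ∂_a T_a(x)` is `α`-Hölder on each branch, uniformly in `a` -/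
  paramDeriv_holder : ∃ C : ℝ, ∀ a ∈ Icc (0 : ℝ) 1, ∀ k : Fin p,
    ∀ x ∈ branch b k a, ∀ y ∈ branch b k a,
      |paramDeriv T a x - paramDeriv T a y| ≤ C * |x - y| ^ α
  acip : ∀ a ∈ Icc (0 : ℝ) 1, IsACIP (T a) (μ a)
  acip_unique : ∀ a ∈ Icc (0 : ℝ) 1, ∀ ν : Measure ℝ, IsACIP (T a) ν → ν = μ a
  /-- (iii) the number of monotonicity intervals on the support of `μ_a` does not depend on `a`,
  and their boundary points are `α`-Hölder continuous in `a` -/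
  support_regular : ∃ (q : ℕ) (D : Fin q → ℝ → Set ℝ) (l r : Fin q → ℝ → ℝ) (C : ℝ),
    (∀ a ∈ Icc (0 : ℝ) 1,
      (Function.Injective fun k => D k a) ∧
      (range fun k => D k a) = monotonicityIntervals (μ a).support (partitionPoints b a) ∧
      ∀ k, closure (D k a) = Icc (l k a) (r k a)) ∧
    ∀ k, ∀ a ∈ Icc (0 : ℝ) 1, ∀ a' ∈ Icc (0 : ℝ) 1,
      |l k a - l k a'| ≤ C * |a - a'| ^ α ∧ |r k a - r k a'| ≤ C * |a - a'| ^ α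

/-- Condition (II) on the parameter interval `[0, ε]`: `T_0` is topologically mixing on the support
of `μ_0`, and the Lasota–Yorke inequality holds with uniform constants for `a ∈ [0, ε]`. -/
structure ConditionII (α A : ℝ) {p : ℕ} (T : ℝ → ℝ → ℝ) (b : Fin (p + 1) → ℝ → ℝ)
    (μ : ℝ → Measure ℝ) (ε : ℝ) : Prop where
  eps_pos : 0 < ε
  eps_le : ε ≤ 1
  mixing : TopMixingOn (T 0) (partitionPoints b 0) (μ 0).support
  lasotaYorke : ∃ C ρ : ℝ, 1 ≤ C ∧ 0 < ρ ∧ ρ < 1 ∧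
    ∀ a ∈ Icc (0 : ℝ) ε, ∀ n ≥ 1, ∀ φ : ℝ → ℝ, MemV α A φ →
      gbvNorm α A ((transfer (T a) (partitionPoints b a))^[n] φ) ≤
        ENNReal.ofReal (C * ρ ^ n) * gbvNorm α A φ + ENNReal.ofReal C * eLpNorm φ 1 leb

/-- Exponential decay of correlations with constants that are uniform in `a ∈ [0, ε']`. -/
def UniformDecay (α A : ℝ) (T : ℝ → ℝ → ℝ) (μ : ℝ → Measure ℝ) (ε' : ℝ) : Prop :=
  ∃ C ρ : ℝ, 1 ≤ C ∧ 0 < ρ ∧ ρ < 1 ∧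
    ∀ a ∈ Icc (0 : ℝ) ε', ∀ φ ψ : ℝ → ℝ, MemV α A φ → Integrable ψ leb → ∀ n ≥ 1,
      |(∫ x, φ x * ψ ((T a)^[n] x) ∂leb) - (∫ x, φ x ∂leb) * ∫ x, ψ x ∂(μ a)| ≤
        C * (gbvNorm α A φ).toReal * (∫ x, |ψ x| ∂leb) * ρ ^ n

/-- `∫ (φ - ∫ φ dμ) · (φ - ∫ φ dμ) ∘ Tⁱ dμ`. -/
def autocov (T : ℝ → ℝ) (μ : Measure ℝ) (φ : ℝ → ℝ) (i : ℕ) : ℝ :=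
  ∫ x, (φ x - ∫ z, φ z ∂μ) * (φ (T^[i] x) - ∫ z, φ z ∂μ) ∂μ

/-- The series that defines `σ(φ)²`. -/
def varianceSeries (T : ℝ → ℝ) (μ : Measure ℝ) (φ : ℝ → ℝ) : ℝ :=
  (∫ x, (φ x - ∫ z, φ z ∂μ) ^ 2 ∂μ) + 2 * ∑' i : ℕ, autocov T μ φ (i + 1)

/-- `σ(φ)`, the nonnegative square root of the series. -/
def sigma (T : ℝ → ℝ) (μ : Measure ℝ) (φ : ℝ → ℝ) : ℝ :=
  √(varianceSeries T μ φ)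

end PiecewiseExpanding

end

/-!
# Decay of correlations and regularity of the variance for expanding families

Write `P_a` for the transfer operator of `T_a` on `L¹`. It is a positive contraction that preserves
integrals, and condition (II) gives a Lasota–Yorke inequality in `V_α` with constants independent of
`a`. As operators from `V_α` to `L¹` the `P_a` are Hölder continuous in `a`
(`ExpandingFamily.exists_norm_transferL1_sub_le`): by duality this compares the integrals of
`ψ ∘ T_a` and `ψ ∘ T_a'` over small intervals, which off the partition points nearly have the same
image under the two maps.

**The map at the parameter zero.** Balls of `V_α` are compact in `L¹` (`isCompact_gbvBall`, by
averaging over uniform partitions), so if the orbit of a function from `V_α` with integral zero does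
not tend to zero in `L¹`, it accumulates at some `f ≠ 0` with integral zero that is recurrent: a
subsequence of the iterates of `f` returns to `f`. The functions recurrent along this subsequence
form a vector lattice on which `P_0` is an isometric lattice homomorphism, so disjoint recurrent
functions keep disjoint images. By the Lasota–Yorke inequality a nonzero recurrent function is
bounded by a constant multiple of its `L¹` norm, hence its support cannot be small, and below the
negative part of `f` there is an atom `e` (`IsLasotaYorke.exists_atom`). The images of `e` return to
`e`, so those of the positive part of `f` avoid `e` at the return times. But every nonzero recurrent
function meets the density of `μ_0`, by uniqueness of the invariant measure
(`IsLasotaYorke.inf_invariant_ne_zero`), and by topological mixing all late images of a function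
that meets it intersect any given other such function (`IsBranched.exists_pow_inf_ne_zero`). With the
positive part of `f` and `e` this is a contradiction (`IsLasotaYorke.tendsto_norm_pow`).

**Nearby parameters.** By compactness the decay is uniform on the unit ball, so a single iterate of
`P_0` is small from `V_α` to `L¹` on functions with integral zero; this persists for `P_a` with `a`
small, and the Lasota–Yorke inequality turns it into an exponential rate in `V_α`
(`IsLasotaYorke.exists_exponential_decay`, `ConditionII.exists_uniformDecay`). No spectral
perturbation theory is needed.

**The variance.** The density of `μ_a` is bounded in `V_α` uniformly in `a`, so decay of
correlations, applied to the product of the density with `φ`, bounds the terms of the series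
geometrically. The value of the series is the Cesàro limit of the second moments of the Birkhoff
sums divided by their length, hence nonnegative. For two parameters at distance `t` the first `n`
terms differ by at most a constant times `ρ ^ n + n * t ^ κ`: the measures are compared by pushing
Lebesgue measure forward `n` times under both maps, the correlations by telescoping the powers of
the transfer operators. Taking `n` of order `t ^ (-κ / 4)` gives Hölder continuity of `σ²`, and the
square root halves the exponent.
-/

noncomputable section

namespace PiecewiseExpanding

open Filter Topology
open scoped ENNReal NNReal

/-! ### Essential oscillation -/

instance isProbabilityMeasure_leb : IsProbabilityMeasure leb := by
  constructor
  simp [leb]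

lemma leb_restrict_Ioo_ne_zero {x δ : ℝ} (hx : x ∈ Icc (0 : ℝ) 1) (hδ : 0 < δ) :
    leb.restrict (Ioo (x - δ) (x + δ)) ≠ 0 := by
  rw [Ne, Measure.restrict_eq_zero, leb, Measure.restrict_apply measurableSet_Ioo]
  have hsub : Ioo (max 0 (x - δ)) (min 1 (x + δ)) ⊆ Ioo (x - δ) (x + δ) ∩ Icc 0 1 := by
    intro y hy
    simp only [mem_Ioo, max_lt_iff, lt_min_iff] at hy
    exact ⟨⟨hy.1.2, hy.2.2⟩, hy.1.1.le, hy.2.1.le⟩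
  have hlt : max 0 (x - δ) < min 1 (x + δ) := by
    obtain ⟨h0, h1⟩ := hx
    simp only [max_lt_iff, lt_min_iff]
    refine ⟨⟨one_pos, by linarith⟩, by linarith, by linarith⟩
  intro h
  have := measure_mono_null hsub h
  rw [Real.volume_Ioo, ENNReal.ofReal_eq_zero] at this
  linarith

lemma osc_le_of_ae_bounds {φ : ℝ → ℝ} {δ x u v : ℝ}
    (h : ∀ᵐ y ∂leb.restrict (Ioo (x - δ) (x + δ)), u ≤ φ y ∧ φ y ≤ v) :
    osc φ δ x ≤ ENNReal.ofReal (v - u) := by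
  have h1 : essSup (fun y => (φ y : EReal)) (leb.restrict (Ioo (x - δ) (x + δ))) ≤ (v : EReal) :=
    essSup_le_of_ae_le _ (h.mono fun y hy => EReal.coe_le_coe_iff.2 hy.2)
  have h2 : (u : EReal) ≤ essInf (fun y => (φ y : EReal)) (leb.restrict (Ioo (x - δ) (x + δ))) :=
    le_essInf_of_ae_le _ (h.mono fun y hy => EReal.coe_le_coe_iff.2 hy.1)
  calc osc φ δ x ≤ ((v : EReal) - (u : EReal)).toENNReal :=
        EReal.toENNReal_le_toENNReal (EReal.sub_le_sub h1 h2)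
    _ = ENNReal.ofReal (v - u) := by rw [← EReal.coe_sub, EReal.real_coe_toENNReal]

lemma exists_bounds_of_osc_ne_top {φ : ℝ → ℝ} {δ x : ℝ} (hx : x ∈ Icc (0 : ℝ) 1) (hδ : 0 < δ)
    (h : osc φ δ x ≠ ⊤) :
    ∃ u v : ℝ, u ≤ v ∧ (∀ᵐ y ∂leb.restrict (Ioo (x - δ) (x + δ)), u ≤ φ y ∧ φ y ≤ v) ∧
      ENNReal.ofReal (v - u) = osc φ δ x := by
  have : NeZero (leb.restrict (Ioo (x - δ) (x + δ))) := ⟨leb_restrict_Ioo_ne_zero hx hδ⟩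
  have hS := ae_le_essSup (f := fun y => (φ y : EReal)) (μ := leb.restrict (Ioo (x - δ) (x + δ)))
  have hI := ae_essInf_le (f := fun y => (φ y : EReal)) (μ := leb.restrict (Ioo (x - δ) (x + δ)))
  unfold osc at h ⊢
  set S := essSup (fun y => (φ y : EReal)) (leb.restrict (Ioo (x - δ) (x + δ)))
  set I := essInf (fun y => (φ y : EReal)) (leb.restrict (Ioo (x - δ) (x + δ)))
  obtain ⟨y, hyS, hyI⟩ := (hS.and hI).exists
  have hI1 : I ≠ ⊤ := fun hh => by rw [hh] at hyI; simp at hyI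
  have hS1 : S ≠ ⊥ := fun hh => by rw [hh] at hyS; simp at hyS
  have hS2 : S ≠ ⊤ := fun hh => h (by
    rw [hh, EReal.top_sub hI1]; rfl)
  have hI2 : I ≠ ⊥ := fun hh => h (by
    rw [hh, EReal.sub_bot hS1]; rfl)
  clear_value S I
  lift S to ℝ using ⟨hS2, hS1⟩
  lift I to ℝ using ⟨hI1, hI2⟩
  refine ⟨I, S, by exact_mod_cast hyI.trans hyS, ?_, ?_⟩
  · filter_upwards [hS, hI] with z h1 h2
    exact ⟨by exact_mod_cast h2, by exact_mod_cast h1⟩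
  · rw [← EReal.coe_sub, EReal.real_coe_toENNReal]

lemma osc_le_of_ae_sub_le {φ : ℝ → ℝ} {δ x r : ℝ}
    (h : ∀ᵐ y ∂leb.restrict (Ioo (x - δ) (x + δ)),
      ∀ᵐ z ∂leb.restrict (Ioo (x - δ) (x + δ)), φ y - φ z ≤ r) :
    osc φ δ x ≤ ENNReal.ofReal r := by
  by_cases h0 : leb.restrict (Ioo (x - δ) (x + δ)) = 0
  · refine (osc_le_of_ae_bounds (u := 0) (v := 0) ?_).trans (by simp)
    rw [h0]; simp
  have : NeZero (leb.restrict (Ioo (x - δ) (x + δ))) := ⟨h0⟩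
  have hI := ae_essInf_le (f := fun y => (φ y : EReal)) (μ := leb.restrict (Ioo (x - δ) (x + δ)))
  have h3 : ∀ᵐ y ∂leb.restrict (Ioo (x - δ) (x + δ)),
      ((φ y - r : ℝ) : EReal) ≤
        essInf (fun y => (φ y : EReal)) (leb.restrict (Ioo (x - δ) (x + δ))) := by
    filter_upwards [h] with y hy
    refine le_essInf_of_ae_le _ ?_
    filter_upwards [hy] with z hz
    exact_mod_cast (by linarith : φ y - r ≤ φ z)
  set I := essInf (fun y => (φ y : EReal)) (leb.restrict (Ioo (x - δ) (x + δ)))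
  obtain ⟨y, hy1, hy2⟩ := (h3.and hI).exists
  have hI1 : I ≠ ⊤ := fun hh => by rw [hh] at hy2; simp at hy2
  have hI2 : I ≠ ⊥ := fun hh => by
    rw [hh] at hy1; exact EReal.coe_ne_bot _ (le_bot_iff.1 hy1)
  clear_value I
  lift I to ℝ using ⟨hI1, hI2⟩
  refine (osc_le_of_ae_bounds (u := I) (v := I + r) ?_).trans (by simp)
  filter_upwards [h3, hI] with z h1 h2
  exact ⟨by exact_mod_cast h2, by have : φ z - r ≤ I := by exact_mod_cast h1
                                  linarith⟩

lemma ae_sub_le_of_osc {φ : ℝ → ℝ} {δ x : ℝ} (hx : x ∈ Icc (0 : ℝ) 1) (hδ : 0 < δ)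
    (h : osc φ δ x ≠ ⊤) :
    ∀ᵐ y ∂leb.restrict (Ioo (x - δ) (x + δ)),
      ∀ᵐ z ∂leb.restrict (Ioo (x - δ) (x + δ)), |φ y - φ z| ≤ (osc φ δ x).toReal := by
  obtain ⟨u, v, huv, hb, he⟩ := exists_bounds_of_osc_ne_top hx hδ h
  rw [← he, ENNReal.toReal_ofReal (by linarith)]
  filter_upwards [hb] with y hy
  filter_upwards [hb] with z hz
  rw [abs_le]; constructor <;> linarith [hy.1, hy.2, hz.1, hz.2]

lemma osc_congr {φ ψ : ℝ → ℝ} (h : φ =ᵐ[leb] ψ) (δ x : ℝ) : osc φ δ x = osc ψ δ x := by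
  have h' : (fun y => (φ y : EReal)) =ᵐ[leb.restrict (Ioo (x - δ) (x + δ))]
      fun y => (ψ y : EReal) := by
    filter_upwards [ae_restrict_of_ae h] with y hy
    rw [hy]
  rw [osc, osc, essSup_congr_ae h', essInf_congr_ae h']

lemma osc_const (c δ x : ℝ) : osc (fun _ => c) δ x = 0 := by
  have := osc_le_of_ae_bounds (φ := fun _ => c) (δ := δ) (x := x) (u := c) (v := c) (by simp)
  simpa using this

/-- If the increments of `φ` are dominated by those of `f` and `g`, so are the oscillations. This
one lemma gives the behaviour of `osc` under sums, scalar multiples, absolute values and products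
of bounded functions. -/
lemma osc_le_of_increments {φ f g : ℝ → ℝ} {δ x a b : ℝ} (hx : x ∈ Icc (0 : ℝ) 1) (hδ : 0 < δ)
    (ha : 0 < a) (hb : 0 < b)
    (h : ∀ᵐ y ∂leb, ∀ᵐ z ∂leb, |φ y - φ z| ≤ a * |f y - f z| + b * |g y - g z|) :
    osc φ δ x ≤ ENNReal.ofReal a * osc f δ x + ENNReal.ofReal b * osc g δ x := by
  by_cases hf : osc f δ x = ⊤
  · rw [hf, ENNReal.mul_top (by simpa using ha)]; simp
  by_cases hg : osc g δ x = ⊤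
  · rw [hg, ENNReal.mul_top (by simpa using hb)]; simp
  have : ENNReal.ofReal a * osc f δ x + ENNReal.ofReal b * osc g δ x =
      ENNReal.ofReal (a * (osc f δ x).toReal + b * (osc g δ x).toReal) := by
    rw [ENNReal.ofReal_add (by positivity) (by positivity), ENNReal.ofReal_mul ha.le,
      ENNReal.ofReal_mul hb.le, ENNReal.ofReal_toReal hf, ENNReal.ofReal_toReal hg]
  rw [this]
  apply osc_le_of_ae_sub_le
  filter_upwards [ae_sub_le_of_osc hx hδ hf, ae_sub_le_of_osc hx hδ hg, ae_restrict_of_ae h]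
    with y h1 h2 h3
  filter_upwards [h1, h2, ae_restrict_of_ae h3] with z h4 h5 h6
  have := mul_le_mul_of_nonneg_left h4 ha.le
  have := mul_le_mul_of_nonneg_left h5 hb.le
  linarith [le_abs_self (φ y - φ z)]

/-- The essential supremum over a sliding window exceeds `c` iff the window meets the set `{c < f}`
in positive measure, a condition that persists under small shifts of the window. -/
lemma measurable_essSup_Ioo (f : ℝ → EReal) (δ : ℝ) :
    Measurable fun x => essSup f (leb.restrict (Ioo (x - δ) (x + δ))) := by
  have key : ∀ (c : EReal) (x : ℝ), c < essSup f (leb.restrict (Ioo (x - δ) (x + δ))) ↔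
      leb ({y | c < f y} ∩ Ioo (x - δ) (x + δ)) ≠ 0 := by
    intro c x
    rw [← not_le, ← not_iff_not, not_not, not_not]
    have : essSup f (leb.restrict (Ioo (x - δ) (x + δ))) ≤ c ↔
        ∀ᵐ y ∂leb.restrict (Ioo (x - δ) (x + δ)), f y ≤ c :=
      ⟨fun h => by
        filter_upwards [ae_le_essSup (f := f) (μ := leb.restrict (Ioo (x - δ) (x + δ)))] with y hy
        exact hy.trans h, fun h => essSup_le_of_ae_le _ h⟩
    rw [this, ae_iff, Measure.restrict_apply' measurableSet_Ioo]
    simp only [not_le]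
  apply measurable_of_Ioi
  intro c
  apply IsOpen.measurableSet
  rw [isOpen_iff_mem_nhds]
  intro x hx
  rw [mem_preimage, mem_Ioi, key] at hx
  have hU : ({y | c < f y} ∩ Ioo (x - δ) (x + δ)) =
      ⋃ n : ℕ, {y | c < f y} ∩ Ioo (x - δ + 1 / (n + 1 : ℝ)) (x + δ - 1 / (n + 1 : ℝ)) := by
    ext y
    simp only [mem_inter_iff, mem_Ioo, mem_iUnion, mem_ofPred_eq]
    constructor
    · rintro ⟨h1, h2, h3⟩
      obtain ⟨n, hn⟩ := exists_nat_one_div_lt (lt_min (sub_pos.2 h2) (sub_pos.2 h3))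
      have h4 := hn.trans_le (min_le_left _ _)
      have h5 := hn.trans_le (min_le_right _ _)
      exact ⟨n, h1, by linarith, by linarith⟩
    · rintro ⟨n, h1, h2, h3⟩
      have : 0 < 1 / (n + 1 : ℝ) := by positivity
      exact ⟨h1, by linarith, by linarith⟩
  rw [hU, Ne, measure_iUnion_null_iff, not_forall] at hx
  obtain ⟨n, hn⟩ := hx
  have hpos : 0 < 1 / (n + 1 : ℝ) := by positivity
  filter_upwards [Metric.ball_mem_nhds x hpos] with x' hx'
  rw [mem_preimage, mem_Ioi, key]
  intro h0
  apply hn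
  refine measure_mono_null (inter_subset_inter_right _ ?_) h0
  rw [Metric.mem_ball, Real.dist_eq, abs_lt] at hx'
  intro y hy
  exact ⟨by linarith [hy.1], by linarith [hy.2]⟩

lemma measurable_osc (φ : ℝ → ℝ) (δ : ℝ) : Measurable (osc φ δ) := by
  have h1 := measurable_essSup_Ioo (fun y => (φ y : EReal)) δ
  have h2 := measurable_essSup_Ioo (fun y => -(φ y : EReal)) δ
  have h3 : ∀ x, essInf (fun y => (φ y : EReal)) (leb.restrict (Ioo (x - δ) (x + δ))) =
      - essSup (fun y => -(φ y : EReal)) (leb.restrict (Ioo (x - δ) (x + δ))) := by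
    intro x
    apply le_antisymm
    · rw [EReal.le_neg]
      refine essSup_le_of_ae_le _ ?_
      filter_upwards [ae_essInf_le (f := fun y => (φ y : EReal))
        (μ := leb.restrict (Ioo (x - δ) (x + δ)))] with y hy
      exact EReal.neg_le_neg_iff.2 hy
    · refine le_essInf_of_ae_le _ ?_
      filter_upwards [ae_le_essSup (f := fun y => -(φ y : EReal))
        (μ := leb.restrict (Ioo (x - δ) (x + δ)))] with y hy
      exact EReal.neg_le.1 hy
  have : osc φ δ = fun x => (essSup (fun y => (φ y : EReal)) (leb.restrict (Ioo (x - δ) (x + δ))) +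
      essSup (fun y => -(φ y : EReal)) (leb.restrict (Ioo (x - δ) (x + δ)))).toENNReal := by
    funext x
    rw [osc, h3 x, sub_eq_add_neg, neg_neg]
  rw [this]
  exact (h1.add h2).ereal_toENNReal

/-- Lower semicontinuity of the oscillation under almost everywhere convergence. -/
lemma osc_le_liminf {φ : ℕ → ℝ → ℝ} {ψ : ℝ → ℝ} {δ x : ℝ} (hx : x ∈ Icc (0 : ℝ) 1) (hδ : 0 < δ)
    (h : ∀ᵐ y ∂leb, Tendsto (fun n => φ n y) atTop (𝓝 (ψ y))) :
    osc ψ δ x ≤ liminf (fun n => osc (φ n) δ x) atTop := by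
  apply le_of_forall_gt_imp_ge_of_dense
  intro c hc
  rcases eq_or_ne c ⊤ with rfl | hct
  · exact le_top
  have hfr : ∃ᶠ n in atTop, osc (φ n) δ x < c := frequently_lt_of_liminf_lt (by isBoundedDefault) hc
  rw [← ENNReal.ofReal_toReal hct]
  apply osc_le_of_ae_sub_le
  have hall : ∀ᵐ y ∂leb.restrict (Ioo (x - δ) (x + δ)), ∀ n, osc (φ n) δ x < c →
      ∀ᵐ z ∂leb.restrict (Ioo (x - δ) (x + δ)), |φ n y - φ n z| ≤ c.toReal := by
    rw [ae_all_iff]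
    intro n
    by_cases hn : osc (φ n) δ x < c
    · filter_upwards [ae_sub_le_of_osc hx hδ (hn.ne_top)] with y hy _
      filter_upwards [hy] with z hz
      exact hz.trans (ENNReal.toReal_mono hct hn.le)
    · exact Eventually.of_forall fun y hh => absurd hh hn
  filter_upwards [hall, ae_restrict_of_ae h] with y hy hty
  have hy' : ∀ᵐ z ∂leb.restrict (Ioo (x - δ) (x + δ)), ∀ n, osc (φ n) δ x < c →
      |φ n y - φ n z| ≤ c.toReal := by
    rw [ae_all_iff]
    intro n
    by_cases hn : osc (φ n) δ x < c
    · filter_upwards [hy n hn] with z hz _ using hz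
    · exact Eventually.of_forall fun y hh => absurd hh hn
  filter_upwards [hy', ae_restrict_of_ae h] with z hz htz
  refine le_of_tendsto_of_frequently (hty.sub htz) (hfr.mono fun n hn => ?_)
  exact (le_abs_self _).trans (hz n hn)

/-! ### The seminorm of generalised bounded variation -/

lemma gbvSeminorm_congr {α A : ℝ} {φ ψ : ℝ → ℝ} (h : φ =ᵐ[leb] ψ) :
    gbvSeminorm α A φ = gbvSeminorm α A ψ := by
  simp only [gbvSeminorm, osc_congr h]

lemma gbvNorm_congr {α A : ℝ} {φ ψ : ℝ → ℝ} (h : φ =ᵐ[leb] ψ) :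
    gbvNorm α A φ = gbvNorm α A ψ := by
  rw [gbvNorm, gbvNorm, gbvSeminorm_congr h, eLpNorm_congr_ae h]

lemma ae_mem_Icc_leb : ∀ᵐ x ∂leb, x ∈ Icc (0 : ℝ) 1 := ae_restrict_mem measurableSet_Icc

lemma lintegral_osc_le {α A : ℝ} {φ : ℝ → ℝ} {δ : ℝ} (hδ : 0 < δ) (hδA : δ ≤ A) :
    ∫⁻ x, osc φ δ x ∂leb ≤ gbvSeminorm α A φ * ENNReal.ofReal (δ ^ α) := by
  have h : (∫⁻ x, osc φ δ x ∂leb) / ENNReal.ofReal (δ ^ α) ≤ gbvSeminorm α A φ :=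
    le_iSup₂ (f := fun δ (_ : δ ∈ Ioc (0 : ℝ) A) =>
      (∫⁻ x, osc φ δ x ∂leb) / ENNReal.ofReal (δ ^ α)) δ ⟨hδ, hδA⟩
  rwa [ENNReal.div_le_iff (by simpa using Real.rpow_pos_of_pos hδ α) ENNReal.ofReal_ne_top] at h

lemma gbvSeminorm_le {α A : ℝ} {φ : ℝ → ℝ} {R : ℝ≥0∞}
    (h : ∀ δ ∈ Ioc (0 : ℝ) A, ∫⁻ x, osc φ δ x ∂leb ≤ R * ENNReal.ofReal (δ ^ α)) :
    gbvSeminorm α A φ ≤ R := by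
  refine iSup₂_le fun δ hδ => ?_
  rw [ENNReal.div_le_iff (by simpa using Real.rpow_pos_of_pos hδ.1 α) ENNReal.ofReal_ne_top]
  exact h δ hδ

lemma gbvSeminorm_le_of_increments {α A : ℝ} {φ f g : ℝ → ℝ} {a b : ℝ} (ha : 0 < a) (hb : 0 < b)
    (h : ∀ᵐ y ∂leb, ∀ᵐ z ∂leb, |φ y - φ z| ≤ a * |f y - f z| + b * |g y - g z|) :
    gbvSeminorm α A φ ≤
      ENNReal.ofReal a * gbvSeminorm α A f + ENNReal.ofReal b * gbvSeminorm α A g := by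
  apply gbvSeminorm_le
  intro δ hδ
  calc ∫⁻ x, osc φ δ x ∂leb
      ≤ ∫⁻ x, (ENNReal.ofReal a * osc f δ x + ENNReal.ofReal b * osc g δ x) ∂leb := by
        apply lintegral_mono_ae
        filter_upwards [ae_mem_Icc_leb] with x hx
        exact osc_le_of_increments hx hδ.1 ha hb h
    _ = ENNReal.ofReal a * (∫⁻ x, osc f δ x ∂leb) + ENNReal.ofReal b * ∫⁻ x, osc g δ x ∂leb := by
        rw [lintegral_add_left ((measurable_osc f δ).const_mul _),
          lintegral_const_mul _ (measurable_osc f δ), lintegral_const_mul _ (measurable_osc g δ)]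
    _ ≤ ENNReal.ofReal a * (gbvSeminorm α A f * ENNReal.ofReal (δ ^ α)) +
          ENNReal.ofReal b * (gbvSeminorm α A g * ENNReal.ofReal (δ ^ α)) := by
        gcongr
        · exact lintegral_osc_le hδ.1 hδ.2
        · exact lintegral_osc_le hδ.1 hδ.2
    _ = _ := by ring

lemma gbvSeminorm_const (α A c : ℝ) : gbvSeminorm α A (fun _ => c) = 0 := by
  refine le_antisymm (gbvSeminorm_le fun δ _ => ?_) bot_le
  simp [osc_const]

lemma gbvSeminorm_add_le (α A : ℝ) (f g : ℝ → ℝ) :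
    gbvSeminorm α A (fun x => f x + g x) ≤ gbvSeminorm α A f + gbvSeminorm α A g := by
  have := gbvSeminorm_le_of_increments (α := α) (A := A) (φ := fun x => f x + g x) (f := f) (g := g)
    one_pos one_pos (Eventually.of_forall fun y => Eventually.of_forall fun z => by
      rw [one_mul, one_mul, add_sub_add_comm]; exact abs_add_le _ _)
  simpa using this

lemma gbvSeminorm_le_of_increments_left {α A : ℝ} {φ f : ℝ → ℝ} {a : ℝ} (ha : 0 < a)
    (h : ∀ᵐ y ∂leb, ∀ᵐ z ∂leb, |φ y - φ z| ≤ a * |f y - f z|) :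
    gbvSeminorm α A φ ≤ ENNReal.ofReal a * gbvSeminorm α A f := by
  have := gbvSeminorm_le_of_increments (α := α) (A := A) (φ := φ) (f := f) (g := fun _ => (0 : ℝ))
    ha one_pos (by simpa using h)
  simpa [gbvSeminorm_const] using this

lemma gbvSeminorm_abs_le (α A : ℝ) (f : ℝ → ℝ) :
    gbvSeminorm α A (fun x => |f x|) ≤ gbvSeminorm α A f := by
  simpa using gbvSeminorm_le_of_increments_left (α := α) (A := A) (φ := fun x => |f x|) (f := f)
    one_pos (Eventually.of_forall fun y => Eventually.of_forall fun z => by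
      rw [one_mul]; exact abs_abs_sub_abs_le_abs_sub _ _)

lemma gbvSeminorm_const_mul_le (α A c : ℝ) (f : ℝ → ℝ) :
    gbvSeminorm α A (fun x => c * f x) ≤ ENNReal.ofReal |c| * gbvSeminorm α A f := by
  rcases eq_or_ne c 0 with rfl | hc
  · simp [gbvSeminorm_const]
  · exact gbvSeminorm_le_of_increments_left (abs_pos.2 hc)
      (Eventually.of_forall fun y => Eventually.of_forall fun z => by
        rw [← mul_sub, abs_mul])

lemma gbvSeminorm_mul_le {α A : ℝ} {f g : ℝ → ℝ} {M M' : ℝ} (hM : 0 < M) (hM' : 0 < M')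
    (hf : ∀ᵐ x ∂leb, |f x| ≤ M) (hg : ∀ᵐ x ∂leb, |g x| ≤ M') :
    gbvSeminorm α A (fun x => f x * g x) ≤
      ENNReal.ofReal M' * gbvSeminorm α A f + ENNReal.ofReal M * gbvSeminorm α A g := by
  apply gbvSeminorm_le_of_increments hM' hM
  filter_upwards [hf] with y hy
  filter_upwards [hg] with z hz
  have : f y * g y - f z * g z = (f y - f z) * g z + f y * (g y - g z) := by ring
  rw [this]
  refine (abs_add_le _ _).trans ?_
  rw [abs_mul, abs_mul, mul_comm (|f y - f z|)]
  gcongr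

/-- Lower semicontinuity of the seminorm, by Fatou's lemma. -/
lemma gbvSeminorm_le_of_tendsto_ae {α A : ℝ} {φ : ℕ → ℝ → ℝ} {ψ : ℝ → ℝ} {R : ℝ≥0∞}
    (h : ∀ᵐ y ∂leb, Tendsto (fun n => φ n y) atTop (𝓝 (ψ y)))
    (hR : ∀ n, gbvSeminorm α A (φ n) ≤ R) : gbvSeminorm α A ψ ≤ R := by
  apply gbvSeminorm_le
  intro δ hδ
  calc ∫⁻ x, osc ψ δ x ∂leb ≤ ∫⁻ x, liminf (fun n => osc (φ n) δ x) atTop ∂leb := by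
        apply lintegral_mono_ae
        filter_upwards [ae_mem_Icc_leb] with x hx
        exact osc_le_liminf hx hδ.1 h
    _ ≤ liminf (fun n => ∫⁻ x, osc (φ n) δ x ∂leb) atTop :=
        lintegral_liminf_le fun n => measurable_osc _ _
    _ ≤ R * ENNReal.ofReal (δ ^ α) := by
        refine liminf_le_of_frequently_le' (Frequently.of_forall fun n => ?_)
        exact (lintegral_osc_le hδ.1 hδ.2).trans (mul_le_mul_left (hR n) _)

/-! ### Uniform partitions of the unit interval -/

/-- The `j`-th cell of the partition of the unit interval into `N` intervals of equal length. -/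
def cell (N j : ℕ) : Set ℝ := Ioc ((j : ℝ) / N) ((j + 1 : ℝ) / N)

lemma measurableSet_cell (N j : ℕ) : MeasurableSet (cell N j) := measurableSet_Ioc

lemma disjoint_cell {N : ℕ} (hN : 0 < N) {i j : ℕ} (hij : i ≠ j) :
    Disjoint (cell N i) (cell N j) := by
  have hN' : (0 : ℝ) < N := by exact_mod_cast hN
  have key : ∀ i j : ℕ, i < j → Disjoint (cell N i) (cell N j) := by
    intro i j h
    apply Ioc_disjoint_Ioc_of_le
    have : (i : ℝ) + 1 ≤ j := by exact_mod_cast h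
    gcongr
  rcases lt_or_gt_of_ne hij with h | h
  · exact key i j h
  · exact (key j i h).symm

lemma biUnion_cell {N : ℕ} (hN : 0 < N) : ⋃ j ∈ Finset.range N, cell N j = Ioc (0 : ℝ) 1 := by
  have hN' : (0 : ℝ) < N := by exact_mod_cast hN
  ext x
  simp only [mem_iUnion, Finset.mem_range, cell, mem_Ioc, exists_prop]
  constructor
  · rintro ⟨j, hj, h1, h2⟩
    have hj' : (j : ℝ) + 1 ≤ N := by exact_mod_cast hj
    refine ⟨lt_of_le_of_lt (by positivity) h1, h2.trans ?_⟩
    rw [div_le_one hN']; exact hj'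
  · rintro ⟨h0, h1⟩
    have hpos : 0 < x * N := by positivity
    have hc : 0 < ⌈x * N⌉₊ := Nat.ceil_pos.2 hpos
    have hle : ⌈x * N⌉₊ ≤ N := Nat.ceil_le.2 (by nlinarith)
    obtain ⟨j, hj⟩ := Nat.exists_eq_succ_of_ne_zero hc.ne'
    refine ⟨j, by omega, ?_, ?_⟩
    · rw [div_lt_iff₀ hN']
      exact Nat.lt_ceil.1 (by omega)
    · rw [le_div_iff₀ hN']
      have := Nat.le_ceil (x * N)
      rw [hj] at this; push_cast at this; exact this

lemma leb_eq_restrict_biUnion {N : ℕ} (hN : 0 < N) :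
    leb = volume.restrict (⋃ j ∈ Finset.range N, cell N j) := by
  rw [biUnion_cell hN, leb]
  exact (Measure.restrict_congr_set Ioc_ae_eq_Icc).symm

lemma cell_subset_Icc {N j : ℕ} (hj : j < N) : cell N j ⊆ Icc 0 1 := by
  intro x hx
  have := biUnion_cell (Nat.zero_lt_of_lt hj)
  have hx' : x ∈ ⋃ j ∈ Finset.range N, cell N j := by
    simp only [mem_iUnion, Finset.mem_range]; exact ⟨j, hj, hx⟩
  rw [this] at hx'
  exact ⟨hx'.1.le, hx'.2⟩

lemma lintegral_leb_eq_sum_cell {N : ℕ} (hN : 0 < N) (f : ℝ → ℝ≥0∞) :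
    ∫⁻ x, f x ∂leb = ∑ j ∈ Finset.range N, ∫⁻ x in cell N j, f x := by
  conv_lhs => rw [leb_eq_restrict_biUnion hN]
  exact lintegral_biUnion_finset (fun i _ j _ hij => disjoint_cell hN hij)
    (fun j _ => measurableSet_cell N j) f

lemma volume_cell {N : ℕ} (hN : 0 < N) (j : ℕ) : volume (cell N j) = ENNReal.ofReal (1 / N) := by
  have hN' : (0 : ℝ) < N := by exact_mod_cast hN
  rw [cell, Real.volume_Ioc]; congr 1; field_simp; ring

lemma cell_subset_Ioo {N j : ℕ} (hN : 0 < N) {x : ℝ} (hx : x ∈ cell N j) :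
    cell N j ⊆ Ioo (x - 1 / N) (x + 1 / N) := by
  have hN' : (0 : ℝ) < N := by exact_mod_cast hN
  intro y hy
  obtain ⟨h1, h2⟩ := hx
  obtain ⟨h3, h4⟩ := hy
  rw [add_div] at h2 h4
  exact ⟨by linarith, by linarith⟩

lemma restrict_cell_le {N j : ℕ} (hj : j < N) {x : ℝ} (hx : x ∈ cell N j) :
    volume.restrict (cell N j) ≤ leb.restrict (Ioo (x - 1 / N) (x + 1 / N)) := by
  rw [leb, Measure.restrict_restrict measurableSet_Ioo]
  exact Measure.restrict_mono (subset_inter (cell_subset_Ioo (Nat.zero_lt_of_lt hj) hx)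
    (cell_subset_Icc hj)) le_rfl

lemma volume_restrict_cell_le {N j : ℕ} (hj : j < N) : volume.restrict (cell N j) ≤ leb :=
  Measure.restrict_mono (cell_subset_Icc hj) le_rfl

lemma ae_enorm_sub_le_osc {f : ℝ → ℝ} {N j : ℕ} (hj : j < N) {x : ℝ} (hx : x ∈ cell N j) :
    ∀ᵐ y ∂volume.restrict (cell N j), ∀ᵐ z ∂volume.restrict (cell N j),
      ‖f y - f z‖ₑ ≤ osc f (1 / N) x := by
  have hN' : (0 : ℝ) < N := by exact_mod_cast Nat.zero_lt_of_lt hj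
  by_cases h : osc f (1 / N) x = ⊤
  · rw [h]; simp
  have := ae_sub_le_of_osc (cell_subset_Icc hj hx) (by positivity) h
  have hle := (restrict_cell_le hj hx).absolutelyContinuous
  filter_upwards [hle.ae_le this] with y hy
  filter_upwards [hle.ae_le hy] with z hz
  rw [← ofReal_norm, Real.norm_eq_abs, ← ENNReal.ofReal_toReal h]
  exact ENNReal.ofReal_le_ofReal hz

/-- On a cell, the mean deviation from the average is controlled by the oscillation. -/
lemma lintegral_cell_sub_average_le {f : ℝ → ℝ} (hf : Integrable f leb) {N j : ℕ} (hj : j < N) :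
    ∫⁻ y in cell N j, ‖f y - N * ∫ z in cell N j, f z‖ₑ ≤ ∫⁻ x in cell N j, osc f (1 / N) x := by
  have hN := Nat.zero_lt_of_lt hj
  have hN' : (0 : ℝ) < N := by exact_mod_cast hN
  have hint : Integrable f (volume.restrict (cell N j)) :=
    hf.mono_measure (volume_restrict_cell_le hj)
  have hvol := volume_cell hN j
  have hvr : volume.real (cell N j) = 1 / N := by
    rw [Measure.real, hvol, ENNReal.toReal_ofReal (by positivity)]
  have hfin : IsFiniteMeasure (volume.restrict (cell N j)) :=
    ⟨by rw [Measure.restrict_apply_univ, hvol]; exact ENNReal.ofReal_lt_top⟩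
  have h1 : ∀ x ∈ cell N j, ∫⁻ y in cell N j, ‖f y - N * ∫ z in cell N j, f z‖ₑ ≤
      osc f (1 / N) x * ENNReal.ofReal (1 / N) := by
    intro x hx
    calc ∫⁻ y in cell N j, ‖f y - N * ∫ z in cell N j, f z‖ₑ
        ≤ ∫⁻ y in cell N j, osc f (1 / N) x := by
          apply lintegral_mono_ae
          filter_upwards [ae_enorm_sub_le_osc hj hx (f := f)] with y hy
          have : f y - N * ∫ z in cell N j, f z = N * ∫ z in cell N j, (f y - f z) := by
            rw [integral_sub (integrable_const _) hint, integral_const, smul_eq_mul,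
              measureReal_restrict_apply_univ, hvr]
            field_simp
          rw [this, enorm_mul]
          calc ‖(N : ℝ)‖ₑ * ‖∫ z in cell N j, (f y - f z)‖ₑ
              ≤ ‖(N : ℝ)‖ₑ * ∫⁻ z in cell N j, osc f (1 / N) x := by
                gcongr
                exact (enorm_integral_le_lintegral_enorm _).trans (lintegral_mono_ae hy)
            _ = osc f (1 / N) x := by
                rw [setLIntegral_const, hvol, mul_left_comm, Real.enorm_eq_ofReal hN'.le,
                  ← ENNReal.ofReal_mul hN'.le, mul_one_div_cancel hN'.ne']
                simp
      _ = _ := by rw [setLIntegral_const, hvol]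
  have h2 : ∫⁻ x in cell N j, (∫⁻ y in cell N j, ‖f y - N * ∫ z in cell N j, f z‖ₑ) ≤
      ∫⁻ x in cell N j, osc f (1 / N) x * ENNReal.ofReal (1 / N) :=
    setLIntegral_mono' (measurableSet_cell N j) h1
  rw [setLIntegral_const, hvol, lintegral_mul_const _ (measurable_osc f _)] at h2
  exact (ENNReal.mul_le_mul_iff_left (by simpa using hN.ne') ENNReal.ofReal_ne_top).1 h2

/-- Step function approximation in `L¹` with an error of order `N ^ (-α)`. -/
lemma sum_lintegral_cell_sub_average_le {α A : ℝ} {f : ℝ → ℝ} (hf : Integrable f leb) {N : ℕ}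
    (hN : 0 < N) (hNA : 1 / (N : ℝ) ≤ A) :
    ∑ j ∈ Finset.range N, ∫⁻ y in cell N j, ‖f y - N * ∫ z in cell N j, f z‖ₑ ≤
      gbvSeminorm α A f * ENNReal.ofReal ((1 / N : ℝ) ^ α) := by
  have hN' : (0 : ℝ) < N := by exact_mod_cast hN
  calc _ ≤ ∑ j ∈ Finset.range N, ∫⁻ x in cell N j, osc f (1 / N) x :=
        Finset.sum_le_sum fun j hj => lintegral_cell_sub_average_le hf (Finset.mem_range.1 hj)
    _ = ∫⁻ x, osc f (1 / N) x ∂leb := (lintegral_leb_eq_sum_cell hN _).symm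
    _ ≤ _ := lintegral_osc_le (by positivity) hNA

/-- Functions of generalised bounded variation are essentially bounded. -/
lemma ae_enorm_le_gbvNorm {α A : ℝ} (hα : 0 ≤ α) {f : ℝ → ℝ} {N : ℕ}
    (hN : 0 < N) (hNA : 1 / (N : ℝ) ≤ A) :
    ∀ᵐ y ∂leb, ‖f y‖ₑ ≤ N * gbvNorm α A f := by
  have hN' : (0 : ℝ) < N := by exact_mod_cast hN
  have hN1 : (1 : ℝ) ≤ N := by exact_mod_cast hN
  rw [leb_eq_restrict_biUnion hN, ae_restrict_biUnion_finset_iff]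
  intro j hj
  have hj' := Finset.mem_range.1 hj
  have hvol := volume_cell hN j
  have hne : volume (cell N j) ≠ 0 := by rw [hvol]; simpa using hN.ne'
  have htop : volume (cell N j) ≠ ⊤ := by rw [hvol]; exact ENNReal.ofReal_ne_top
  obtain ⟨x, hx, hxo⟩ := exists_le_setLAverage hne htop (f := osc f (1 / N))
    (measurable_osc f _).aemeasurable
  filter_upwards [ae_enorm_sub_le_osc hj' hx (f := f)] with y hy
  have hNe : (N : ℝ≥0∞) = ENNReal.ofReal N := by simp
  have hNN : ENNReal.ofReal (1 / N) * N = 1 := by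
    rw [hNe, ← ENNReal.ofReal_mul (by positivity), one_div_mul_cancel hN'.ne', ENNReal.ofReal_one]
  have h1 : ENNReal.ofReal (1 / N) * ‖f y‖ₑ ≤ ENNReal.ofReal (1 / N) * osc f (1 / N) x +
      ∫⁻ z in cell N j, ‖f z‖ₑ := by
    calc ENNReal.ofReal (1 / N) * ‖f y‖ₑ = ∫⁻ z in cell N j, ‖f y‖ₑ := by
          rw [setLIntegral_const, hvol, mul_comm]
      _ ≤ ∫⁻ z in cell N j, (osc f (1 / N) x + ‖f z‖ₑ) := by
          apply lintegral_mono_ae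
          filter_upwards [hy] with z hz
          calc ‖f y‖ₑ = ‖(f y - f z) + f z‖ₑ := by rw [sub_add_cancel]
            _ ≤ _ := (enorm_add_le _ _).trans (by gcongr)
      _ = _ := by
          rw [lintegral_add_left measurable_const, setLIntegral_const, hvol, mul_comm]
  have h2 : ENNReal.ofReal (1 / N) * osc f (1 / N) x ≤ gbvSeminorm α A f := by
    rw [setLAverage_eq, hvol] at hxo
    calc ENNReal.ofReal (1 / N) * osc f (1 / N) x
        ≤ ENNReal.ofReal (1 / N) * ((∫⁻ x in cell N j, osc f (1 / N) x) /
            ENNReal.ofReal (1 / N)) := by gcongr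
      _ = ∫⁻ x in cell N j, osc f (1 / N) x :=
          ENNReal.mul_div_cancel (by simpa using hN.ne') ENNReal.ofReal_ne_top
      _ ≤ ∫⁻ x, osc f (1 / N) x ∂leb := lintegral_mono' (volume_restrict_cell_le hj') le_rfl
      _ ≤ gbvSeminorm α A f * ENNReal.ofReal ((1 / N : ℝ) ^ α) :=
          lintegral_osc_le (by positivity) hNA
      _ ≤ gbvSeminorm α A f * 1 := by
          gcongr
          rw [← ENNReal.ofReal_one]
          apply ENNReal.ofReal_le_ofReal
          apply Real.rpow_le_one (by positivity) _ hα
          rw [div_le_one hN']; exact hN1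
      _ = _ := mul_one _
  have h3 : ∫⁻ z in cell N j, ‖f z‖ₑ ≤ eLpNorm f 1 leb := by
    rw [eLpNorm_one_eq_lintegral_enorm]
    exact lintegral_mono' (volume_restrict_cell_le hj') le_rfl
  calc ‖f y‖ₑ = N * (ENNReal.ofReal (1 / N) * ‖f y‖ₑ) := by
        rw [← mul_assoc, mul_comm (N : ℝ≥0∞), hNN, one_mul]
    _ ≤ N * gbvNorm α A f := by
        gcongr
        exact h1.trans (add_le_add h2 h3)

/-! ### Compactness in `L¹` -/

/-- The space `L¹` of the unit interval. -/
abbrev L1 : Type := Lp ℝ 1 leb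

/-- The functions in `L¹` with seminorm `|f|_α` and `L¹` norm at most `R`. -/
def gbvBall (α A R : ℝ) : Set L1 :=
  {f | gbvSeminorm α A f ≤ ENNReal.ofReal R ∧ ‖f‖ ≤ R}

lemma isClosed_gbvBall (α A R : ℝ) : IsClosed (gbvBall α A R) := by
  apply IsSeqClosed.isClosed
  intro f g hf hg
  refine ⟨?_, le_of_tendsto hg.norm (Eventually.of_forall fun n => (hf n).2)⟩
  obtain ⟨ns, -, hns⟩ := (tendstoInMeasure_of_tendsto_Lp hg).exists_seq_tendsto_ae
  exact gbvSeminorm_le_of_tendsto_ae hns fun n => (hf _).1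

/-- The element `∑ c_j 1_{cell N j}` of `L¹`. -/
def stepL1 (N : ℕ) (c : Fin N → ℝ) : L1 :=
  ∑ j : Fin N, c j • indicatorConstLp 1 (μ := leb) (measurableSet_cell N j) (measure_ne_top _ _) 1

lemma continuous_stepL1 (N : ℕ) : Continuous (stepL1 N) := by
  unfold stepL1; fun_prop

lemma coeFn_stepL1 (N : ℕ) (c : Fin N → ℝ) :
    stepL1 N c =ᵐ[leb] fun x => ∑ j : Fin N, c j * (cell N j).indicator (fun _ => 1) x := by
  have h : ∀ s : Finset (Fin N), (∑ j ∈ s, c j • indicatorConstLp 1 (μ := leb)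
      (measurableSet_cell N j) (measure_ne_top _ _) (1 : ℝ) : L1) =ᵐ[leb]
      fun x => ∑ j ∈ s, c j * (cell N j).indicator (fun _ => 1) x := by
    intro s
    induction s using Finset.cons_induction with
    | empty => simp only [Finset.sum_empty]; exact Lp.coeFn_zero _ _ _
    | cons a s ha ih =>
      simp only [Finset.sum_cons]
      filter_upwards [ih, Lp.coeFn_add (c a • indicatorConstLp 1 (μ := leb)
        (measurableSet_cell N a) (measure_ne_top _ _) (1 : ℝ) : L1) (∑ j ∈ s, c j •
        indicatorConstLp 1 (μ := leb) (measurableSet_cell N j) (measure_ne_top _ _) (1 : ℝ) : L1),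
        Lp.coeFn_smul (c a) (indicatorConstLp 1 (μ := leb)
        (measurableSet_cell N a) (measure_ne_top _ _) (1 : ℝ) : L1),
        indicatorConstLp_coeFn (p := 1) (μ := leb) (hs := measurableSet_cell N a)
          (hμs := measure_ne_top _ _) (c := (1 : ℝ))] with x h1 h2 h3 h4
      rw [h2, Pi.add_apply, h3, Pi.smul_apply, h4, h1, smul_eq_mul]
  exact h Finset.univ

lemma norm_sub_stepL1_le {α A R : ℝ} (hR : 0 ≤ R) {N : ℕ} (hN : 0 < N) (hNA : 1 / (N : ℝ) ≤ A)
    {f : L1} (hf : f ∈ gbvBall α A R) :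
    ‖f - stepL1 N (fun j => N * ∫ z in cell N j, f z)‖ ≤ R * (1 / N : ℝ) ^ α := by
  have hN' : (0 : ℝ) < N := by exact_mod_cast hN
  have hpow : 0 ≤ (1 / N : ℝ) ^ α := by positivity
  rw [L1.norm_sub_eq_lintegral]
  apply ENNReal.toReal_le_of_le_ofReal (by positivity)
  rw [ENNReal.ofReal_mul hR]
  refine le_trans ?_ (mul_le_mul_left hf.1 _)
  refine le_trans (le_of_eq ?_)
    (sum_lintegral_cell_sub_average_le (L1.integrable_coeFn f) hN hNA)
  rw [lintegral_leb_eq_sum_cell hN]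
  refine Finset.sum_congr rfl fun j hj => ?_
  have hj' := Finset.mem_range.1 hj
  apply lintegral_congr_ae
  filter_upwards [(volume_restrict_cell_le hj').absolutelyContinuous.ae_le
    (coeFn_stepL1 N fun j => N * ∫ z in cell N j, f z),
    ae_restrict_mem (measurableSet_cell N j)] with x hx hxj
  rw [hx, Finset.sum_eq_single (⟨j, hj'⟩ : Fin N)]
  · rw [indicator_of_mem hxj, mul_one]
  · intro i _ hi
    have : x ∉ cell N i := fun hxi =>
      (disjoint_cell hN (fun h => hi (Fin.ext h))).notMem_of_mem_left hxi hxj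
    rw [indicator_of_notMem this, mul_zero]
  · simp

/-- Balls of `V_α` are compact in `L¹`: they are closed by Fatou's lemma, and totally bounded
because step functions on a fine partition approximate their elements uniformly. -/
lemma isCompact_gbvBall {α A R : ℝ} (hα : 0 < α) (hA : 0 < A) (hR : 0 ≤ R) :
    IsCompact (gbvBall α A R) := by
  rw [isCompact_iff_totallyBounded_isComplete]
  refine ⟨?_, (isClosed_gbvBall α A R).isComplete⟩
  rw [Metric.totallyBounded_iff]
  intro ε hε
  have hlim : Tendsto (fun n : ℕ => R * (1 / ((n : ℝ) + 1)) ^ α) atTop (𝓝 (R * 0 ^ α)) :=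
    (tendsto_one_div_add_atTop_nhds_zero_nat.rpow_const (Or.inr hα.le)).const_mul R
  rw [Real.zero_rpow hα.ne', mul_zero] at hlim
  have hlim2 := tendsto_one_div_add_atTop_nhds_zero_nat (𝕜 := ℝ)
  obtain ⟨n, hn1, hn2⟩ := ((hlim.eventually_lt_const (half_pos hε)).and
    (hlim2.eventually_le_const hA)).exists
  set N := n + 1 with hNdef
  have hcast : ((n : ℝ) + 1) = (N : ℝ) := by simp [hNdef]
  rw [hcast] at hn1 hn2
  have hN : 0 < N := Nat.succ_pos n
  have hcpt : IsCompact (stepL1 N '' univ.pi fun _ => Icc (-(N * R)) (N * R)) :=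
    (isCompact_univ_pi fun _ => isCompact_Icc).image (continuous_stepL1 N)
  obtain ⟨t, ht, htc⟩ := Metric.totallyBounded_iff.1 hcpt.totallyBounded (ε / 2) (half_pos hε)
  refine ⟨t, ht, fun f hf => ?_⟩
  have hmem : stepL1 N (fun j => N * ∫ z in cell N j, f z) ∈
      stepL1 N '' univ.pi fun _ => Icc (-(N * R)) (N * R) := by
    refine mem_image_of_mem _ fun j _ => ?_
    rw [mem_Icc, ← abs_le, abs_mul, Nat.abs_cast]
    gcongr
    calc |∫ z in cell N j, f z| ≤ ∫ z in cell N j, ‖f z‖ := by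
          rw [← Real.norm_eq_abs]; exact norm_integral_le_integral_norm _
      _ ≤ ∫ z, ‖f z‖ ∂leb := integral_mono_measure (volume_restrict_cell_le j.2)
          (Eventually.of_forall fun _ => norm_nonneg _) (L1.integrable_coeFn f).norm
      _ ≤ R := by rw [← L1.norm_eq_integral_norm]; exact hf.2
  have := htc hmem
  simp only [mem_iUnion, Metric.mem_ball, exists_prop] at this ⊢
  obtain ⟨y, hy, hd⟩ := this
  refine ⟨y, hy, ?_⟩
  calc dist f y ≤ dist f (stepL1 N (fun j => N * ∫ z in cell N j, f z)) +
        dist (stepL1 N (fun j => N * ∫ z in cell N j, f z)) y := dist_triangle _ _ _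
    _ < ε / 2 + ε / 2 := by
        refine add_lt_add ?_ hd
        rw [dist_eq_norm]
        exact (norm_sub_stepL1_le hR hN hn2 hf).trans_lt hn1
    _ = ε := add_halves ε

/-! ### The transfer operator of a piecewise expanding map -/

/-- A map `T` of the unit interval with partition points `c 0 = 0 < c 1 < ⋯ < c p = 1` that is
differentiable with `|T'| ≥ 1` on every branch interval. -/
structure IsBranched {p : ℕ} (T : ℝ → ℝ) (c : Fin (p + 1) → ℝ) : Prop where
  mapsTo : MapsTo T (Icc 0 1) (Icc 0 1)
  zero : c 0 = 0
  last : c (Fin.last p) = 1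
  strictMono : StrictMono c
  differentiableOn : ∀ k : Fin p, DifferentiableOn ℝ T (Ioo (c k.castSucc) (c k.succ))
  one_le_deriv : ∀ k : Fin p, ∀ x ∈ Ioo (c k.castSucc) (c k.succ), 1 ≤ |deriv T x|

namespace IsBranched

variable {p : ℕ} {T : ℝ → ℝ} {c : Fin (p + 1) → ℝ}

lemma branch_subset (h : IsBranched T c) (k : Fin p) :
    Ioo (c k.castSucc) (c k.succ) ⊆ Icc 0 1 := by
  intro x hx
  have h0 : c 0 ≤ c k.castSucc := h.strictMono.monotone (Fin.zero_le _)
  have h1 : c k.succ ≤ c (Fin.last p) := h.strictMono.monotone (Fin.le_last _)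
  rw [h.zero] at h0
  rw [h.last] at h1
  exact ⟨by linarith [hx.1], by linarith [hx.2]⟩

lemma exists_branch (h : IsBranched T c) {x : ℝ} (hx : x ∈ Icc (0 : ℝ) 1) (hc : x ∉ range c) :
    ∃ k : Fin p, x ∈ Ioo (c k.castSucc) (c k.succ) := by
  by_contra! hcon
  have key : ∀ k : Fin (p + 1), c k < x := by
    intro k
    induction k using Fin.induction with
    | zero =>
      rw [h.zero]
      refine lt_of_le_of_ne hx.1 fun h0 => hc ⟨0, ?_⟩
      rw [h.zero]; exact h0
    | succ k ih =>
      have : ¬ x < c k.succ := fun hlt => hcon k ⟨ih, hlt⟩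
      exact lt_of_le_of_ne (not_lt.1 this) fun h0 => hc ⟨_, h0⟩
  have := key (Fin.last p)
  rw [h.last] at this
  linarith [hx.2]

lemma notMem_range (h : IsBranched T c) {x : ℝ} {k : Fin p}
    (hx : x ∈ Ioo (c k.castSucc) (c k.succ)) : x ∉ range c := by
  rintro ⟨j, rfl⟩
  have h1 := h.strictMono.lt_iff_lt.1 hx.1
  have h2 := h.strictMono.lt_iff_lt.1 hx.2
  rw [Fin.lt_def] at h1 h2
  simp at h1 h2
  omega

lemma disjoint_branch (h : IsBranched T c) {i j : Fin p} (hij : i ≠ j) :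
    Disjoint (Ioo (c i.castSucc) (c i.succ)) (Ioo (c j.castSucc) (c j.succ)) := by
  have key : ∀ i j : Fin p, i < j →
      Disjoint (Ioo (c i.castSucc) (c i.succ)) (Ioo (c j.castSucc) (c j.succ)) := by
    intro i j hlt
    refine Set.disjoint_left.2 fun x hx hy => ?_
    have : c i.succ ≤ c j.castSucc := h.strictMono.monotone (by
      rw [Fin.le_def]; simpa using hlt)
    linarith [hx.2, hy.1]
  rcases lt_or_gt_of_ne hij with hlt | hlt
  · exact key i j hlt
  · exact (key j i hlt).symm

lemma leb_eq (h : IsBranched T c) :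
    leb = volume.restrict (⋃ k ∈ (Finset.univ : Finset (Fin p)),
      Ioo (c k.castSucc) (c k.succ)) := by
  refine (Measure.restrict_congr_set ?_).symm
  have hfin : volume (range c) = 0 := (finite_range c).measure_zero _
  have hae : ∀ᵐ x : ℝ, x ∉ range c := measure_eq_zero_iff_ae_notMem.1 hfin
  filter_upwards [hae] with x hx
  apply propext
  change x ∈ (⋃ k ∈ (Finset.univ : Finset (Fin p)), Ioo (c k.castSucc) (c k.succ)) ↔ x ∈ Icc 0 1
  simp only [mem_iUnion, exists_prop, Finset.mem_univ, true_and]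
  exact ⟨fun ⟨k, hk⟩ => h.branch_subset k hk, fun hI => h.exists_branch hI hx⟩

lemma hasDerivAt (h : IsBranched T c) {k : Fin p} {x : ℝ}
    (hx : x ∈ Ioo (c k.castSucc) (c k.succ)) : HasDerivAt T (deriv T x) x :=
  ((h.differentiableOn k).differentiableAt (isOpen_Ioo.mem_nhds hx)).hasDerivAt

lemma injOn (h : IsBranched T c) (k : Fin p) : InjOn T (Ioo (c k.castSucc) (c k.succ)) := by
  have key : ∀ x ∈ Ioo (c k.castSucc) (c k.succ), ∀ y ∈ Ioo (c k.castSucc) (c k.succ), x < y →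
      T x ≠ T y := by
    intro x hx y hy hlt he
    have hsub : Icc x y ⊆ Ioo (c k.castSucc) (c k.succ) := fun z hz =>
      ⟨hx.1.trans_le hz.1, hz.2.trans_lt hy.2⟩
    obtain ⟨z, hz, hz0⟩ := exists_deriv_eq_zero hlt
      ((h.differentiableOn k).continuousOn.mono hsub) he
    have := h.one_le_deriv k z (hsub ⟨hz.1.le, hz.2.le⟩)
    rw [hz0] at this
    simp at this
    linarith
  intro x hx y hy he
  rcases lt_trichotomy x y with hlt | heq | hgt
  · exact absurd he (key x hx y hy hlt)
  · exact heq
  · exact absurd he.symm (key y hy x hx hgt)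

lemma continuousAt (h : IsBranched T c) {x : ℝ} (hx : x ∈ Icc (0 : ℝ) 1) (hc : x ∉ range c) :
    ContinuousAt T x := by
  obtain ⟨k, hk⟩ := h.exists_branch hx hc
  exact (h.hasDerivAt hk).continuousAt

lemma measurableSet_image (h : IsBranched T c) (k : Fin p) :
    MeasurableSet (T '' Ioo (c k.castSucc) (c k.succ)) :=
  measurableSet_Ioo.image_of_continuousOn_injOn (h.differentiableOn k).continuousOn (h.injOn k)

lemma image_subset (h : IsBranched T c) (k : Fin p) :
    T '' Ioo (c k.castSucc) (c k.succ) ⊆ Icc 0 1 := by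
  rintro _ ⟨x, hx, rfl⟩
  exact h.mapsTo (h.branch_subset k hx)

lemma restrict_branch_le (h : IsBranched T c) (k : Fin p) :
    volume.restrict (Ioo (c k.castSucc) (c k.succ)) ≤ leb :=
  Measure.restrict_mono (h.branch_subset k) le_rfl

lemma integral_leb_eq_sum (h : IsBranched T c) {f : ℝ → ℝ} (hf : Integrable f leb) :
    ∫ x, f x ∂leb = ∑ k : Fin p, ∫ x in Ioo (c k.castSucc) (c k.succ), f x := by
  conv_lhs => rw [h.leb_eq]
  refine integral_biUnion_finset _ (fun _ _ => measurableSet_Ioo)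
    (fun i _ j _ hij => h.disjoint_branch hij) fun k _ => ?_
  exact hf.mono_measure (h.restrict_branch_le k)

lemma integrable_leb_iff (h : IsBranched T c) {f : ℝ → ℝ} :
    Integrable f leb ↔ ∀ k : Fin p, IntegrableOn f (Ioo (c k.castSucc) (c k.succ)) := by
  conv_lhs => rw [h.leb_eq]
  have := integrableOn_finset_iUnion (f := f) (μ := volume) (s := (Finset.univ : Finset (Fin p)))
    (t := fun k => Ioo (c k.castSucc) (c k.succ))
  simpa [IntegrableOn] using this

end IsBranched

/-- The contribution of the branch `(u, v)` to the transfer operator: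
`φ(y) / |T'(y)|` at the point `y` of the branch with `T y = x`, and `0` if there is none. -/
def branchTransfer (T : ℝ → ℝ) (u v : ℝ) (φ : ℝ → ℝ) : ℝ → ℝ :=
  (T '' Ioo u v).indicator fun x =>
    φ (Function.invFunOn T (Ioo u v) x) / |deriv T (Function.invFunOn T (Ioo u v) x)|

lemma branchTransfer_apply {T : ℝ → ℝ} {u v : ℝ} (hinj : InjOn T (Ioo u v)) (φ : ℝ → ℝ) {y : ℝ}
    (hy : y ∈ Ioo u v) : branchTransfer T u v φ (T y) = φ y / |deriv T y| := by
  rw [branchTransfer, indicator_of_mem (mem_image_of_mem T hy), hinj.leftInvOn_invFunOn hy]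

namespace IsBranched

variable {p : ℕ} {T : ℝ → ℝ} {c : Fin (p + 1) → ℝ}

lemma transfer_eq_sum (h : IsBranched T c) (φ : ℝ → ℝ) (x : ℝ) :
    transfer T (range c) φ x =
      ∑ k : Fin p, branchTransfer T (c k.castSucc) (c k.succ) φ x := by
  set inv : Fin p → ℝ := fun k => Function.invFunOn T (Ioo (c k.castSucc) (c k.succ)) x with hinv
  set S : Set (Fin p) := {k | x ∈ T '' Ioo (c k.castSucc) (c k.succ)} with hS
  have hmem : ∀ k ∈ S, inv k ∈ Ioo (c k.castSucc) (c k.succ) ∧ T (inv k) = x := fun k hk =>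
    ⟨Function.invFunOn_mem hk, Function.invFunOn_eq hk⟩
  have himg : {y : ℝ | y ∈ Icc (0 : ℝ) 1 ∧ y ∉ range c ∧ T y = x} = inv '' S := by
    ext y
    constructor
    · rintro ⟨h1, h2, h3⟩
      obtain ⟨k, hk⟩ := h.exists_branch h1 h2
      have hkS : k ∈ S := ⟨y, hk, h3⟩
      refine ⟨k, hkS, ?_⟩
      exact h.injOn k (hmem k hkS).1 hk ((hmem k hkS).2.trans h3.symm)
    · rintro ⟨k, hk, rfl⟩
      obtain ⟨h1, h2⟩ := hmem k hk
      exact ⟨h.branch_subset k h1, h.notMem_range h1, h2⟩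
  have hinjS : InjOn inv S := by
    intro i hi j hj hij
    by_contra hne
    refine (h.disjoint_branch hne).notMem_of_mem_left (hmem i hi).1 ?_
    rw [hij]
    exact (hmem j hj).1
  rw [transfer, himg, finsum_mem_image hinjS, finsum_mem_def, finsum_eq_sum_of_fintype]
  refine Finset.sum_congr rfl fun k _ => ?_
  by_cases hk : k ∈ S
  · rw [branchTransfer, indicator_of_mem (show x ∈ T '' Ioo (c k.castSucc) (c k.succ) from hk)]
    rw [indicator_of_mem hk]
  · rw [branchTransfer, indicator_of_notMem (show x ∉ T '' Ioo (c k.castSucc) (c k.succ) from hk)]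
    rw [indicator_of_notMem hk]

lemma transfer_add (h : IsBranched T c) (φ ψ : ℝ → ℝ) (x : ℝ) :
    transfer T (range c) (fun y => φ y + ψ y) x =
      transfer T (range c) φ x + transfer T (range c) ψ x := by
  simp only [h.transfer_eq_sum, ← Finset.sum_add_distrib, branchTransfer, indicator]
  refine Finset.sum_congr rfl fun k _ => ?_
  split_ifs <;> ring

lemma transfer_const_mul (h : IsBranched T c) (r : ℝ) (φ : ℝ → ℝ) (x : ℝ) :
    transfer T (range c) (fun y => r * φ y) x = r * transfer T (range c) φ x := by
  simp only [h.transfer_eq_sum, Finset.mul_sum, branchTransfer, indicator]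
  refine Finset.sum_congr rfl fun k _ => ?_
  split_ifs <;> ring

lemma transfer_nonneg (h : IsBranched T c) {φ : ℝ → ℝ} (hφ : ∀ y, 0 ≤ φ y) (x : ℝ) :
    0 ≤ transfer T (range c) φ x := by
  rw [h.transfer_eq_sum]
  refine Finset.sum_nonneg fun k _ => ?_
  exact indicator_nonneg (fun y _ => div_nonneg (hφ _) (abs_nonneg _)) x

lemma abs_transfer_le (h : IsBranched T c) (φ : ℝ → ℝ) (x : ℝ) :
    |transfer T (range c) φ x| ≤ transfer T (range c) (fun y => |φ y|) x := by
  rw [h.transfer_eq_sum, h.transfer_eq_sum]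
  refine (Finset.abs_sum_le_sum_abs _ _).trans (Finset.sum_le_sum fun k _ => ?_)
  rw [branchTransfer, branchTransfer, indicator, indicator]
  split_ifs
  · rw [abs_div, abs_abs]
  · simp

/-- Change of variables on one branch. -/
lemma integrable_branchTransfer_mul (h : IsBranched T c) (k : Fin p) {φ ψ : ℝ → ℝ}
    (hint : Integrable (fun x => φ x * ψ (T x)) leb) :
    Integrable (fun x => branchTransfer T (c k.castSucc) (c k.succ) φ x * ψ x) leb ∧
      ∫ x, branchTransfer T (c k.castSucc) (c k.succ) φ x * ψ x ∂leb =
        ∫ x in Ioo (c k.castSucc) (c k.succ), φ x * ψ (T x) := by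
  set I := Ioo (c k.castSucc) (c k.succ) with hI
  set g := branchTransfer T (c k.castSucc) (c k.succ) φ with hg
  have hd : ∀ x ∈ I, HasDerivWithinAt T (deriv T x) I x := fun x hx =>
    (h.hasDerivAt hx).hasDerivWithinAt
  have heq : ∀ x ∈ I, |deriv T x| • (g (T x) * ψ (T x)) = φ x * ψ (T x) := by
    intro x hx
    have h1 := h.one_le_deriv k x hx
    rw [hg, branchTransfer_apply (h.injOn k) φ hx, smul_eq_mul]
    field_simp
  have h1 : IntegrableOn (fun x => g x * ψ x) (T '' I) := by
    rw [integrableOn_image_iff_integrableOn_abs_deriv_smul measurableSet_Ioo hd (h.injOn k)]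
    rw [integrableOn_congr_fun heq measurableSet_Ioo]
    exact hint.mono_measure (h.restrict_branch_le k)
  have h2 := integral_image_eq_integral_abs_deriv_smul measurableSet_Ioo hd (h.injOn k)
    (fun x => g x * ψ x)
  rw [setIntegral_congr_fun measurableSet_Ioo heq] at h2
  have hind : (fun x => g x * ψ x) = (T '' I).indicator fun x => g x * ψ x := by
    funext x
    by_cases hx : x ∈ T '' I
    · rw [indicator_of_mem hx]
    · rw [indicator_of_notMem hx, hg, branchTransfer, indicator_of_notMem hx, zero_mul]
  have hres : leb.restrict (T '' I) = volume.restrict (T '' I) := by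
    rw [leb, Measure.restrict_restrict (h.measurableSet_image k),
      inter_eq_left.2 (h.image_subset k)]
  rw [hind]
  constructor
  · rw [integrable_indicator_iff (h.measurableSet_image k), IntegrableOn, hres]
    exact h1
  · rw [integral_indicator (h.measurableSet_image k), hres, h2]

/-- The transfer operator is dual to composition with the map. -/
lemma integral_transfer_mul (h : IsBranched T c) {φ ψ : ℝ → ℝ}
    (hint : Integrable (fun x => φ x * ψ (T x)) leb) :
    Integrable (fun x => transfer T (range c) φ x * ψ x) leb ∧
      ∫ x, transfer T (range c) φ x * ψ x ∂leb = ∫ x, φ x * ψ (T x) ∂leb := by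
  simp only [h.transfer_eq_sum, Finset.sum_mul]
  refine ⟨integrable_finsetSum _ fun k _ => (h.integrable_branchTransfer_mul k hint).1, ?_⟩
  rw [integral_finsetSum _ fun k _ => (h.integrable_branchTransfer_mul k hint).1,
    h.integral_leb_eq_sum hint]
  exact Finset.sum_congr rfl fun k _ => (h.integrable_branchTransfer_mul k hint).2

lemma integrable_transfer (h : IsBranched T c) {φ : ℝ → ℝ} (hφ : Integrable φ leb) :
    Integrable (transfer T (range c) φ) leb := by
  simpa using (h.integral_transfer_mul (φ := φ) (ψ := fun _ => 1) (by simpa using hφ)).1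

lemma integral_transfer (h : IsBranched T c) {φ : ℝ → ℝ} (hφ : Integrable φ leb) :
    ∫ x, transfer T (range c) φ x ∂leb = ∫ x, φ x ∂leb := by
  simpa using (h.integral_transfer_mul (φ := φ) (ψ := fun _ => 1) (by simpa using hφ)).2

lemma integrable_comp (h : IsBranched T c) {ψ : ℝ → ℝ} (hψ : Integrable ψ leb) :
    Integrable (fun x => ψ (T x)) leb := by
  rw [h.integrable_leb_iff]
  intro k
  have hd : ∀ x ∈ Ioo (c k.castSucc) (c k.succ), HasDerivWithinAt T (deriv T x)
      (Ioo (c k.castSucc) (c k.succ)) x := fun x hx => (h.hasDerivAt hx).hasDerivWithinAt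
  have h1 : IntegrableOn ψ (T '' Ioo (c k.castSucc) (c k.succ)) :=
    hψ.mono_measure (Measure.restrict_mono (h.image_subset k) le_rfl)
  rw [integrableOn_image_iff_integrableOn_abs_deriv_smul measurableSet_Ioo hd (h.injOn k)] at h1
  have h2 : IntegrableOn (fun x => |deriv T x|⁻¹ * (|deriv T x| • ψ (T x)))
      (Ioo (c k.castSucc) (c k.succ)) := by
    refine Integrable.bdd_mul (c := 1) h1
      (((measurable_deriv T).abs).inv.aestronglyMeasurable) ?_
    filter_upwards [ae_restrict_mem measurableSet_Ioo] with x hx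
    rw [norm_inv, Real.norm_eq_abs, abs_abs]
    exact inv_le_one_of_one_le₀ (h.one_le_deriv k x hx)
  refine h2.congr_fun (fun x hx => ?_) measurableSet_Ioo
  have := h.one_le_deriv k x hx
  simp only [smul_eq_mul]
  field_simp

/-- The map is nonsingular with respect to Lebesgue measure. -/
lemma ae_comp (h : IsBranched T c) {P : ℝ → Prop} (hP : ∀ᵐ x ∂leb, P x) :
    ∀ᵐ x ∂leb, P (T x) := by
  classical
  set ψ : ℝ → ℝ := fun x => if P x then 0 else 1 with hψ
  have h0 : ψ =ᵐ[leb] 0 := by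
    filter_upwards [hP] with x hx
    simp [hψ, hx]
  have hψi : Integrable ψ leb := (integrable_congr h0).2 (integrable_zero _ _ _)
  have hi := h.integrable_comp hψi
  have hdual := h.integral_transfer_mul (φ := fun _ => 1) (ψ := ψ) (by simpa using hi)
  have hz : ∫ x, transfer T (range c) (fun _ => 1) x * ψ x ∂leb = 0 := by
    rw [integral_eq_zero_of_ae]
    filter_upwards [h0] with x hx
    rw [hx]; simp
  rw [hz] at hdual
  have h1 : ∫ x, ψ (T x) ∂leb = 0 := by simpa using hdual.2.symm
  rw [integral_eq_zero_iff_of_nonneg (fun x => by simp only [hψ]; split_ifs <;> simp) hi] at h1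
  filter_upwards [h1] with x hx
  by_contra hcon
  simp [hψ, hcon] at hx

lemma aemeasurable (h : IsBranched T c) : AEMeasurable T leb := by
  have hid : Integrable (fun x : ℝ => x) leb := by
    refine Integrable.of_bound (C := 1) aestronglyMeasurable_id ?_
    filter_upwards [ae_mem_Icc_leb] with x hx
    rw [Real.norm_eq_abs, abs_le]
    exact ⟨by linarith [hx.1], hx.2⟩
  exact (h.integrable_comp hid).aestronglyMeasurable.aemeasurable

lemma aestronglyMeasurable_comp (h : IsBranched T c) {ψ : ℝ → ℝ}
    (hψ : AEStronglyMeasurable ψ leb) : AEStronglyMeasurable (fun x => ψ (T x)) leb := by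
  have h1 : AEMeasurable (fun x => hψ.mk ψ (T x)) leb :=
    hψ.stronglyMeasurable_mk.measurable.comp_aemeasurable h.aemeasurable
  exact h1.aestronglyMeasurable.congr (EventuallyEq.symm (h.ae_comp hψ.ae_eq_mk))

lemma transfer_congr (h : IsBranched T c) {φ ψ : ℝ → ℝ} (he : φ =ᵐ[leb] ψ) :
    transfer T (range c) φ =ᵐ[leb] transfer T (range c) ψ := by
  have hd0 : (fun y => |φ y + (-1) * ψ y|) =ᵐ[leb] 0 := by
    filter_upwards [he] with x hx
    simp [hx]
  have hdi : Integrable (fun y => |φ y + (-1) * ψ y|) leb :=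
    (integrable_congr hd0).2 (integrable_zero _ _ _)
  have h1 := h.integral_transfer hdi
  rw [integral_congr_ae hd0] at h1
  simp only [Pi.zero_apply, integral_zero] at h1
  rw [integral_eq_zero_iff_of_nonneg
    (fun x => h.transfer_nonneg (φ := fun y => |φ y + (-1) * ψ y|) (fun y => abs_nonneg _) x)
    (h.integrable_transfer hdi)] at h1
  filter_upwards [h1] with x hx
  have h2 := h.abs_transfer_le (fun y => φ y + (-1) * ψ y) x
  rw [hx, h.transfer_add, h.transfer_const_mul] at h2
  have h3 := abs_nonpos_iff.1 h2
  linarith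

lemma integral_abs_transfer_le (h : IsBranched T c) {φ : ℝ → ℝ} (hφ : Integrable φ leb) :
    ∫ x, |transfer T (range c) φ x| ∂leb ≤ ∫ x, |φ x| ∂leb := by
  rw [← h.integral_transfer hφ.abs]
  exact integral_mono (h.integrable_transfer hφ).abs (h.integrable_transfer hφ.abs)
    (h.abs_transfer_le φ)

/-- The transfer operator as a bounded operator on `L¹`. -/
def transferL1 (h : IsBranched T c) : L1 →L[ℝ] L1 :=
  LinearMap.mkContinuous
    { toFun := fun f => (h.integrable_transfer (L1.integrable_coeFn f)).toL1 _
      map_add' := fun f g => by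
        apply Lp.ext
        filter_upwards [Integrable.coeFn_toL1 (h.integrable_transfer (L1.integrable_coeFn (f + g))),
          Integrable.coeFn_toL1 (h.integrable_transfer (L1.integrable_coeFn f)),
          Integrable.coeFn_toL1 (h.integrable_transfer (L1.integrable_coeFn g)),
          Lp.coeFn_add ((h.integrable_transfer (L1.integrable_coeFn f)).toL1 _)
            ((h.integrable_transfer (L1.integrable_coeFn g)).toL1 _),
          h.transfer_congr (Lp.coeFn_add f g)] with x h1 h2 h3 h4 h5
        rw [h1, h4, Pi.add_apply, h2, h3, h5, ← h.transfer_add]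
        rfl
      map_smul' := fun r f => by
        apply Lp.ext
        filter_upwards [Integrable.coeFn_toL1 (h.integrable_transfer (L1.integrable_coeFn (r • f))),
          Integrable.coeFn_toL1 (h.integrable_transfer (L1.integrable_coeFn f)),
          Lp.coeFn_smul r ((h.integrable_transfer (L1.integrable_coeFn f)).toL1 _),
          h.transfer_congr (Lp.coeFn_smul r f)] with x h1 h2 h3 h4
        rw [h1, RingHom.id_apply, h3, Pi.smul_apply, h2, h4, smul_eq_mul, ← h.transfer_const_mul]
        rfl }
    1 fun f => by
      rw [one_mul]
      change ‖(h.integrable_transfer (L1.integrable_coeFn f)).toL1 _‖ ≤ ‖f‖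
      rw [L1.norm_of_fun_eq_integral_norm, L1.norm_eq_integral_norm]
      exact h.integral_abs_transfer_le (L1.integrable_coeFn f)

lemma coeFn_transferL1 (h : IsBranched T c) (f : L1) :
    h.transferL1 f =ᵐ[leb] transfer T (range c) f :=
  Integrable.coeFn_toL1 (h.integrable_transfer (L1.integrable_coeFn f))

lemma coeFn_transferL1_pow (h : IsBranched T c) (n : ℕ) (f : L1) :
    (h.transferL1 ^ n) f =ᵐ[leb] (transfer T (range c))^[n] f := by
  induction n with
  | zero => exact EventuallyEq.rfl
  | succ n ih =>
    rw [pow_succ', Function.iterate_succ_apply', mul_apply_eq_comp]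
    exact (h.coeFn_transferL1 _).trans (h.transfer_congr ih)

lemma transferL1_nonneg (h : IsBranched T c) {f : L1} (hf : 0 ≤ f) : 0 ≤ h.transferL1 f := by
  rw [← Lp.coeFn_nonneg] at hf ⊢
  have h1 : (f : ℝ → ℝ) =ᵐ[leb] fun x => |f x| := by
    filter_upwards [hf] with x hx
    exact (abs_of_nonneg hx).symm
  filter_upwards [h.coeFn_transferL1 f, h.transfer_congr h1] with x h2 h3
  rw [h2, h3]
  exact h.transfer_nonneg (fun y => abs_nonneg _) x

lemma integral_transferL1_mul (h : IsBranched T c) (f : L1) {ψ : ℝ → ℝ}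
    (hint : Integrable (fun x => f x * ψ (T x)) leb) :
    Integrable (fun x => h.transferL1 f x * ψ x) leb ∧
      ∫ x, h.transferL1 f x * ψ x ∂leb = ∫ x, f x * ψ (T x) ∂leb := by
  have he : (fun x => h.transferL1 f x * ψ x) =ᵐ[leb] fun x => transfer T (range c) f x * ψ x := by
    filter_upwards [h.coeFn_transferL1 f] with x hx
    rw [hx]
  rw [integrable_congr he, integral_congr_ae he]
  exact h.integral_transfer_mul hint

end IsBranched

/-! ### The Banach lattice `L¹` and the space of functions of bounded variation -/

/-- The integral over the unit interval, as a functional on `L¹`. -/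
def mass : L1 →L[ℝ] ℝ := L1.integralCLM

lemma mass_apply (f : L1) : mass f = ∫ x, f x ∂leb := by
  rw [mass, ← L1.integral_eq, L1.integral_eq_integral]

lemma mass_eq_norm {f : L1} (hf : 0 ≤ f) : mass f = ‖f‖ := by
  rw [mass_apply, L1.norm_eq_integral_norm]
  apply integral_congr_ae
  rw [← Lp.coeFn_nonneg] at hf
  filter_upwards [hf] with x hx
  exact (abs_of_nonneg hx).symm

lemma abs_mass_le (f : L1) : |mass f| ≤ ‖f‖ := by
  rw [mass_apply, L1.norm_eq_integral_norm]
  rw [← Real.norm_eq_abs]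
  exact norm_integral_le_integral_norm (f : ℝ → ℝ)

lemma inf_eq_half_smul (f g : L1) : f ⊓ g = (2⁻¹ : ℝ) • (f + g - |f - g|) := by
  rw [inf_eq_half_smul_add_sub_abs_sub ℝ f g, abs_sub_comm, invOf_eq_inv]

lemma inf_eq_zero_iff_abs_sub {f g : L1} : f ⊓ g = 0 ↔ |f - g| = f + g := by
  rw [inf_eq_half_smul, smul_eq_zero_iff_right (by norm_num), sub_eq_zero, eq_comm]

lemma inf_eq_zero_iff_ae {f g : L1} (hf : 0 ≤ f) (hg : 0 ≤ g) :
    f ⊓ g = 0 ↔ ∀ᵐ x ∂leb, f x = 0 ∨ g x = 0 := by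
  rw [← Lp.coeFn_nonneg] at hf hg
  constructor
  · intro h
    have h0 : (f ⊓ g : L1) =ᵐ[leb] 0 := by rw [h]; exact Lp.coeFn_zero _ _ _
    filter_upwards [h0, Lp.coeFn_inf f g, hf, hg] with x h1 h2 h3 h4
    rw [h2] at h1
    rcases min_choice (f x) (g x) with h | h
    · left; rw [← h]; exact h1
    · right; rw [← h]; exact h1
  · intro h
    apply Lp.ext
    filter_upwards [h, Lp.coeFn_inf f g, hf, hg, Lp.coeFn_zero ℝ 1 leb] with x h1 h2 h3 h4 h5
    rw [h2, h5]
    change min (f x) (g x) = 0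
    rcases h1 with h1 | h1
    · rw [h1]; exact min_eq_left h4
    · rw [h1]; exact min_eq_right h3

lemma smul_nonneg_L1 {r : ℝ} (hr : 0 ≤ r) {f : L1} (hf : 0 ≤ f) : 0 ≤ r • f := by
  rw [← Lp.coeFn_nonneg] at hf ⊢
  filter_upwards [hf, Lp.coeFn_smul r f] with x h1 h2
  rw [h2]
  exact mul_nonneg hr h1

/-- The functions `f ∈ L¹` with `‖f‖_α < ∞`. -/
def MemBV (α A : ℝ) (f : L1) : Prop := gbvNorm α A f ≠ ⊤

/-- The norm `‖f‖_α` as a real number. -/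
def bvNorm (α A : ℝ) (f : L1) : ℝ := (gbvNorm α A f).toReal

section BV

variable {α A : ℝ}

lemma eLpNorm_coeFn (f : L1) : eLpNorm f 1 leb = ENNReal.ofReal ‖f‖ := by
  rw [Lp.norm_def, ENNReal.ofReal_toReal (Lp.eLpNorm_ne_top f)]

lemma gbvNorm_coeFn (f : L1) : gbvNorm α A f = gbvSeminorm α A f + ENNReal.ofReal ‖f‖ := by
  rw [gbvNorm, eLpNorm_coeFn]

lemma bvNorm_nonneg (f : L1) : 0 ≤ bvNorm α A f := ENNReal.toReal_nonneg

lemma MemBV.ofReal_bvNorm {f : L1} (hf : MemBV α A f) :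
    ENNReal.ofReal (bvNorm α A f) = gbvNorm α A f := ENNReal.ofReal_toReal hf

lemma MemBV.norm_le {f : L1} (hf : MemBV α A f) : ‖f‖ ≤ bvNorm α A f := by
  rw [← ENNReal.ofReal_le_ofReal_iff (bvNorm_nonneg f), hf.ofReal_bvNorm, gbvNorm_coeFn]
  exact le_add_self

lemma memBV_and_le {f : L1} {R : ℝ} (hR : 0 ≤ R) (h : gbvNorm α A f ≤ ENNReal.ofReal R) :
    MemBV α A f ∧ bvNorm α A f ≤ R :=
  ⟨ne_top_of_le_ne_top ENNReal.ofReal_ne_top h, ENNReal.toReal_le_of_le_ofReal hR h⟩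

lemma MemBV.mem_gbvBall {f : L1} (hf : MemBV α A f) {R : ℝ} (hR : bvNorm α A f ≤ R) :
    f ∈ gbvBall α A R := by
  refine ⟨?_, hf.norm_le.trans hR⟩
  refine le_trans ?_ (ENNReal.ofReal_le_ofReal hR)
  rw [hf.ofReal_bvNorm, gbvNorm]
  exact le_self_add

lemma memBV_of_mem_gbvBall {f : L1} {R : ℝ} (hR : 0 ≤ R) (hf : f ∈ gbvBall α A R) :
    MemBV α A f ∧ bvNorm α A f ≤ 2 * R := by
  apply memBV_and_le (by positivity)
  rw [gbvNorm_coeFn, two_mul, ENNReal.ofReal_add hR hR]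
  exact add_le_add hf.1 (ENNReal.ofReal_le_ofReal hf.2)

lemma MemBV.add {f g : L1} (hf : MemBV α A f) (hg : MemBV α A g) :
    MemBV α A (f + g) ∧ bvNorm α A (f + g) ≤ bvNorm α A f + bvNorm α A g := by
  apply memBV_and_le (add_nonneg (bvNorm_nonneg f) (bvNorm_nonneg g))
  rw [ENNReal.ofReal_add (bvNorm_nonneg f) (bvNorm_nonneg g), hf.ofReal_bvNorm, hg.ofReal_bvNorm]
  have h1 : gbvSeminorm α A (f + g : L1) ≤ gbvSeminorm α A f + gbvSeminorm α A g := by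
    rw [gbvSeminorm_congr (Lp.coeFn_add f g)]
    exact gbvSeminorm_add_le α A f g
  have h2 : ENNReal.ofReal ‖f + g‖ ≤ ENNReal.ofReal ‖f‖ + ENNReal.ofReal ‖g‖ := by
    rw [← ENNReal.ofReal_add (norm_nonneg _) (norm_nonneg _)]
    exact ENNReal.ofReal_le_ofReal (norm_add_le f g)
  rw [gbvNorm_coeFn, gbvNorm_coeFn, gbvNorm_coeFn]
  calc _ ≤ (gbvSeminorm α A f + gbvSeminorm α A g) +
        (ENNReal.ofReal ‖f‖ + ENNReal.ofReal ‖g‖) := add_le_add h1 h2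
    _ = _ := by ring

lemma MemBV.smul {f : L1} (hf : MemBV α A f) (r : ℝ) :
    MemBV α A (r • f) ∧ bvNorm α A (r • f) ≤ |r| * bvNorm α A f := by
  apply memBV_and_le (mul_nonneg (abs_nonneg r) (bvNorm_nonneg f))
  rw [ENNReal.ofReal_mul (abs_nonneg r), hf.ofReal_bvNorm, gbvNorm_coeFn, gbvNorm_coeFn, mul_add,
    gbvSeminorm_congr (Lp.coeFn_smul r f), norm_smul, ENNReal.ofReal_mul (norm_nonneg r)]
  exact add_le_add (gbvSeminorm_const_mul_le α A r f) le_rfl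

lemma MemBV.sub {f g : L1} (hf : MemBV α A f) (hg : MemBV α A g) :
    MemBV α A (f - g) ∧ bvNorm α A (f - g) ≤ bvNorm α A f + bvNorm α A g := by
  have h := hg.smul (-1)
  have h2 := hf.add h.1
  rw [neg_one_smul, ← sub_eq_add_neg] at h2
  refine ⟨h2.1, h2.2.trans ?_⟩
  have := h.2
  rw [neg_one_smul, abs_neg, abs_one, one_mul] at this
  linarith

lemma MemBV.abs {f : L1} (hf : MemBV α A f) : MemBV α A |f| := by
  apply ne_top_of_le_ne_top hf
  rw [gbvNorm_coeFn, gbvNorm_coeFn, norm_abs_eq_norm]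
  refine add_le_add ?_ le_rfl
  rw [gbvSeminorm_congr (Lp.coeFn_abs f)]
  exact gbvSeminorm_abs_le α A f

lemma MemBV.inf {f g : L1} (hf : MemBV α A f) (hg : MemBV α A g) : MemBV α A (f ⊓ g) := by
  rw [inf_eq_half_smul]
  exact (((hf.add hg).1.sub (hf.sub hg).1.abs).1.smul _).1

lemma memBV_zero : MemBV α A (0 : L1) := by
  rw [MemBV, gbvNorm_coeFn, gbvSeminorm_congr (Lp.coeFn_zero ℝ 1 leb), norm_zero]
  have := gbvSeminorm_const α A 0
  rw [show (0 : ℝ → ℝ) = fun _ => 0 from rfl, this]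
  simp

lemma memBV_sum {ι : Type*} (s : Finset ι) {f : ι → L1} {R : ℝ} (hf : ∀ i ∈ s, MemBV α A (f i))
    (hR : ∀ i ∈ s, bvNorm α A (f i) ≤ R) :
    MemBV α A (∑ i ∈ s, f i) ∧ bvNorm α A (∑ i ∈ s, f i) ≤ s.card * R := by
  induction s using Finset.cons_induction with
  | empty =>
    simp only [Finset.sum_empty, Finset.card_empty, Nat.cast_zero, zero_mul]
    refine ⟨memBV_zero, ?_⟩
    have := (memBV_zero (α := α) (A := A)).smul 0
    simpa using this.2
  | cons a s ha ih =>
    have h1 := ih (fun i hi => hf i (Finset.mem_cons_of_mem hi))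
      (fun i hi => hR i (Finset.mem_cons_of_mem hi))
    have h2 := (hf a (Finset.mem_cons_self a s)).add h1.1
    rw [Finset.sum_cons, Finset.card_cons]
    refine ⟨h2.1, h2.2.trans ?_⟩
    have := hR a (Finset.mem_cons_self a s)
    push_cast
    linarith [h1.2]

/-- Functions in `V_α` are bounded by a multiple of their norm. -/
lemma exists_ae_abs_le (hα : 0 ≤ α) (hA : 0 < A) :
    ∃ N : ℝ, 1 ≤ N ∧ ∀ f : L1, MemBV α A f → ∀ᵐ x ∂leb, |f x| ≤ N * bvNorm α A f := by
  obtain ⟨n, hn⟩ := exists_nat_one_div_lt hA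
  refine ⟨(n + 1 : ℕ), by simp, fun f hf => ?_⟩
  have := ae_enorm_le_gbvNorm (f := f) hα (Nat.succ_pos n) (N := n + 1) (A := A)
    (by push_cast; exact hn.le)
  filter_upwards [this] with x hx
  rw [← hf.ofReal_bvNorm, Real.enorm_eq_ofReal_abs, ← ENNReal.ofReal_natCast,
    ← ENNReal.ofReal_mul (by positivity)] at hx
  exact (ENNReal.ofReal_le_ofReal_iff (mul_nonneg (by positivity) (bvNorm_nonneg f))).1 hx

end BV

/-! ### Positive operators satisfying a Lasota–Yorke inequality -/

/-- A positive, integral preserving operator on `L¹` that satisfies a Lasota–Yorke inequality with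
constants `C` and `ρ`. -/
structure IsLasotaYorke (α A C ρ : ℝ) (P : L1 →L[ℝ] L1) : Prop where
  nonneg : ∀ f : L1, 0 ≤ f → 0 ≤ P f
  mass_eq : ∀ f : L1, mass (P f) = mass f
  one_le : 1 ≤ C
  rho_pos : 0 < ρ
  rho_lt : ρ < 1
  bound : ∀ (n : ℕ) (f : L1), MemBV α A f →
    MemBV α A ((P ^ n) f) ∧ bvNorm α A ((P ^ n) f) ≤ C * ρ ^ n * bvNorm α A f + C * ‖f‖

namespace IsLasotaYorke

variable {α A C ρ : ℝ} {P : L1 →L[ℝ] L1}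

lemma pow_nonneg (h : IsLasotaYorke α A C ρ P) (n : ℕ) {f : L1} (hf : 0 ≤ f) :
    0 ≤ (P ^ n) f := by
  induction n with
  | zero => exact hf
  | succ n ih => rw [pow_succ', mul_apply_eq_comp]; exact h.nonneg _ ih

lemma mass_pow (h : IsLasotaYorke α A C ρ P) (n : ℕ) (f : L1) : mass ((P ^ n) f) = mass f := by
  induction n with
  | zero => rfl
  | succ n ih => rw [pow_succ', mul_apply_eq_comp, h.mass_eq, ih]

lemma abs_pow_le (h : IsLasotaYorke α A C ρ P) (n : ℕ) (f : L1) :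
    |(P ^ n) f| ≤ (P ^ n) |f| := by
  rw [abs_le']
  constructor
  · rw [← sub_nonneg, ← map_sub]
    exact h.pow_nonneg n (sub_nonneg.2 (le_abs_self f))
  · rw [← map_neg, ← sub_nonneg, ← map_sub]
    exact h.pow_nonneg n (sub_nonneg.2 (neg_le_abs f))

lemma norm_pow_le (h : IsLasotaYorke α A C ρ P) (n : ℕ) (f : L1) : ‖(P ^ n) f‖ ≤ ‖f‖ := by
  have h1 : ‖(P ^ n) f‖ ≤ ‖(P ^ n) |f|‖ := by
    rw [← norm_abs_eq_norm ((P ^ n) f)]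
    exact norm_le_norm_of_abs_le_abs (by
      rw [abs_abs]; exact (h.abs_pow_le n f).trans (le_abs_self _))
  rw [← mass_eq_norm (h.pow_nonneg n (abs_nonneg f)), h.mass_pow, mass_eq_norm (abs_nonneg f),
    norm_abs_eq_norm] at h1
  exact h1

lemma norm_pow_le_of_le (h : IsLasotaYorke α A C ρ P) {m n : ℕ} (hmn : m ≤ n) (f : L1) :
    ‖(P ^ n) f‖ ≤ ‖(P ^ m) f‖ := by
  obtain ⟨k, rfl⟩ := Nat.exists_eq_add_of_le' hmn
  rw [pow_add, mul_apply_eq_comp]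
  exact h.norm_pow_le k _

lemma bvNorm_pow_le (h : IsLasotaYorke α A C ρ P) (n : ℕ) {f : L1} (hf : MemBV α A f) :
    bvNorm α A ((P ^ n) f) ≤ 2 * C * bvNorm α A f := by
  have h1 := (h.bound n f hf).2
  have h2 : C * ρ ^ n * bvNorm α A f ≤ C * bvNorm α A f := by
    have : ρ ^ n ≤ 1 := pow_le_one₀ h.rho_pos.le h.rho_lt.le
    have hC : 0 ≤ C := zero_le_one.trans h.one_le
    refine mul_le_mul_of_nonneg_right ?_ (bvNorm_nonneg f)
    nlinarith
  have h3 : C * ‖f‖ ≤ C * bvNorm α A f :=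
    mul_le_mul_of_nonneg_left hf.norm_le (zero_le_one.trans h.one_le)
  linarith

/-- Averages of the iterates of a nonnegative `f` accumulate at an invariant density in `V_α`. -/
lemma exists_invariant (h : IsLasotaYorke α A C ρ P) (hα : 0 < α) (hA : 0 < A) {f : L1}
    (hf : MemBV α A f) (hf0 : 0 ≤ f) :
    ∃ g : L1, MemBV α A g ∧ bvNorm α A g ≤ 4 * C * bvNorm α A f ∧ 0 ≤ g ∧ P g = g ∧
      mass g = mass f ∧ ∃ ns : ℕ → ℕ, StrictMono ns ∧ Tendsto
        (fun j => ((ns j + 1 : ℕ) : ℝ)⁻¹ • ∑ k ∈ Finset.range (ns j + 1), (P ^ k) f)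
        atTop (𝓝 g) := by
  set avg : ℕ → L1 := fun n => ((n + 1 : ℕ) : ℝ)⁻¹ • ∑ k ∈ Finset.range (n + 1), (P ^ k) f
    with havg
  have hC : 0 ≤ C := zero_le_one.trans h.one_le
  have hR : 0 ≤ 2 * C * bvNorm α A f := mul_nonneg (by positivity) (bvNorm_nonneg f)
  have hmem : ∀ n, avg n ∈ gbvBall α A (2 * C * bvNorm α A f) := by
    intro n
    have h1 := memBV_sum (α := α) (A := A) (Finset.range (n + 1)) (f := fun k => (P ^ k) f)
      (fun k _ => (h.bound k f hf).1) (fun k _ => h.bvNorm_pow_le k hf)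
    have h2 := h1.1.smul (((n + 1 : ℕ) : ℝ)⁻¹)
    refine h2.1.mem_gbvBall (h2.2.trans ?_)
    have hpos : (0 : ℝ) < ((n + 1 : ℕ) : ℝ) := by positivity
    rw [abs_of_pos (inv_pos.2 hpos), inv_mul_le_iff₀ hpos]
    simpa using h1.2
  obtain ⟨g, hg, ns, hns, hlim⟩ := (isCompact_gbvBall hα hA hR).tendsto_subseq hmem
  have hgBV := memBV_of_mem_gbvBall hR hg
  refine ⟨g, hgBV.1, by linarith [hgBV.2], ?_, ?_, ?_, ns, hns, hlim⟩
  · refine ge_of_tendsto hlim (Eventually.of_forall fun j => ?_)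
    exact smul_nonneg_L1 (by positivity) (Finset.sum_nonneg fun k _ => h.pow_nonneg k hf0)
  · have h1 : Tendsto (fun j => P ((avg ∘ ns) j) - (avg ∘ ns) j) atTop (𝓝 (P g - g)) :=
      ((P.continuous.tendsto g).comp hlim).sub hlim
    have h2 : ∀ n, ‖P (avg n) - avg n‖ ≤ 2 * ‖f‖ * (1 / ((n : ℝ) + 1)) := by
      intro n
      have h3 : P (avg n) - avg n = ((n + 1 : ℕ) : ℝ)⁻¹ • ((P ^ (n + 1)) f - f) := by
        rw [havg, map_smul, ← smul_sub, map_sum, ← Finset.sum_sub_distrib]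
        congr 1
        have := Finset.sum_range_sub (fun k => (P ^ k) f) (n + 1)
        rw [pow_zero] at this
        rw [one_apply_eq_self] at this
        rw [← this]
        refine Finset.sum_congr rfl fun k _ => ?_
        rw [pow_succ', mul_apply_eq_comp]
      rw [h3, norm_smul, Real.norm_of_nonneg (by positivity)]
      have h4 := (norm_sub_le ((P ^ (n + 1)) f) f)
      have h5 := h.norm_pow_le (n + 1) f
      rw [Nat.cast_add, Nat.cast_one, mul_comm, one_div]
      exact mul_le_mul_of_nonneg_right (by linarith) (by positivity)
    have h3 : Tendsto (fun n : ℕ => 2 * ‖f‖ * (1 / ((n : ℝ) + 1))) atTop (𝓝 (2 * ‖f‖ * 0)) :=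
      tendsto_one_div_add_atTop_nhds_zero_nat.const_mul _
    rw [mul_zero] at h3
    have h4 : Tendsto (fun j => P ((avg ∘ ns) j) - (avg ∘ ns) j) atTop (𝓝 0) :=
      squeeze_zero_norm (fun j => h2 (ns j)) (h3.comp hns.tendsto_atTop)
    exact sub_eq_zero.1 (tendsto_nhds_unique h1 h4)
  · have h1 : ∀ n, mass (avg n) = mass f := by
      intro n
      rw [havg, map_smul, map_sum, Finset.sum_congr rfl fun k _ => h.mass_pow k f]
      simp only [Finset.sum_const, Finset.card_range, nsmul_eq_mul, smul_eq_mul]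
      have : ((n + 1 : ℕ) : ℝ) ≠ 0 := by positivity
      field_simp
    have h2 := (mass.continuous.tendsto g).comp hlim
    refine tendsto_nhds_unique h2 ?_
    refine tendsto_const_nhds.congr fun j => ?_
    exact (h1 (ns j)).symm

end IsLasotaYorke

/-! ### Recurrent functions -/

/-- `g ∈ V_α` is recurrent along `m` if `P ^ (m j) g → g`. -/
def IsRecurrent (α A : ℝ) (P : L1 →L[ℝ] L1) (m : ℕ → ℕ) (g : L1) : Prop :=
  MemBV α A g ∧ Tendsto (fun j => (P ^ m j) g) atTop (𝓝 g)

namespace IsRecurrent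

variable {α A C ρ : ℝ} {P : L1 →L[ℝ] L1} {m : ℕ → ℕ} {f g : L1}

lemma norm_pow (h : IsLasotaYorke α A C ρ P) (hm : Tendsto m atTop atTop)
    (hg : IsRecurrent α A P m g) (n : ℕ) : ‖(P ^ n) g‖ = ‖g‖ := by
  refine le_antisymm (h.norm_pow_le n g) (le_of_tendsto hg.2.norm ?_)
  filter_upwards [hm.eventually_ge_atTop n] with j hj
  exact h.norm_pow_le_of_le hj g

/-- On recurrent functions the operator is a lattice homomorphism: `P ^ n |g| - |P ^ n g|` is
nonnegative and has integral `‖g‖ - ‖P ^ n g‖ = 0`. -/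
lemma pow_abs (h : IsLasotaYorke α A C ρ P) (hm : Tendsto m atTop atTop)
    (hg : IsRecurrent α A P m g) (n : ℕ) : (P ^ n) |g| = |(P ^ n) g| := by
  have h0 : 0 ≤ (P ^ n) |g| - |(P ^ n) g| := sub_nonneg.2 (h.abs_pow_le n g)
  have h1 := mass_eq_norm h0
  rw [map_sub, h.mass_pow, mass_eq_norm (abs_nonneg _), mass_eq_norm (abs_nonneg _),
    norm_abs_eq_norm, norm_abs_eq_norm, hg.norm_pow h hm, sub_self] at h1
  exact sub_eq_zero.1 (norm_eq_zero.1 h1.symm)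

lemma abs (h : IsLasotaYorke α A C ρ P) (hm : Tendsto m atTop atTop)
    (hg : IsRecurrent α A P m g) : IsRecurrent α A P m |g| := by
  refine ⟨hg.1.abs, ?_⟩
  simp only [hg.pow_abs h hm]
  have : Continuous fun x : L1 => |x| := by
    simp only [_root_.abs]
    fun_prop
  exact (this.tendsto g).comp hg.2

lemma add (hf : IsRecurrent α A P m f) (hg : IsRecurrent α A P m g) :
    IsRecurrent α A P m (f + g) :=
  ⟨(hf.1.add hg.1).1, by simpa using hf.2.add hg.2⟩

lemma sub (hf : IsRecurrent α A P m f) (hg : IsRecurrent α A P m g) :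
    IsRecurrent α A P m (f - g) :=
  ⟨(hf.1.sub hg.1).1, by simpa using hf.2.sub hg.2⟩

lemma smul (hf : IsRecurrent α A P m f) (r : ℝ) : IsRecurrent α A P m (r • f) :=
  ⟨(hf.1.smul r).1, by simpa using hf.2.const_smul r⟩

lemma inf (h : IsLasotaYorke α A C ρ P) (hm : Tendsto m atTop atTop)
    (hf : IsRecurrent α A P m f) (hg : IsRecurrent α A P m g) : IsRecurrent α A P m (f ⊓ g) := by
  rw [inf_eq_half_smul]
  exact ((hf.add hg).sub ((hf.sub hg).abs h hm)).smul _

lemma posPart (h : IsLasotaYorke α A C ρ P) (hm : Tendsto m atTop atTop)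
    (hf : IsRecurrent α A P m f) : IsRecurrent α A P m f⁺ := by
  have : f⁺ = (2⁻¹ : ℝ) • (f + |f|) := by
    have h1 := posPart_sub_negPart f
    have h2 := posPart_add_negPart f
    rw [← h2]
    nth_rewrite 2 [← h1]
    rw [sub_add_add_cancel, ← two_smul ℝ, smul_smul, inv_mul_cancel₀ two_ne_zero, one_smul]
  rw [this]
  exact (hf.add (hf.abs h hm)).smul _

lemma pow (h : IsLasotaYorke α A C ρ P) (hg : IsRecurrent α A P m g) (n : ℕ) :
    IsRecurrent α A P m ((P ^ n) g) := by
  refine ⟨(h.bound n g hg.1).1, ?_⟩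
  have := (((P ^ n).continuous.tendsto g).comp hg.2)
  refine this.congr fun j => ?_
  rw [Function.comp_apply, ← mul_apply_eq_comp, ← mul_apply_eq_comp, ← pow_add, ← pow_add, add_comm]

/-- The operator preserves disjointness of recurrent functions. -/
lemma pow_inf_eq_zero (h : IsLasotaYorke α A C ρ P) (hm : Tendsto m atTop atTop)
    (hf : IsRecurrent α A P m f) (hg : IsRecurrent α A P m g) (hfg : f ⊓ g = 0) (n : ℕ) :
    (P ^ n) f ⊓ (P ^ n) g = 0 := by
  rw [inf_eq_zero_iff_abs_sub] at hfg ⊢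
  rw [← map_sub, ← (hf.sub hg).pow_abs h hm, hfg, map_add]

/-- Along the recurrence times the contracting term of the Lasota–Yorke inequality disappears. -/
lemma bvNorm_le (h : IsLasotaYorke α A C ρ P) (hm : Tendsto m atTop atTop)
    (hg : IsRecurrent α A P m g) (hg0 : g ≠ 0) : bvNorm α A g ≤ 4 * C * ‖g‖ := by
  have hC : 0 < C := zero_lt_one.trans_le h.one_le
  have hpos : 0 < C * ‖g‖ := mul_pos hC (norm_pos_iff.2 hg0)
  have h1 : Tendsto (fun j => C * ρ ^ m j * bvNorm α A g + C * ‖g‖) atTop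
      (𝓝 (C * 0 * bvNorm α A g + C * ‖g‖)) :=
    ((((tendsto_pow_atTop_nhds_zero_of_lt_one h.rho_pos.le h.rho_lt).comp hm).const_mul
      C).mul_const _).add_const _
  rw [mul_zero, zero_mul, zero_add] at h1
  have h2 : ∀ᶠ j in atTop, (P ^ m j) g ∈ gbvBall α A (2 * (C * ‖g‖)) := by
    filter_upwards [h1.eventually_le_const (show C * ‖g‖ < 2 * (C * ‖g‖) by linarith)] with j hj
    have := h.bound (m j) g hg.1
    exact this.1.mem_gbvBall (this.2.trans hj)
  have h3 := (isClosed_gbvBall α A (2 * (C * ‖g‖))).mem_of_tendsto hg.2 h2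
  have h4 := (memBV_of_mem_gbvBall (by positivity) h3).2
  linarith

end IsRecurrent

/-- The Lebesgue measure of the set where `g` does not vanish. -/
def suppMeasure (g : L1) : ℝ := leb.real {x | g x ≠ 0}

lemma nullMeasurableSet_ne_zero (g : L1) : NullMeasurableSet {x | g x ≠ 0} leb :=
  ((L1.measurable_coeFn g) (measurableSet_singleton (0 : ℝ)).compl).nullMeasurableSet

lemma norm_le_mul_suppMeasure {g : L1} {M : ℝ} (h : ∀ᵐ x ∂leb, |g x| ≤ M) :
    ‖g‖ ≤ M * suppMeasure g := by
  have hs : MeasurableSet {x | g x ≠ 0} :=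
    (L1.measurable_coeFn g) (measurableSet_singleton (0 : ℝ)).compl
  rw [L1.norm_eq_integral_norm]
  calc ∫ x, ‖g x‖ ∂leb ≤ ∫ x, {x | g x ≠ 0}.indicator (fun _ => M) x ∂leb := by
        refine integral_mono_ae (L1.integrable_coeFn g).norm
          ((integrable_const M).indicator hs) ?_
        filter_upwards [h] with x hx
        by_cases h0 : g x = 0
        · rw [indicator_of_notMem (by simpa using h0), h0, norm_zero]
        · rw [indicator_of_mem (show x ∈ {x | g x ≠ 0} from h0)]; exact hx
    _ = M * suppMeasure g := by
        rw [integral_indicator hs, setIntegral_const, smul_eq_mul, mul_comm, suppMeasure]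

/-- The supports of two disjoint functions are disjoint inside the support of a third. -/
lemma suppMeasure_add_le {u v e : L1} (hu : 0 ≤ u) (hv : 0 ≤ v) (he : 0 ≤ e) (huv : u ⊓ v = 0) :
    suppMeasure (u ⊓ e) + suppMeasure (v ⊓ e) ≤ suppMeasure e := by
  rw [inf_eq_zero_iff_ae hu hv] at huv
  have hd : AEDisjoint leb {x | (u ⊓ e : L1) x ≠ 0} {x | (v ⊓ e : L1) x ≠ 0} := by
    rw [AEDisjoint, measure_eq_zero_iff_ae_notMem]
    rw [← Lp.coeFn_nonneg] at he
    filter_upwards [huv, he, Lp.coeFn_inf u e, Lp.coeFn_inf v e] with x h1 h2 h3 h4 hx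
    rcases h1 with h1 | h1
    · apply hx.1
      rw [h3]
      change min (u x) (e x) = 0
      rw [h1]; exact min_eq_left h2
    · apply hx.2
      rw [h4]
      change min (v x) (e x) = 0
      rw [h1]; exact min_eq_left h2
  rw [suppMeasure, suppMeasure, suppMeasure,
    ← measureReal_union₀ (nullMeasurableSet_ne_zero _) hd]
  refine ENNReal.toReal_mono (measure_ne_top _ _) (measure_mono_ae ?_)
  rw [← Lp.coeFn_nonneg] at hu hv
  filter_upwards [Lp.coeFn_inf u e, Lp.coeFn_inf v e, hu, hv] with x h3 h4 h5 h6 hx h0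
  rcases hx with hx | hx
  · apply hx
    rw [h3]
    change min (u x) (e x) = 0
    rw [h0]; exact min_eq_right h5
  · apply hx
    rw [h4]
    change min (v x) (e x) = 0
    rw [h0]; exact min_eq_right h6

namespace IsLasotaYorke

variable {α A C ρ : ℝ} {P : L1 →L[ℝ] L1} {m : ℕ → ℕ}

/-- Nonnegative recurrent functions disjoint from `u`: one whose support has nearly minimal measure
is an atom of the lattice of recurrent functions, since the supports cannot be arbitrarily small. -/
lemma exists_atom (h : IsLasotaYorke α A C ρ P) (hα : 0 < α) (hA : 0 < A)
    (hm : Tendsto m atTop atTop) {u e₀ : L1} (he₀ : IsRecurrent α A P m e₀)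
    (he₀0 : 0 ≤ e₀) (he₀n : e₀ ≠ 0) (hdis : e₀ ⊓ u = 0) :
    ∃ e : L1, IsRecurrent α A P m e ∧ 0 ≤ e ∧ e ≠ 0 ∧ e ⊓ u = 0 ∧
      ∀ v w : L1, IsRecurrent α A P m v → IsRecurrent α A P m w → 0 ≤ v → 0 ≤ w → v ⊓ w = 0 →
        v ⊓ e = 0 ∨ w ⊓ e = 0 := by
  obtain ⟨N, hN1, hN⟩ := exists_ae_abs_le hα.le hA
  have hC : 0 < C := zero_lt_one.trans_le h.one_le
  set S : Set L1 := {e | IsRecurrent α A P m e ∧ 0 ≤ e ∧ e ≠ 0 ∧ e ⊓ u = 0} with hS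
  have hlow : ∀ e ∈ S, (N * (4 * C))⁻¹ ≤ suppMeasure e := by
    rintro e ⟨h1, -, h3, -⟩
    have h4 := norm_le_mul_suppMeasure (hN e h1.1)
    have h5 := h1.bvNorm_le h hm h3
    have h6 : 0 < ‖e‖ := norm_pos_iff.2 h3
    have h7 : 0 ≤ suppMeasure e := measureReal_nonneg
    rw [inv_le_iff_one_le_mul₀ (by positivity)]
    have h8 : ‖e‖ ≤ N * (4 * C * ‖e‖) * suppMeasure e := h4.trans (by gcongr)
    have h9 : ‖e‖ * 1 ≤ ‖e‖ * (suppMeasure e * (N * (4 * C))) := by linarith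
    exact le_of_mul_le_mul_left h9 h6
  have hSne : (suppMeasure '' S).Nonempty := ⟨_, mem_image_of_mem _ ⟨he₀, he₀0, he₀n, hdis⟩⟩
  have hbdd : BddBelow (suppMeasure '' S) := ⟨0, by rintro _ ⟨e, -, rfl⟩; exact measureReal_nonneg⟩
  have hpos : 0 < sInf (suppMeasure '' S) := by
    refine lt_of_lt_of_le (show 0 < (N * (4 * C))⁻¹ by positivity) (le_csInf hSne ?_)
    rintro _ ⟨e, he, rfl⟩
    exact hlow e he
  obtain ⟨_, ⟨e, he, rfl⟩, hlt⟩ := exists_lt_of_csInf_lt hSne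
    (show sInf (suppMeasure '' S) < 2 * sInf (suppMeasure '' S) by linarith)
  refine ⟨e, he.1, he.2.1, he.2.2.1, he.2.2.2, fun v w hv hw hv0 hw0 hvw => ?_⟩
  by_contra! hcon
  have hmemS : ∀ v : L1, IsRecurrent α A P m v → 0 ≤ v → v ⊓ e ≠ 0 → v ⊓ e ∈ S := by
    intro v hv hv0 hne
    refine ⟨hv.inf h hm he.1, le_inf hv0 he.2.1, hne, ?_⟩
    rw [inf_assoc, he.2.2.2]
    exact inf_eq_right.2 hv0
  have h1 := csInf_le hbdd (mem_image_of_mem suppMeasure (hmemS v hv hv0 hcon.1))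
  have h2 := csInf_le hbdd (mem_image_of_mem suppMeasure (hmemS w hw hw0 hcon.2))
  have h3 := suppMeasure_add_le hv0 hw0 he.2.1 hvw
  linarith

/-- A nonzero recurrent function meets the unique invariant density, since otherwise the averages of
its iterates would accumulate at a disjoint invariant density. -/
lemma inf_invariant_ne_zero (h : IsLasotaYorke α A C ρ P) (hα : 0 < α) (hA : 0 < A)
    (hm : Tendsto m atTop atTop) {d : L1} (hd : MemBV α A d) (hd0 : 0 ≤ d) (hPd : P d = d)
    (hmass : mass d = 1) (huniq : ∀ g : L1, 0 ≤ g → P g = g → mass g = 1 → g = d)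
    {f : L1} (hf : IsRecurrent α A P m f) (hf0 : 0 ≤ f) (hfn : f ≠ 0) : f ⊓ d ≠ 0 := by
  intro hdis
  have hPn : ∀ n, (P ^ n) d = d := by
    intro n
    induction n with
    | zero => rfl
    | succ n ih => rw [pow_succ', mul_apply_eq_comp, ih, hPd]
  have hdr : IsRecurrent α A P m d := ⟨hd, by simp only [hPn]; exact tendsto_const_nhds⟩
  have hk : ∀ k, (P ^ k) f ⊓ d = 0 := by
    intro k
    have := hf.pow_inf_eq_zero h hm hdr hdis k
    rwa [hPn] at this
  obtain ⟨g, -, -, hg0, hPg, hgm, ns, -, hlim⟩ := h.exists_invariant hα hA hf.1 hf0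
  have hsum : ∀ n, (∑ k ∈ Finset.range n, (P ^ k) f) ⊓ d = 0 := by
    intro n
    induction n with
    | zero => rw [Finset.sum_range_zero]; exact inf_eq_left.2 hd0
    | succ n ih =>
      have h1 : 0 ≤ ∑ k ∈ Finset.range n, (P ^ k) f :=
        Finset.sum_nonneg fun k _ => h.pow_nonneg k hf0
      have h2 := h.pow_nonneg n hf0
      have h3 := hk n
      rw [Finset.sum_range_succ]
      rw [inf_eq_zero_iff_ae h1 hd0] at ih
      rw [inf_eq_zero_iff_ae h2 hd0] at h3
      rw [inf_eq_zero_iff_ae (add_nonneg h1 h2) hd0]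
      filter_upwards [ih, h3, Lp.coeFn_add (∑ k ∈ Finset.range n, (P ^ k) f) ((P ^ n) f)]
        with x h4 h5 h6
      rw [h6, Pi.add_apply]
      rcases h4 with h4 | h4
      · rcases h5 with h5 | h5
        · left; rw [h4, h5, add_zero]
        · right; exact h5
      · right; exact h4
  have havg : ∀ j, (((ns j + 1 : ℕ) : ℝ)⁻¹ • ∑ k ∈ Finset.range (ns j + 1), (P ^ k) f) ⊓ d = 0 := by
    intro j
    have h1 : 0 ≤ ∑ k ∈ Finset.range (ns j + 1), (P ^ k) f :=
      Finset.sum_nonneg fun k _ => h.pow_nonneg k hf0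
    have h2 := hsum (ns j + 1)
    rw [inf_eq_zero_iff_ae h1 hd0] at h2
    rw [inf_eq_zero_iff_ae (smul_nonneg_L1 (by positivity) h1) hd0]
    filter_upwards [h2, Lp.coeFn_smul (((ns j + 1 : ℕ) : ℝ)⁻¹)
      (∑ k ∈ Finset.range (ns j + 1), (P ^ k) f)] with x h3 h4
    rw [h4, Pi.smul_apply]
    rcases h3 with h3 | h3
    · left; rw [h3, smul_zero]
    · right; exact h3
  have hgd : g ⊓ d = 0 := by
    have h1 := hlim.inf_nhds (tendsto_const_nhds (x := d))
    simp only [havg] at h1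
    exact tendsto_nhds_unique h1 tendsto_const_nhds
  have hfpos : 0 < mass f := by rw [mass_eq_norm hf0]; exact norm_pos_iff.2 hfn
  have hgeq : (mass f)⁻¹ • g = d := by
    apply huniq
    · exact smul_nonneg_L1 (by positivity) hg0
    · rw [map_smul, hPg]
    · rw [map_smul, hgm, smul_eq_mul, inv_mul_cancel₀ hfpos.ne']
  have hg' : g = mass f • d := by rw [← hgeq, smul_smul, mul_inv_cancel₀ hfpos.ne', one_smul]
  rw [inf_eq_zero_iff_ae hg0 hd0] at hgd
  have hd00 : d = 0 := by
    apply Lp.ext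
    have h1 : (g : ℝ → ℝ) =ᵐ[leb] mass f • (d : ℝ → ℝ) := by
      conv_lhs => rw [hg']
      exact Lp.coeFn_smul _ _
    filter_upwards [hgd, h1, Lp.coeFn_zero ℝ 1 leb] with x h2 h3 h4
    rw [h4]
    rcases h2 with h2 | h2
    · rw [h3, Pi.smul_apply, smul_eq_mul] at h2
      exact (mul_eq_zero.1 h2).resolve_left hfpos.ne'
    · exact h2
  rw [hd00, map_zero] at hmass
  exact zero_ne_one hmass

/-- If the invariant density `d` is unique and the operator mixes the functions that meet `d`, then
the iterates of every function in `V_α` with integral zero tend to zero. -/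
theorem tendsto_norm_pow (h : IsLasotaYorke α A C ρ P) (hα : 0 < α) (hA : 0 < A)
    {d : L1} (hd : MemBV α A d) (hd0 : 0 ≤ d) (hPd : P d = d)
    (hmass : mass d = 1) (huniq : ∀ g : L1, 0 ≤ g → P g = g → mass g = 1 → g = d)
    (hmix : ∀ f g : L1, MemBV α A f → MemBV α A g → 0 ≤ f → 0 ≤ g → f ⊓ d ≠ 0 → g ⊓ d ≠ 0 →
      ∃ N, ∀ k ≥ N, (P ^ k) f ⊓ g ≠ 0)
    {φ : L1} (hφ : MemBV α A φ) (hφ0 : mass φ = 0) :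
    Tendsto (fun n => ‖(P ^ n) φ‖) atTop (𝓝 0) := by
  have hanti : Antitone fun n => ‖(P ^ n) φ‖ := fun i j hij => h.norm_pow_le_of_le hij φ
  have hbdd : BddBelow (range fun n => ‖(P ^ n) φ‖) :=
    ⟨0, by rintro _ ⟨n, rfl⟩; exact norm_nonneg _⟩
  have hlim := tendsto_atTop_ciInf hanti hbdd
  set c := ⨅ n, ‖(P ^ n) φ‖ with hc
  have hc0 : 0 ≤ c := le_ciInf fun n => norm_nonneg _
  rcases hc0.eq_or_lt with hc0 | hcpos
  · rwa [← hc0] at hlim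
  exfalso
  -- A limit point `f` of the orbit is recurrent along differences of its approach times.
  have hC : 0 ≤ C := zero_le_one.trans h.one_le
  have hR : 0 ≤ 2 * C * bvNorm α A φ := mul_nonneg (by positivity) (bvNorm_nonneg φ)
  obtain ⟨f, hfball, ns, hns, hflim⟩ := (isCompact_gbvBall hα hA hR).tendsto_subseq
    (x := fun n => (P ^ n) φ) fun n => (h.bound n φ hφ).1.mem_gbvBall (h.bvNorm_pow_le n hφ)
  set m : ℕ → ℕ := fun j => ns (2 * j) - ns j with hmdef
  have hmge : ∀ j, j + ns j ≤ ns (2 * j) := fun j => by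
    rw [two_mul]; exact hns.add_le_nat j j
  have hm : Tendsto m atTop atTop := by
    refine tendsto_atTop_mono (fun j => ?_) tendsto_id
    have := hmge j
    simp only [hmdef, id]; omega
  have hf : IsRecurrent α A P m f := by
    refine ⟨(memBV_of_mem_gbvBall hR hfball).1, ?_⟩
    rw [tendsto_iff_norm_sub_tendsto_zero]
    have h1 : Tendsto (fun j => ‖(P ^ ns j) φ - f‖) atTop (𝓝 0) :=
      tendsto_iff_norm_sub_tendsto_zero.1 hflim
    have h2 : Tendsto (fun j => ‖(P ^ ns (2 * j)) φ - f‖) atTop (𝓝 0) :=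
      h1.comp (tendsto_id.const_mul_atTop' (by norm_num : 0 < 2))
    have h3 := h1.add h2
    rw [add_zero] at h3
    refine squeeze_zero (fun j => norm_nonneg _) (fun j => ?_) h3
    have h4 : (P ^ m j) ((P ^ ns j) φ) = (P ^ ns (2 * j)) φ := by
      rw [← mul_apply_eq_comp, ← pow_add]
      have : m j + ns j = ns (2 * j) := by have := hmge j; simp only [hmdef]; omega
      rw [this]
    calc ‖(P ^ m j) f - f‖ = ‖(P ^ m j) (f - (P ^ ns j) φ) + ((P ^ ns (2 * j)) φ - f)‖ := by
          rw [map_sub, h4]; congr 1; abel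
      _ ≤ ‖(P ^ m j) (f - (P ^ ns j) φ)‖ + ‖(P ^ ns (2 * j)) φ - f‖ := norm_add_le _ _
      _ ≤ ‖(P ^ ns j) φ - f‖ + ‖(P ^ ns (2 * j)) φ - f‖ := by
          gcongr
          rw [norm_sub_rev _ f]
          exact h.norm_pow_le _ _
  have hfnorm : ‖f‖ = c :=
    tendsto_nhds_unique hflim.norm (hlim.comp hns.tendsto_atTop)
  have hfmass : mass f = 0 := by
    refine tendsto_nhds_unique ((mass.continuous.tendsto f).comp hflim) ?_
    refine tendsto_const_nhds.congr fun j => ?_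
    simp only [Function.comp_apply, h.mass_pow, hφ0]
  have hpm : ‖f⁺‖ = ‖f⁻‖ := by
    rw [← mass_eq_norm (posPart_nonneg f), ← mass_eq_norm (negPart_nonneg f), ← sub_eq_zero,
      ← map_sub, posPart_sub_negPart, hfmass]
  have hsum : ‖f⁺‖ + ‖f⁻‖ = c := by
    rw [← hfnorm, ← norm_abs_eq_norm f, ← mass_eq_norm (abs_nonneg f), ← posPart_add_negPart f,
      map_add, mass_eq_norm (posPart_nonneg f), mass_eq_norm (negPart_nonneg f)]
  have hp : f⁺ ≠ 0 := fun h0 => by rw [← hpm, h0, norm_zero] at hsum; linarith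
  have hn : f⁻ ≠ 0 := fun h0 => by rw [hpm, h0, norm_zero] at hsum; linarith
  have hpr := hf.posPart h hm
  have hnr : IsRecurrent α A P m f⁻ := by
    have := (hf.smul (-1)).posPart h hm
    rwa [neg_one_smul, posPart_neg] at this
  obtain ⟨e, her, he0, hen, hedis, hatom⟩ := h.exists_atom hα hA hm hnr
    (negPart_nonneg f) hn (by rw [inf_comm]; exact posPart_inf_negPart_eq_zero f)
  have hmeet := fun {g : L1} (hg : IsRecurrent α A P m g) (hg0 : 0 ≤ g) (hgn : g ≠ 0) =>
    h.inf_invariant_ne_zero hα hA hm hd hd0 hPd hmass huniq hg hg0 hgn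
  obtain ⟨N, hN⟩ := hmix f⁺ e hpr.1 her.1 (posPart_nonneg f) he0
    (hmeet hpr (posPart_nonneg f) hp) (hmeet her he0 hen)
  -- Along the recurrence times the atom `e` returns to itself, so the image of `f⁺` avoids it.
  have hret : ∀ᶠ j in atTop, (P ^ m j) e ⊓ e ≠ 0 := by
    have h1 : Tendsto (fun j => (P ^ m j) e ⊓ e) atTop (𝓝 (e ⊓ e)) :=
      her.2.inf_nhds tendsto_const_nhds
    rw [inf_idem] at h1
    exact h1.eventually_ne hen
  obtain ⟨j, hj1, hj2⟩ := (hret.and (hm.eventually_ge_atTop N)).exists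
  have hdisj := hpr.pow_inf_eq_zero h hm her (by rw [inf_comm]; exact hedis) (m j)
  rcases hatom _ _ (hpr.pow h (m j)) (her.pow h (m j)) (h.pow_nonneg _ (posPart_nonneg f))
    (h.pow_nonneg _ he0) hdisj with h1 | h1
  · exact hN (m j) hj2 h1
  · exact hj1 h1

end IsLasotaYorke

/-! ### Dependence of the transfer operator on the parameter -/

namespace IsBranched

variable {p : ℕ} {T : ℝ → ℝ} {c : Fin (p + 1) → ℝ}

lemma image_Icc (h : IsBranched T c) {k : Fin p} {u v : ℝ} (huv : u ≤ v)
    (hsub : Icc u v ⊆ Ioo (c k.castSucc) (c k.succ)) : T '' Icc u v = uIcc (T u) (T v) := by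
  have hcont : ContinuousOn T (Icc u v) := (h.differentiableOn k).continuousOn.mono hsub
  apply Subset.antisymm
  · rcases hcont.strictMonoOn_of_injOn_Icc' huv ((h.injOn k).mono hsub) with hm | hm
    · rw [uIcc_of_le (hm.monotoneOn (left_mem_Icc.2 huv) (right_mem_Icc.2 huv) huv)]
      exact hm.monotoneOn.image_Icc_subset
    · rw [uIcc_of_ge (hm.antitoneOn (left_mem_Icc.2 huv) (right_mem_Icc.2 huv) huv)]
      exact hm.antitoneOn.image_Icc_subset
  · have := intermediate_value_uIcc (a := u) (b := v) (f := T) (by rwa [uIcc_of_le huv])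
    rwa [uIcc_of_le huv] at this

lemma integral_abs_deriv_mul_comp (h : IsBranched T c) {k : Fin p} {u v : ℝ} (huv : u ≤ v)
    (hsub : Icc u v ⊆ Ioo (c k.castSucc) (c k.succ)) (ψ : ℝ → ℝ) :
    ∫ x in Icc u v, |deriv T x| * ψ (T x) = ∫ y in min (T u) (T v)..max (T u) (T v), ψ y := by
  have := integral_image_eq_integral_abs_deriv_smul (s := Icc u v) (f := T) (f' := deriv T)
    measurableSet_Icc (fun x hx => (h.hasDerivAt (hsub hx)).hasDerivWithinAt)
    ((h.injOn k).mono hsub) ψ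
  simp only [smul_eq_mul] at this
  rw [← this, h.image_Icc huv hsub, intervalIntegral.integral_of_le min_le_max,
    ← integral_Icc_eq_integral_Ioc, uIcc]

lemma aestronglyMeasurable_comp_restrict (h : IsBranched T c) {ψ : ℝ → ℝ} (hψ : Measurable ψ)
    {s : Set ℝ} (hs : s ⊆ Icc 0 1) :
    AEStronglyMeasurable (fun x => ψ (T x)) (volume.restrict s) :=
  (h.aestronglyMeasurable_comp hψ.aestronglyMeasurable).mono_measure
    (Measure.restrict_mono hs le_rfl)

/-- If `|T'|` is close to `d` on `[u, v]`, then `d ∫ ψ ∘ T` over `[u, v]` is close to the integral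
of `ψ` over the image of `[u, v]`. -/
lemma abs_mul_integral_comp_sub_le (h : IsBranched T c) {k : Fin p} {u v : ℝ} (huv : u ≤ v)
    (hsub : Icc u v ⊆ Ioo (c k.castSucc) (c k.succ)) {ψ : ℝ → ℝ} (hψ : Measurable ψ)
    (hψ1 : ∀ x, |ψ x| ≤ 1) {d e : ℝ} (hd : ∀ x ∈ Icc u v, |(|deriv T x| - d)| ≤ e) :
    |d * (∫ x in Icc u v, ψ (T x)) - ∫ y in min (T u) (T v)..max (T u) (T v), ψ y| ≤
      e * (v - u) := by
  have hI : Icc u v ⊆ Icc (0 : ℝ) 1 := hsub.trans (h.branch_subset k)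
  have hmeas := h.aestronglyMeasurable_comp_restrict hψ hI
  have hfin : volume (Icc u v) < ⊤ := measure_Icc_lt_top
  have hi1 : IntegrableOn (fun x => d * ψ (T x)) (Icc u v) :=
    (IntegrableOn.of_bound hfin hmeas 1 (Eventually.of_forall fun x => hψ1 _)).const_mul d
  have hi2 : IntegrableOn (fun x => |deriv T x| * ψ (T x)) (Icc u v) := by
    refine IntegrableOn.of_bound hfin
      ((measurable_deriv T).abs.aestronglyMeasurable.mul hmeas) (|d| + e) ?_
    filter_upwards [ae_restrict_mem measurableSet_Icc] with x hx
    have h1 := hd x hx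
    have h2 : |deriv T x| ≤ |d| + e := by
      have := (abs_le.1 h1).2
      linarith [le_abs_self d]
    calc ‖|deriv T x| * ψ (T x)‖ = |deriv T x| * |ψ (T x)| := by
          rw [Real.norm_eq_abs, abs_mul, abs_abs]
      _ ≤ (|d| + e) * 1 := mul_le_mul h2 (hψ1 _) (abs_nonneg _) ((abs_nonneg _).trans h2)
      _ = _ := mul_one _
  rw [← h.integral_abs_deriv_mul_comp huv hsub ψ, ← integral_const_mul, ← integral_sub hi1 hi2]
  have := norm_setIntegral_le_of_norm_le_const (μ := volume) (s := Icc u v) (C := e)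
    (f := fun x => d * ψ (T x) - |deriv T x| * ψ (T x)) hfin (fun x hx => by
      rw [← sub_mul, Real.norm_eq_abs, abs_mul, abs_sub_comm]
      have h1 := hd x hx
      calc _ ≤ e * 1 := mul_le_mul h1 (hψ1 _) (abs_nonneg _) ((abs_nonneg _).trans h1)
        _ = e := mul_one e)
  rwa [Real.volume_real_Icc_of_le huv, Real.norm_eq_abs] at this

end IsBranched

lemma abs_integral_min_max_sub_le {ψ : ℝ → ℝ} (hψ : Measurable ψ) (hψ1 : ∀ x, |ψ x| ≤ 1)
    {s t s' t' e : ℝ} (hs : |s - s'| ≤ e) (ht : |t - t'| ≤ e) :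
    |(∫ y in min s t..max s t, ψ y) - ∫ y in min s' t'..max s' t', ψ y| ≤ 2 * e := by
  have hint : ∀ a b : ℝ, IntervalIntegrable ψ volume a b := fun a b => by
    rw [intervalIntegrable_iff]
    exact IntegrableOn.of_bound measure_Ioc_lt_top hψ.aestronglyMeasurable 1
      (Eventually.of_forall fun x => hψ1 x)
  rw [intervalIntegral.integral_interval_sub_interval_comm (hint _ _) (hint _ _) (hint _ _)]
  have h1 := intervalIntegral.norm_integral_le_of_norm_le_const (a := min s t) (b := min s' t')
    (f := ψ) (C := 1) fun x _ => hψ1 x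
  have h2 := intervalIntegral.norm_integral_le_of_norm_le_const (a := max s t) (b := max s' t')
    (f := ψ) (C := 1) fun x _ => hψ1 x
  have h3 := (abs_min_sub_min_le_max s t s' t').trans (max_le hs ht)
  have h4 := (abs_max_sub_max_le_max s t s' t').trans (max_le hs ht)
  rw [Real.norm_eq_abs, one_mul, abs_sub_comm] at h1 h2
  refine (abs_sub _ _).trans ?_
  linarith

namespace ExpandingFamily

variable {α : ℝ} {p : ℕ} {T : ℝ → ℝ → ℝ} {b : Fin (p + 1) → ℝ → ℝ} {μ : ℝ → Measure ℝ}

lemma isBranched (hT : ExpandingFamily α p T b μ) {a : ℝ} (ha : a ∈ Icc (0 : ℝ) 1) :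
    IsBranched (T a) fun k => b k a where
  mapsTo := hT.mapsTo a ha
  zero := hT.b_zero a ha
  last := hT.b_last a ha
  strictMono := hT.b_strictMono a ha
  differentiableOn := hT.differentiableOn a ha
  one_le_deriv := fun k x hx => by
    obtain ⟨l, L, hl, -, h⟩ := hT.expanding
    exact hl.le.trans (h a ha k x hx).1

lemma exists_branch_length (hT : ExpandingFamily α p T b μ) :
    ∃ l : ℝ, 0 < l ∧ ∀ a ∈ Icc (0 : ℝ) 1, ∀ k : Fin p, l ≤ b k.succ a - b k.castSucc a := by
  obtain ⟨L, hL⟩ := hT.b_lipschitz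
  have hcont : ∀ k, ContinuousOn (b k) (Icc 0 1) := by
    intro k
    refine (LipschitzOnWith.of_dist_le_mul (K := L.toNNReal) fun x hx y hy => ?_).continuousOn
    rw [Real.dist_eq, Real.dist_eq]
    refine (hL k x hx y hy).trans (mul_le_mul_of_nonneg_right ?_ (abs_nonneg _))
    exact Real.le_coe_toNNReal L
  have key : ∀ k : Fin p, ∃ l : ℝ, 0 < l ∧ ∀ a ∈ Icc (0 : ℝ) 1,
      l ≤ b k.succ a - b k.castSucc a := by
    intro k
    obtain ⟨a₀, ha₀, hmin⟩ := isCompact_Icc.exists_isMinOn (nonempty_Icc.2 zero_le_one)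
      ((hcont k.succ).sub (hcont k.castSucc))
    exact ⟨_, sub_pos.2 (hT.b_strictMono a₀ ha₀ k.castSucc_lt_succ), fun a ha => hmin ha⟩
  choose l hl hlb using key
  rcases isEmpty_or_nonempty (Fin p) with hp | hp
  · exact ⟨1, one_pos, fun a _ k => (hp.false k).elim⟩
  · obtain ⟨k₀, hk₀⟩ := Finite.exists_min l
    exact ⟨l k₀, hl k₀, fun a ha k => (hk₀ k).trans (hlb k a ha)⟩

/-- The parameter derivative is uniformly bounded. At the midpoint of a branch the partition points
stay away for a time `η` independent of the branch, so the mean value theorem applies there; the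
Hölder conditions carry the bound to the whole branch. -/
lemma exists_paramDeriv_bound (hT : ExpandingFamily α p T b μ) :
    ∃ M : ℝ, 0 ≤ M ∧ ∀ a ∈ Icc (0 : ℝ) 1, ∀ k : Fin p, ∀ x ∈ branch b k a,
      |paramDeriv T a x| ≤ M := by
  obtain ⟨l, hl, hlb⟩ := hT.exists_branch_length
  obtain ⟨L, hL⟩ := hT.b_lipschitz
  obtain ⟨C₁, hC₁⟩ := hT.param_regular
  obtain ⟨C₂, hC₂⟩ := hT.paramDeriv_holder
  set η : ℝ := min 1 (l / (4 * (|L| + 1))) with hη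
  have hLpos : 0 < |L| + 1 := by positivity
  have hη0 : 0 < η := lt_min one_pos (by positivity)
  have hη1 : η ≤ 1 := min_le_left _ _
  have hLη : |L| * η ≤ l / 4 := by
    have h1 : η ≤ l / (4 * (|L| + 1)) := min_le_right _ _
    rw [le_div_iff₀ (by positivity)] at h1
    nlinarith [abs_nonneg L]
  refine ⟨1 / η + |C₁| + |C₂|, by positivity, fun a ha k x hx => ?_⟩
  set y : ℝ := (b k.castSucc a + b k.succ a) / 2 with hy
  have hlen := hlb a ha k
  have hyb : y ∈ branch b k a := by
    constructor <;> simp only [hy] <;> linarith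
  set a₀ : ℝ := min a (1 - η) with ha₀
  have ha₀0 : 0 ≤ a₀ := le_min ha.1 (by linarith)
  have ha₀a : a₀ ≤ a := min_le_left _ _
  have haa₀ : a ≤ a₀ + η := by
    rcases min_choice a (1 - η) with h | h
    · rw [ha₀, h]; linarith
    · rw [ha₀, h]; linarith [ha.2]
  have ha₀1 : a₀ + η ≤ 1 := by linarith [min_le_right a (1 - η)]
  have hJ : Icc a₀ (a₀ + η) ⊆ Icc 0 1 := Icc_subset_Icc ha₀0 ha₀1
  have hpart : ∀ s ∈ Icc a₀ (a₀ + η), y ∉ partitionPoints b s := by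
    intro s hs
    have hsa : |s - a| ≤ η := by
      rw [abs_le]; constructor <;> linarith [hs.1, hs.2]
    have hb : ∀ j, |b j s - b j a| ≤ l / 4 := fun j =>
      calc |b j s - b j a| ≤ L * |s - a| := hL j s (hJ hs) a ha
        _ ≤ |L| * η := mul_le_mul (le_abs_self L) hsa (abs_nonneg _) (abs_nonneg _)
        _ ≤ l / 4 := hLη
    have h1 := abs_le.1 (hb k.castSucc)
    have h2 := abs_le.1 (hb k.succ)
    refine (hT.isBranched (hJ hs)).notMem_range (k := k) ⟨?_, ?_⟩
    · simp only [hy]; linarith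
    · simp only [hy]; linarith
  have hyI : y ∈ Icc (0 : ℝ) 1 := (hT.isBranched ha).branch_subset k hyb
  obtain ⟨hdiff, hhol⟩ := hC₁ y hyI _ hJ ordConnected_Icc hpart
  obtain ⟨s, hs, hslope⟩ := exists_hasDerivAt_eq_slope (fun s => T s y)
    (fun s => paramDeriv T s y) (show a₀ < a₀ + η by linarith)
    (fun s hs => ((hdiff s hs).mono hJ).continuousWithinAt) (fun s hs => by
      have hn : Icc (0 : ℝ) 1 ∈ 𝓝 s := mem_of_superset (Icc_mem_nhds hs.1 hs.2) hJ
      exact (hdiff s (Ioo_subset_Icc_self hs)).hasDerivWithinAt.hasDerivAt hn)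
  have hsJ := Ioo_subset_Icc_self hs
  have hd1 : |paramDeriv T s y| ≤ 1 / η := by
    rw [hslope, add_sub_cancel_left, abs_div, abs_of_pos hη0]
    have h1 := hT.mapsTo _ (hJ (right_mem_Icc.2 (by linarith : a₀ ≤ a₀ + η))) hyI
    have h2 := hT.mapsTo _ (hJ (left_mem_Icc.2 (by linarith : a₀ ≤ a₀ + η))) hyI
    gcongr
    rw [abs_le]; constructor <;> linarith [h1.1, h1.2, h2.1, h2.2]
  have hd2 : |paramDeriv T a y - paramDeriv T s y| ≤ |C₁| := by
    refine (hhol a ⟨ha₀a, haa₀⟩ s hsJ).1.trans ?_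
    have h1 : |a - s| ^ α ≤ 1 := Real.rpow_le_one (abs_nonneg _) (by
      rw [abs_le]; constructor <;> linarith [ha.1, ha.2, (hJ hsJ).1, (hJ hsJ).2]) hT.alpha_pos.le
    calc C₁ * |a - s| ^ α ≤ |C₁| * 1 := mul_le_mul (le_abs_self _) h1 (by positivity) (abs_nonneg _)
      _ = _ := mul_one _
  have hd3 : |paramDeriv T a x - paramDeriv T a y| ≤ |C₂| := by
    refine (hC₂ a ha k x hx y hyb).trans ?_
    have hxI : x ∈ Icc (0 : ℝ) 1 := (hT.isBranched ha).branch_subset k hx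
    have h1 : |x - y| ^ α ≤ 1 := Real.rpow_le_one (abs_nonneg _) (by
      rw [abs_le]; constructor <;> linarith [hxI.1, hxI.2, hyI.1, hyI.2]) hT.alpha_pos.le
    calc C₂ * |x - y| ^ α ≤ |C₂| * 1 := mul_le_mul (le_abs_self _) h1 (by positivity) (abs_nonneg _)
      _ = _ := mul_one _
  have e : paramDeriv T a x = (paramDeriv T a x - paramDeriv T a y) +
      (paramDeriv T a y - paramDeriv T s y) + paramDeriv T s y := by ring
  rw [e]
  refine (abs_add_three _ _ _).trans ?_
  linarith

/-- On an interval that stays away from the partition points, the integrals of `ψ ∘ T_a` and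
`ψ ∘ T_{a'}` are close: both are, up to the nearly constant factor `|T'|`, integrals of `ψ` over
image intervals with nearby endpoints. -/
lemma exists_abs_integral_comp_sub_le (hT : ExpandingFamily α p T b μ) :
    ∃ E L : ℝ, 0 ≤ E ∧ 0 ≤ L ∧ ∀ a ∈ Icc (0 : ℝ) 1, ∀ a' ∈ Icc (0 : ℝ) 1, ∀ u v : ℝ, u ≤ v →
      Icc u v ⊆ Icc 0 1 →
      (∀ k, b k a ∉ Icc (u - L * |a - a'|) (v + L * |a - a'|)) →
      ∀ ψ : ℝ → ℝ, Measurable ψ → (∀ x, |ψ x| ≤ 1) →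
        |∫ x in Icc u v, (ψ (T a x) - ψ (T a' x))| ≤
          E * ((v - u) * ((v - u) ^ α + |a - a'| ^ α) + |a - a'|) := by
  obtain ⟨M, hM0, hM⟩ := hT.exists_paramDeriv_bound
  obtain ⟨L₀, hL₀⟩ := hT.b_lipschitz
  obtain ⟨C₁, hC₁⟩ := hT.param_regular
  obtain ⟨C₂, hC₂⟩ := hT.deriv_holder
  refine ⟨2 * M + 2 * |C₂| + |C₁|, |L₀|, by positivity, abs_nonneg _,
    fun a ha a' ha' u v huv hI hpart ψ hψ hψ1 => ?_⟩
  have hα := hT.alpha_pos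
  set Δ := |a - a'| with hΔ
  have hΔ0 : 0 ≤ Δ := abs_nonneg _
  have hBa := hT.isBranched ha
  have hBa' := hT.isBranched ha'
  have hJ : uIcc a a' ⊆ Icc 0 1 := by
    rw [uIcc]; exact Icc_subset_Icc (le_min ha.1 ha'.1) (max_le ha.2 ha'.2)
  have huI : u ∈ Icc u v := left_mem_Icc.2 huv
  -- The partition points do not cross `[u, v]` between the two parameters.
  have hside : ∀ s ∈ uIcc a a', ∀ k, |b k s - b k a| ≤ |L₀| * Δ := by
    intro s hs k
    have h1 : |s - a| ≤ Δ := by rw [hΔ, abs_sub_comm a a']; exact abs_sub_left_of_mem_uIcc hs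
    exact (hL₀ k s (hJ hs) a ha).trans
      (mul_le_mul (le_abs_self _) h1 (abs_nonneg _) (abs_nonneg _))
  have hcase : ∀ k, b k a < u - |L₀| * Δ ∨ v + |L₀| * Δ < b k a := by
    intro k
    by_contra! hcon
    exact hpart k ⟨hcon.1, hcon.2⟩
  have hLΔ : 0 ≤ |L₀| * Δ := by positivity
  have hua : u ∉ range fun k => b k a := by
    rintro ⟨k, hk⟩
    have hk' : b k a = u := hk
    rcases hcase k with h | h <;> linarith
  obtain ⟨k, hk⟩ := hBa.exists_branch (hI huI) hua
  have hsub : ∀ s ∈ uIcc a a', Icc u v ⊆ branch b k s := by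
    intro s hs x hx
    have h1 := abs_le.1 (hside s hs k.castSucc)
    have h2 := abs_le.1 (hside s hs k.succ)
    have h3 : b k.castSucc a < u - |L₀| * Δ := by
      rcases hcase k.castSucc with h | h
      · exact h
      · have : b k.castSucc a < u := hk.1
        linarith
    have h4 : v + |L₀| * Δ < b k.succ a := by
      rcases hcase k.succ with h | h
      · have : u < b k.succ a := hk.2
        linarith
      · exact h
    exact ⟨by linarith [hx.1], by linarith [hx.2]⟩
  have hsa := hsub a left_mem_uIcc
  have hsa' := hsub a' right_mem_uIcc
  have hreg : ∀ x ∈ Icc u v, |T a x - T a' x| ≤ M * Δ ∧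
      |deriv (T a) x - deriv (T a') x| ≤ |C₁| * Δ ^ α := by
    intro x hx
    obtain ⟨hdiff, hhol⟩ := hC₁ x (hI hx) (uIcc a a') hJ ordConnected_uIcc
      fun s hs => (hT.isBranched (hJ hs)).notMem_range (k := k) (hsub s hs hx)
    constructor
    · have := Convex.norm_image_sub_le_of_norm_hasDerivWithin_le (s := uIcc a a')
        (f := fun s => T s x) (f' := fun s => paramDeriv T s x) (C := M) (x := a') (y := a)
        (fun s hs => (hdiff s hs).hasDerivWithinAt.mono hJ)
        (fun s hs => hM s (hJ hs) k x (hsub s hs hx)) (convex_uIcc a a')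
        right_mem_uIcc left_mem_uIcc
      exact this
    · refine (hhol a left_mem_uIcc a' right_mem_uIcc).2.trans ?_
      exact mul_le_mul_of_nonneg_right (le_abs_self _) (by positivity)
  set d := |deriv (T a) u| with hd
  have hd1 : 1 ≤ d := hBa.one_le_deriv k u (hsa huI)
  have hda : ∀ x ∈ Icc u v, |(|deriv (T a) x| - d)| ≤ |C₂| * (v - u) ^ α := by
    intro x hx
    refine (abs_abs_sub_abs_le_abs_sub _ _).trans ((hC₂ a ha k x (hsa hx) u (hsa huI)).trans ?_)
    refine mul_le_mul (le_abs_self _) ?_ (by positivity) (abs_nonneg _)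
    refine Real.rpow_le_rpow (abs_nonneg _) ?_ hα.le
    rw [abs_of_nonneg (by linarith [hx.1])]
    linarith [hx.2]
  have hda' : ∀ x ∈ Icc u v, |(|deriv (T a') x| - d)| ≤ |C₂| * (v - u) ^ α + |C₁| * Δ ^ α := by
    intro x hx
    have h1 := hda x hx
    have h2 := (abs_abs_sub_abs_le_abs_sub _ _).trans (hreg x hx).2
    have e : |deriv (T a') x| - d =
        (|deriv (T a) x| - d) - (|deriv (T a) x| - |deriv (T a') x|) := by ring
    rw [e]
    refine (abs_sub _ _).trans ?_
    linarith
  have h1 := hBa.abs_mul_integral_comp_sub_le huv hsa hψ hψ1 hda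
  have h2 := hBa'.abs_mul_integral_comp_sub_le huv hsa' hψ hψ1 hda'
  have h3 := abs_integral_min_max_sub_le hψ hψ1 (hreg u huI).1 (hreg v (right_mem_Icc.2 huv)).1
  have hint : ∀ {a : ℝ}, a ∈ Icc (0 : ℝ) 1 → IntegrableOn (fun x => ψ (T a x)) (Icc u v) :=
    fun {a} ha => IntegrableOn.of_bound measure_Icc_lt_top
      ((hT.isBranched ha).aestronglyMeasurable_comp_restrict hψ hI) 1
      (Eventually.of_forall fun x => hψ1 _)
  rw [integral_sub (hint ha) (hint ha')]
  set q := ∫ x in Icc u v, ψ (T a x)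
  set q' := ∫ x in Icc u v, ψ (T a' x)
  have h4 : |d * (q - q')| ≤ |C₂| * (v - u) ^ α * (v - u) +
      (|C₂| * (v - u) ^ α + |C₁| * Δ ^ α) * (v - u) + 2 * (M * Δ) := by
    have e := abs_le.1 h1
    have e2 := abs_le.1 h2
    have e3 := abs_le.1 h3
    rw [abs_le]
    constructor <;> linarith [e.1, e.2, e2.1, e2.2, e3.1, e3.2]
  have h5 : |q - q'| ≤ |d * (q - q')| := by
    rw [abs_mul, abs_of_nonneg (zero_le_one.trans hd1)]
    exact le_mul_of_one_le_left (abs_nonneg _) hd1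
  refine h5.trans (h4.trans ?_)
  have w0 : 0 ≤ v - u := sub_nonneg.2 huv
  have wα : 0 ≤ (v - u) ^ α := Real.rpow_nonneg w0 α
  have dα : 0 ≤ Δ ^ α := Real.rpow_nonneg hΔ0 α
  have p1 : 0 ≤ (v - u) * (v - u) ^ α := mul_nonneg w0 wα
  have p2 : 0 ≤ (v - u) * Δ ^ α := mul_nonneg w0 dα
  have c1 := abs_nonneg C₁
  have c2 := abs_nonneg C₂
  have z1 := mul_nonneg hM0 p1
  have z2 := mul_nonneg hM0 p2
  have z3 := mul_nonneg c1 p1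
  have z4 := mul_nonneg c2 p2
  have z5 := mul_nonneg c1 hΔ0
  have z6 := mul_nonneg c2 hΔ0
  nlinarith

end ExpandingFamily

lemma integral_leb_eq_sum_cell {N : ℕ} (hN : 0 < N) {f : ℝ → ℝ} (hf : Integrable f leb) :
    ∫ x, f x ∂leb = ∑ j ∈ Finset.range N, ∫ x in cell N j, f x := by
  conv_lhs => rw [leb_eq_restrict_biUnion hN]
  refine integral_biUnion_finset _ (fun j _ => measurableSet_cell N j)
    (fun i _ j _ hij => disjoint_cell hN hij) fun j hj => ?_
  exact hf.mono_measure (volume_restrict_cell_le (Finset.mem_range.1 hj))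

/-- Testing a function of bounded variation against a bounded function `F`: after replacing `f` by
its averages over the cells, only the integrals of `F` over the cells matter. -/
lemma abs_integral_mul_le_sum_cell {α A B K : ℝ} {N : ℕ} (hN : 0 < N) (hNA : 1 / (N : ℝ) ≤ A)
    {f : L1} (hf : MemBV α A f) (hB : ∀ᵐ x ∂leb, |f x| ≤ B) {F : ℝ → ℝ}
    (hFm : AEStronglyMeasurable F leb) (hF : ∀ x, |F x| ≤ K) :
    |∫ x, f x * F x ∂leb| ≤ K * (bvNorm α A f * (1 / N : ℝ) ^ α) +
      B * ∑ j ∈ Finset.range N, |∫ x in cell N j, F x| := by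
  have hN' : (0 : ℝ) < N := by exact_mod_cast hN
  have hK : 0 ≤ K := (abs_nonneg _).trans (hF 0)
  have hFi : Integrable F leb := Integrable.of_bound hFm K (Eventually.of_forall hF)
  have hfi := L1.integrable_coeFn f
  have hprod : Integrable (fun x => f x * F x) leb :=
    hfi.mul_bdd hFm (Eventually.of_forall hF)
  set c : ℕ → ℝ := fun j => N * ∫ z in cell N j, f z with hc
  have hvr : ∀ j, volume.real (cell N j) = 1 / N := fun j => by
    rw [Measure.real, volume_cell hN, ENNReal.toReal_ofReal (by positivity)]
  have hcB : ∀ j ∈ Finset.range N, |c j| ≤ B := by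
    intro j hj
    have hj' := Finset.mem_range.1 hj
    have h1 : ‖∫ z in cell N j, f z‖ ≤ B * volume.real (cell N j) := by
      refine norm_setIntegral_le_of_norm_le_const_ae ?_ ?_
      · rw [volume_cell hN]; exact ENNReal.ofReal_lt_top
      · exact (volume_restrict_cell_le hj').absolutelyContinuous.ae_le hB
    rw [hvr, Real.norm_eq_abs] at h1
    rw [hc, abs_mul, Nat.abs_cast]
    calc (N : ℝ) * |∫ z in cell N j, f z| ≤ N * (B * (1 / N)) := by gcongr
      _ = B := by field_simp
  have hint : ∀ j ∈ Finset.range N, ∀ {g : ℝ → ℝ}, Integrable g leb → IntegrableOn g (cell N j) :=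
    fun j hj g hg => hg.mono_measure (volume_restrict_cell_le (Finset.mem_range.1 hj))
  have hfin : ∀ j, IsFiniteMeasure (volume.restrict (cell N j)) := fun j =>
    ⟨by rw [Measure.restrict_apply_univ, volume_cell hN]; exact ENNReal.ofReal_lt_top⟩
  have hdev : ∑ j ∈ Finset.range N, ∫ y in cell N j, |f y - c j| ≤
      bvNorm α A f * (1 / N : ℝ) ^ α := by
    have h1 := sum_lintegral_cell_sub_average_le (α := α) (A := A) hfi hN hNA
    have h2 : ∀ j ∈ Finset.range N, ENNReal.ofReal (∫ y in cell N j, |f y - c j|) =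
        ∫⁻ y in cell N j, ‖f y - c j‖ₑ := fun j hj => by
      have := hfin j
      have h3 : Integrable (fun y => f y - c j) (volume.restrict (cell N j)) :=
        (hint j hj hfi).sub (integrable_const _)
      exact ofReal_integral_norm_eq_lintegral_enorm h3
    rw [← Finset.sum_congr rfl h2, ← ENNReal.ofReal_sum_of_nonneg
      (fun j _ => integral_nonneg fun x => abs_nonneg _)] at h1
    have h4 : gbvSeminorm α A f ≤ ENNReal.ofReal (bvNorm α A f) := by
      rw [hf.ofReal_bvNorm, gbvNorm]; exact le_self_add
    have h5 := h1.trans (mul_le_mul_left h4 _)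
    rw [← ENNReal.ofReal_mul (bvNorm_nonneg f)] at h5
    exact (ENNReal.ofReal_le_ofReal_iff
      (mul_nonneg (bvNorm_nonneg f) (by positivity))).1 h5
  rw [integral_leb_eq_sum_cell hN hprod]
  calc |∑ j ∈ Finset.range N, ∫ x in cell N j, f x * F x|
      ≤ ∑ j ∈ Finset.range N, |∫ x in cell N j, f x * F x| := Finset.abs_sum_le_sum_abs _ _
    _ ≤ ∑ j ∈ Finset.range N,
          (K * (∫ y in cell N j, |f y - c j|) + B * |∫ x in cell N j, F x|) := by
        refine Finset.sum_le_sum fun j hj => ?_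
        have := hfin j
        have hFj := hint j hj hFi
        have h3 : Integrable (fun y => f y - c j) (volume.restrict (cell N j)) :=
          (hint j hj hfi).sub (integrable_const _)
        have h3m : Integrable (fun y => (f y - c j) * F y) (volume.restrict (cell N j)) :=
          h3.mul_bdd hFj.aestronglyMeasurable (Eventually.of_forall hF)
        have h4 : ∫ x in cell N j, f x * F x =
            (∫ x in cell N j, (f x - c j) * F x) + c j * ∫ x in cell N j, F x := by
          rw [← integral_const_mul, ← integral_add h3m (hFj.const_mul _)]
          congr 1; funext x; ring
        rw [h4]
        refine (abs_add_le _ _).trans (add_le_add ?_ ?_)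
        · rw [← integral_const_mul]
          refine (norm_integral_le_integral_norm _).trans (integral_mono h3m.norm
            (h3.abs.const_mul K) fun x => ?_)
          simp only [Real.norm_eq_abs, abs_mul]
          rw [mul_comm]
          gcongr
          exact hF x
        · rw [abs_mul]
          gcongr
          exact hcB j hj
    _ = K * (∑ j ∈ Finset.range N, ∫ y in cell N j, |f y - c j|) +
          B * ∑ j ∈ Finset.range N, |∫ x in cell N j, F x| := by
        rw [Finset.sum_add_distrib, Finset.mul_sum, Finset.mul_sum]
    _ ≤ _ := by gcongr

/-- The number of cells for parameters at distance `Δ`, of order `Δ ^ (-1/2)`: a compromise between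
the step function error `N ^ (-α)` and the total displacement `N Δ` of the cell images. -/
lemma exists_cell_count {α Δ : ℝ} (hα : 0 < α) (hα1 : α ≤ 1) (hΔpos : 0 < Δ) (hΔ1 : Δ ≤ 1)
    (n : ℕ) :
    ∃ N : ℕ, 0 < N ∧ 1 / (N : ℝ) ≤ 1 / ((n : ℝ) + 1) ∧ (1 / N : ℝ) ^ α ≤ Δ ^ (α / 2) ∧
      1 / (N : ℝ) ≤ Δ ^ (α / 2) ∧ N * Δ ≤ 2 * ((n : ℝ) + 1) * Δ ^ (α / 2) := by
  set n₀ : ℝ := (n : ℝ) + 1 with hn₀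
  have hn₀1 : 1 ≤ n₀ := by simp [hn₀]
  set s : ℝ := Δ ^ (1 / 2 : ℝ) with hs
  have hs0 : 0 < s := Real.rpow_pos_of_pos hΔpos _
  have hss : s * s = Δ := by
    rw [hs, ← Real.rpow_add hΔpos]; norm_num
  have hs1 : s ≤ 1 := Real.rpow_le_one hΔpos.le hΔ1 (by norm_num)
  set N : ℕ := (n + 1) * ⌈1 / s⌉₊ with hNdef
  have hceil0 : 0 < ⌈1 / s⌉₊ := Nat.ceil_pos.2 (by positivity)
  have hN : 0 < N := Nat.mul_pos n.succ_pos hceil0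
  have hN' : (0 : ℝ) < N := by exact_mod_cast hN
  have hNcast : (N : ℝ) = n₀ * ⌈1 / s⌉₊ := by simp [hNdef, hn₀]
  have hc1 : 1 / s ≤ (⌈1 / s⌉₊ : ℝ) := Nat.le_ceil _
  have hc2 : (⌈1 / s⌉₊ : ℝ) ≤ 2 / s := by
    have h1 := (Nat.ceil_lt_add_one (show 0 ≤ 1 / s by positivity)).le
    have h2 : 1 ≤ 1 / s := by rw [le_div_iff₀ hs0]; linarith
    have h3 : 2 / s = 1 / s + 1 / s := by ring
    linarith
  have hc3 : (1 : ℝ) ≤ (⌈1 / s⌉₊ : ℝ) := by exact_mod_cast hceil0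
  have hNA : 1 / (N : ℝ) ≤ 1 / n₀ := by
    rw [hNcast]
    apply one_div_le_one_div_of_le (by positivity)
    nlinarith
  have hNs : 1 / (N : ℝ) ≤ s := by
    rw [div_le_iff₀ hN', hNcast]
    have h1 : 1 ≤ s * (⌈1 / s⌉₊ : ℝ) := by
      rw [div_le_iff₀ hs0] at hc1; linarith
    nlinarith
  have hNΔ : (N : ℝ) * Δ ≤ 2 * n₀ * s := by
    rw [hNcast, ← hss]
    rw [le_div_iff₀ hs0] at hc2
    have : n₀ * s * ((⌈1 / s⌉₊ : ℝ) * s) ≤ n₀ * s * 2 := by gcongr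
    linarith
  set r : ℝ := Δ ^ (α / 2) with hr
  have hr0 : 0 < r := Real.rpow_pos_of_pos hΔpos _
  have hsr : s ≤ r := Real.rpow_le_rpow_of_exponent_ge hΔpos hΔ1 (by linarith [hα1])
  have hNr : (1 / N : ℝ) ^ α ≤ r := by
    have h1 : (1 / N : ℝ) ^ α ≤ s ^ α := Real.rpow_le_rpow (by positivity) hNs hα.le
    refine h1.trans (le_of_eq ?_)
    rw [hs, hr, ← Real.rpow_mul hΔpos.le]
    congr 1; ring
  refine ⟨N, hN, hNA, hNr, hNs.trans hsr, hNΔ.trans ?_⟩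
  gcongr

namespace ExpandingFamily

variable {α : ℝ} {p : ℕ} {T : ℝ → ℝ → ℝ} {b : Fin (p + 1) → ℝ → ℝ} {μ : ℝ → Measure ℝ}

/-- Cells far from all partition points are compared by the change of variables along a branch; the
remaining ones lie in a set of small measure. -/
lemma exists_sum_cell_le (hT : ExpandingFamily α p T b μ) :
    ∃ E L : ℝ, 0 ≤ E ∧ 0 ≤ L ∧ ∀ a ∈ Icc (0 : ℝ) 1, ∀ a' ∈ Icc (0 : ℝ) 1, ∀ N : ℕ, 0 < N →
      ∀ ψ : ℝ → ℝ, Measurable ψ → (∀ x, |ψ x| ≤ 1) →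
        ∑ j ∈ Finset.range N, |∫ x in cell N j, (ψ (T a x) - ψ (T a' x))| ≤
          E * ((1 / N : ℝ) ^ α + |a - a'| ^ α + N * |a - a'|) +
            4 * (p + 1) * (1 / N + L * |a - a'|) := by
  obtain ⟨E, L, hE, hL, hEL⟩ := hT.exists_abs_integral_comp_sub_le
  refine ⟨E, L, hE, hL, fun a ha a' ha' N hN ψ hψ hψ1 => ?_⟩
  have hN' : (0 : ℝ) < N := by exact_mod_cast hN
  set Δ := |a - a'| with hΔ
  have hΔ0 : 0 ≤ Δ := abs_nonneg _
  set w : ℝ := 1 / N + L * Δ with hw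
  have hw0 : 0 ≤ w := by positivity
  set F : ℝ → ℝ := fun x => ψ (T a x) - ψ (T a' x) with hF
  have hF2 : ∀ x, ‖F x‖ ≤ 2 := fun x => by
    rw [Real.norm_eq_abs]
    refine (abs_sub _ _).trans ?_
    linarith [hψ1 (T a x), hψ1 (T a' x)]
  -- The cells near a partition point lie in `bad`.
  set bad : Set ℝ := ⋃ k ∈ (Finset.univ : Finset (Fin (p + 1))), Icc (b k a - w) (b k a + w)
    with hbad
  have hbadm : MeasurableSet bad :=
    Finset.measurableSet_biUnion _ fun k _ => measurableSet_Icc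
  have hbadfin : volume bad ≠ ⊤ := by
    refine ne_top_of_le_ne_top ?_ (measure_biUnion_finset_le _ _)
    exact (ENNReal.sum_lt_top.2 fun k _ => measure_Icc_lt_top).ne
  have hbadv : volume.real bad ≤ (p + 1) * (2 * w) := by
    refine (measureReal_biUnion_finset_le _ _).trans ?_
    have : ∀ k : Fin (p + 1), volume.real (Icc (b k a - w) (b k a + w)) = 2 * w := fun k => by
      rw [Real.volume_real_Icc_of_le (by linarith)]; ring
    simp [this]
  have hcellfin : ∀ j, volume (cell N j) < ⊤ := fun j => by
    rw [volume_cell hN]; exact ENNReal.ofReal_lt_top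
  have hcell : ∀ j ∈ Finset.range N, |∫ x in cell N j, F x| ≤
      E * (1 / N * ((1 / N : ℝ) ^ α + Δ ^ α) + Δ) + 2 * volume.real (cell N j ∩ bad) := by
    intro j hj
    have hj' := Finset.mem_range.1 hj
    have hlen : ((j : ℝ) + 1) / N - j / N = 1 / N := by rw [add_div]; ring
    have hle : (j : ℝ) / N ≤ (j + 1 : ℝ) / N := by gcongr; linarith
    by_cases hgood : ∀ k, b k a ∉ Icc ((j : ℝ) / N - L * Δ) ((j + 1 : ℝ) / N + L * Δ)
    · have hsub : Icc ((j : ℝ) / N) ((j + 1 : ℝ) / N) ⊆ Icc 0 1 := by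
        refine Icc_subset_Icc (by positivity) ?_
        rw [div_le_one hN']
        exact_mod_cast hj'
      have h1 := hEL a ha a' ha' _ _ hle hsub hgood ψ hψ hψ1
      rw [hlen, integral_Icc_eq_integral_Ioc] at h1
      refine h1.trans (le_add_of_nonneg_right (by positivity))
    · push Not at hgood
      obtain ⟨k, hk⟩ := hgood
      have hsub : cell N j ⊆ bad := by
        intro x hx
        simp only [hbad, mem_iUnion]
        refine ⟨k, Finset.mem_univ _, ?_, ?_⟩
        · simp only [hw]; linarith [hx.1, hx.2, hk.1, hk.2]
        · simp only [hw]; linarith [hx.1, hx.2, hk.1, hk.2]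
      rw [inter_eq_left.2 hsub]
      have h1 := norm_setIntegral_le_of_norm_le_const (hcellfin j) (fun x _ => hF2 x)
      rw [Real.norm_eq_abs] at h1
      exact h1.trans (le_add_of_nonneg_left (by positivity))
  have hsumbad : ∑ j ∈ Finset.range N, volume.real (cell N j ∩ bad) ≤ volume.real bad := by
    rw [← measureReal_biUnion_finset (fun i _ j _ hij =>
      (disjoint_cell hN hij).mono inter_subset_left inter_subset_left)
      (fun j _ => (measurableSet_cell N j).inter hbadm)
      (fun j _ => ne_top_of_le_ne_top hbadfin (measure_mono inter_subset_right))]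
    refine measureReal_mono ?_ hbadfin
    exact iUnion₂_subset fun j _ => inter_subset_right
  calc _ ≤ ∑ j ∈ Finset.range N,
        (E * (1 / N * ((1 / N : ℝ) ^ α + Δ ^ α) + Δ) + 2 * volume.real (cell N j ∩ bad)) :=
        Finset.sum_le_sum hcell
    _ = E * ((1 / N : ℝ) ^ α + Δ ^ α + N * Δ) +
          2 * ∑ j ∈ Finset.range N, volume.real (cell N j ∩ bad) := by
        rw [Finset.sum_add_distrib, ← Finset.mul_sum, Finset.sum_const, Finset.card_range,
          nsmul_eq_mul]
        field_simp
        rw [Finset.mul_sum]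
    _ ≤ E * ((1 / N : ℝ) ^ α + Δ ^ α + N * Δ) + 2 * ((p + 1) * (2 * w)) := by
        gcongr
        exact hsumbad.trans hbadv
    _ = _ := by ring

/-- The transfer operator is Hölder continuous in the parameter, from `V_α` to `L¹`. -/
theorem exists_norm_transferL1_sub_le (hT : ExpandingFamily α p T b μ) {A : ℝ} (hA : 0 < A) :
    ∃ D κ : ℝ, 0 ≤ D ∧ 0 < κ ∧ ∀ a (ha : a ∈ Icc (0 : ℝ) 1) a' (ha' : a' ∈ Icc (0 : ℝ) 1)
      (f : L1), MemBV α A f →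
        ‖(hT.isBranched ha).transferL1 f - (hT.isBranched ha').transferL1 f‖ ≤
          D * |a - a'| ^ κ * bvNorm α A f := by
  have hα := hT.alpha_pos
  obtain ⟨E, L, hE, hL, hEL⟩ := hT.exists_sum_cell_le
  obtain ⟨M, hM1, hM⟩ := exists_ae_abs_le hα.le hA
  obtain ⟨n, hn⟩ := exists_nat_one_div_lt hA
  set n₀ : ℝ := (n : ℝ) + 1 with hn₀
  have hn₀1 : 1 ≤ n₀ := by simp [hn₀]
  refine ⟨2 + M * (E * (2 + 2 * n₀) + 4 * (p + 1) * (1 + L)), α / 2, by positivity, by positivity,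
    fun a ha a' ha' f hf => ?_⟩
  set Δ := |a - a'| with hΔ
  rcases eq_or_ne a a' with rfl | hne
  · rw [sub_self, norm_zero]
    have := bvNorm_nonneg (α := α) (A := A) f
    positivity
  have hΔpos : 0 < Δ := abs_pos.2 (sub_ne_zero.2 hne)
  have hΔ1 : Δ ≤ 1 := by
    rw [hΔ, abs_le]; constructor <;> linarith [ha.1, ha.2, ha'.1, ha'.2]
  set P := (hT.isBranched ha).transferL1
  set P' := (hT.isBranched ha').transferL1
  set g : L1 := P f - P' f with hg
  -- The sign of `g` is the test function that computes the norm of `g`.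
  set ψ : ℝ → ℝ := fun x => if 0 ≤ g x then 1 else -1 with hψ
  have hψm : Measurable ψ :=
    Measurable.ite ((L1.measurable_coeFn g) measurableSet_Ici) measurable_const measurable_const
  have hψ1 : ∀ x, |ψ x| ≤ 1 := fun x => by simp only [hψ]; split_ifs <;> simp
  have hcm : ∀ {a : ℝ} (ha : a ∈ Icc (0 : ℝ) 1),
      AEStronglyMeasurable (fun x => ψ (T a x)) leb := fun ha =>
    (hT.isBranched ha).aestronglyMeasurable_comp hψm.aestronglyMeasurable
  have hfi : ∀ {a : ℝ} (ha : a ∈ Icc (0 : ℝ) 1),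
      Integrable (fun x => f x * ψ (T a x)) leb := fun ha =>
    (L1.integrable_coeFn f).mul_bdd (hcm ha) (Eventually.of_forall fun x => hψ1 _)
  have hnorm : ‖g‖ = ∫ x, f x * (ψ (T a x) - ψ (T a' x)) ∂leb := by
    have h1 := (hT.isBranched ha).integral_transferL1_mul f (hfi ha)
    have h2 := (hT.isBranched ha').integral_transferL1_mul f (hfi ha')
    have h3 : ∫ x, f x * (ψ (T a x) - ψ (T a' x)) ∂leb =
        (∫ x, f x * ψ (T a x) ∂leb) - ∫ x, f x * ψ (T a' x) ∂leb := by
      rw [← integral_sub (hfi ha) (hfi ha')]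
      congr 1; funext x; ring
    rw [h3, ← h1.2, ← h2.2, ← integral_sub h1.1 h2.1, L1.norm_eq_integral_norm]
    apply integral_congr_ae
    filter_upwards [Lp.coeFn_sub (P f) (P' f)] with x hx
    have hx' : P f x * ψ x - P' f x * ψ x = g x * ψ x := by
      rw [hg, hx, Pi.sub_apply]; ring
    change ‖g x‖ = P f x * ψ x - P' f x * ψ x
    rw [hx', Real.norm_eq_abs]
    simp only [hψ]
    split_ifs with h0
    · rw [abs_of_nonneg h0, mul_one]
    · rw [abs_of_neg (not_le.1 h0), mul_neg_one]
  obtain ⟨N, hN, hNn, hNr, hNr1, hNΔ⟩ := exists_cell_count hα hT.alpha_le hΔpos hΔ1 n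
  have hNA : 1 / (N : ℝ) ≤ A := hNn.trans hn.le
  set r : ℝ := Δ ^ (α / 2) with hr
  have hr0 : 0 < r := Real.rpow_pos_of_pos hΔpos _
  have hΔr : Δ ^ α ≤ r := Real.rpow_le_rpow_of_exponent_ge hΔpos hΔ1 (by linarith)
  have hΔr1 : Δ ≤ r := by
    have := Real.rpow_le_rpow_of_exponent_ge hΔpos hΔ1
      (show α / 2 ≤ 1 by linarith [hT.alpha_le])
    rwa [Real.rpow_one] at this
  have hbv := bvNorm_nonneg (α := α) (A := A) f
  have hmain := abs_integral_mul_le_sum_cell (K := 2) hN hNA hf (hM f hf)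
    ((hcm ha).sub (hcm ha')) (fun x => by
      refine (abs_sub _ _).trans ?_
      linarith [hψ1 (T a x), hψ1 (T a' x)])
  simp only [Pi.sub_apply] at hmain
  rw [hnorm]
  refine (le_abs_self _).trans (hmain.trans ?_)
  have hsum : ∑ j ∈ Finset.range N, |∫ x in cell N j, (ψ (T a x) - ψ (T a' x))| ≤
      (E * (2 + 2 * n₀) + 4 * (p + 1) * (1 + L)) * r := by
    refine (hEL a ha a' ha' N hN ψ hψm hψ1).trans ?_
    have h1 : (1 / N : ℝ) ^ α + Δ ^ α + N * Δ ≤ (2 + 2 * n₀) * r := by linarith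
    have h2 : 1 / (N : ℝ) + L * Δ ≤ (1 + L) * r := by
      have := mul_le_mul_of_nonneg_left hΔr1 hL
      linarith
    calc _ ≤ E * ((2 + 2 * n₀) * r) + 4 * (p + 1) * ((1 + L) * r) := by gcongr
      _ = _ := by ring
  have hB : 0 ≤ M * bvNorm α A f := mul_nonneg (zero_le_one.trans hM1) hbv
  have h1 := mul_le_mul_of_nonneg_left hsum hB
  have h2 := mul_le_mul_of_nonneg_left hNr hbv
  linarith

end ExpandingFamily

/-! ### Invariant densities -/

lemma integrable_mul_of_ae_bound {f ψ : ℝ → ℝ} {K : ℝ} (hf : AEStronglyMeasurable f leb)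
    (hK : ∀ᵐ x ∂leb, |f x| ≤ K) (hψ : Integrable ψ leb) :
    Integrable (fun x => f x * ψ x) leb :=
  hψ.bdd_mul (c := K) hf hK

namespace IsBranched

variable {p : ℕ} {T : ℝ → ℝ} {c : Fin (p + 1) → ℝ}

lemma integrable_comp_iterate (h : IsBranched T c) {ψ : ℝ → ℝ} (hψ : Integrable ψ leb) (n : ℕ) :
    Integrable (fun x => ψ (T^[n] x)) leb := by
  induction n with
  | zero => exact hψ
  | succ n ih =>
    simp only [Function.iterate_succ_apply]
    exact h.integrable_comp ih

lemma mass_transferL1 (h : IsBranched T c) (f : L1) : mass (h.transferL1 f) = mass f := by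
  rw [mass_apply, mass_apply, integral_congr_ae (h.coeFn_transferL1 f)]
  exact h.integral_transfer (L1.integrable_coeFn f)

/-- Duality for the iterates. -/
lemma integral_pow_transferL1_mul {α A C ρ : ℝ} (h : IsBranched T c)
    (hP : IsLasotaYorke α A C ρ h.transferL1) (hα : 0 ≤ α) (hA : 0 < A) (n : ℕ) {f : L1}
    (hf : MemBV α A f) {ψ : ℝ → ℝ} (hψ : Integrable ψ leb) :
    ∫ x, (h.transferL1 ^ n) f x * ψ x ∂leb = ∫ x, f x * ψ (T^[n] x) ∂leb := by
  obtain ⟨N, -, hN⟩ := exists_ae_abs_le hα hA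
  induction n generalizing f with
  | zero => rfl
  | succ n ih =>
    rw [pow_succ, mul_apply_eq_comp]
    have h1 : MemBV α A (h.transferL1 f) := by
      have := (hP.bound 1 f hf).1
      rwa [pow_one] at this
    rw [ih h1]
    have h2 : Integrable (fun x => f x * ψ (T^[n] (T x))) leb :=
      integrable_mul_of_ae_bound (L1.aestronglyMeasurable_coeFn f) (hN f hf)
        (h.integrable_comp (h.integrable_comp_iterate hψ n))
    exact (h.integral_transferL1_mul f (ψ := fun x => ψ (T^[n] x)) h2).2

/-- A normalised nonnegative fixed point of the transfer operator is an invariant density. -/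
lemma isACIP_withDensity (h : IsBranched T c) {g : L1} (hg : 0 ≤ g) (hfix : h.transferL1 g = g)
    (hmass : mass g = 1) : IsACIP T (leb.withDensity fun x => ENNReal.ofReal (g x)) := by
  have hgm := L1.measurable_coeFn g
  have hgi := L1.integrable_coeFn g
  have hg0 : 0 ≤ᵐ[leb] g := (Lp.coeFn_nonneg g).2 hg
  have hac : leb.withDensity (fun x => ENNReal.ofReal (g x)) ≪ leb :=
    withDensity_absolutelyContinuous _ _
  have hset : ∀ s, NullMeasurableSet s leb →
      (leb.withDensity fun x => ENNReal.ofReal (g x)) s =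
        ENNReal.ofReal (∫ x, g x * s.indicator (fun _ => 1) x ∂leb) := by
    intro s hs
    rw [withDensity_apply', ← ofReal_integral_eq_lintegral_ofReal hgi.integrableOn
      (ae_restrict_of_ae hg0), ← integral_indicator₀ hs]
    congr 2
    funext x
    by_cases hx : x ∈ s
    · rw [indicator_of_mem hx, indicator_of_mem hx, mul_one]
    · rw [indicator_of_notMem hx, indicator_of_notMem hx, mul_zero]
  refine ⟨⟨?_⟩, hac, ?_⟩
  · rw [hset univ MeasurableSet.univ.nullMeasurableSet]
    simp only [indicator_univ, mul_one]
    rw [← mass_apply, hmass, ENNReal.ofReal_one]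
  · ext s hs
    have hTm : AEMeasurable T leb := h.aemeasurable
    rw [Measure.map_apply_of_aemeasurable (hTm.mono_ac hac) hs,
      hset _ (hTm.nullMeasurableSet_preimage hs), hset s hs.nullMeasurableSet]
    congr 1
    have hind : AEStronglyMeasurable (s.indicator fun _ => (1 : ℝ)) leb :=
      (stronglyMeasurable_const.indicator hs).aestronglyMeasurable
    have hb : ∀ y, |s.indicator (fun _ => (1 : ℝ)) y| ≤ 1 := fun y => by
      rw [indicator]; split_ifs <;> simp
    have h1 := (h.integral_transferL1_mul g (ψ := s.indicator fun _ => 1)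
      (hgi.mul_bdd (h.aestronglyMeasurable_comp hind) (Eventually.of_forall fun x => hb _))).2
    rw [hfix] at h1
    rw [h1]
    rfl

end IsBranched

/-- A nonzero nonnegative function in `V_α` is bounded below on some interval. -/
lemma exists_cell_bound_below {α A : ℝ} (hα : 0 < α) (hA : 0 < A) {u : L1} (hu : MemBV α A u)
    (hu0 : 0 ≤ u) (hun : u ≠ 0) :
    ∃ N j : ℕ, j < N ∧ ∃ r : ℝ, 0 < r ∧ ∀ᵐ y ∂volume.restrict (cell N j), r ≤ u y := by
  have hlim : Tendsto (fun n : ℕ => bvNorm α A u * (1 / ((n : ℝ) + 1)) ^ α) atTop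
      (𝓝 (bvNorm α A u * 0 ^ α)) :=
    (tendsto_one_div_add_atTop_nhds_zero_nat.rpow_const (Or.inr hα.le)).const_mul _
  rw [Real.zero_rpow hα.ne', mul_zero] at hlim
  have hlim2 := tendsto_one_div_add_atTop_nhds_zero_nat (𝕜 := ℝ)
  obtain ⟨n, hn1, hn2⟩ := ((hlim.eventually_lt_const (norm_pos_iff.2 hun)).and
    (hlim2.eventually_le_const hA)).exists
  set N := n + 1 with hNdef
  have hcast : ((n : ℝ) + 1) = (N : ℝ) := by simp [hNdef]
  rw [hcast] at hn1 hn2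
  have hN : 0 < N := Nat.succ_pos n
  have hN' : (0 : ℝ) < N := by exact_mod_cast hN
  have h1 : ∑ j ∈ Finset.range N, ∫⁻ x in cell N j, osc u (1 / N) x <
      ∑ j ∈ Finset.range N, ∫⁻ x in cell N j, ENNReal.ofReal (u x) := by
    rw [← lintegral_leb_eq_sum_cell hN, ← lintegral_leb_eq_sum_cell hN,
      ← ofReal_integral_eq_lintegral_ofReal (L1.integrable_coeFn u) ((Lp.coeFn_nonneg u).2 hu0),
      ← mass_apply, mass_eq_norm hu0]
    refine (lintegral_osc_le (α := α) (A := A) (by positivity) hn2).trans_lt ?_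
    refine lt_of_le_of_lt ?_ ((ENNReal.ofReal_lt_ofReal_iff (norm_pos_iff.2 hun)).2 hn1)
    rw [ENNReal.ofReal_mul (bvNorm_nonneg u), hu.ofReal_bvNorm]
    exact mul_le_mul_left le_self_add _
  obtain ⟨j, hj, hlt⟩ := Finset.exists_lt_of_sum_lt h1
  have hj' := Finset.mem_range.1 hj
  have hvol := volume_cell hN j
  have hne : volume (cell N j) ≠ 0 := by rw [hvol]; simp [hN']
  have htop : volume (cell N j) ≠ ⊤ := by rw [hvol]; exact ENNReal.ofReal_ne_top
  obtain ⟨x, hx, hxo⟩ := exists_le_setLAverage hne htop (f := osc u (1 / N))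
    (measurable_osc u _).aemeasurable
  rw [setLAverage_eq, ENNReal.le_div_iff_mul_le (Or.inl hne) (Or.inl htop)] at hxo
  have hlt2 := hxo.trans_lt hlt
  have hosc : osc u (1 / N) x ≠ ⊤ := fun hh => by
    rw [hh, ENNReal.top_mul hne] at hlt2
    exact not_top_lt hlt2
  obtain ⟨r, v, hrv, hb, he⟩ := exists_bounds_of_osc_ne_top (cell_subset_Icc hj' hx)
    (by positivity) hosc
  have hb' : ∀ᵐ y ∂volume.restrict (cell N j), r ≤ u y ∧ u y ≤ v :=
    (restrict_cell_le hj' hx).absolutelyContinuous.ae_le hb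
  refine ⟨N, j, hj', r, ?_, hb'.mono fun y hy => hy.1⟩
  by_contra! hr
  have h2 : ∫⁻ x in cell N j, ENNReal.ofReal (u x) ≤ ENNReal.ofReal v * volume (cell N j) := by
    rw [← setLIntegral_const]
    exact lintegral_mono_ae (hb'.mono fun y hy => ENNReal.ofReal_le_ofReal hy.2)
  have h3 : ENNReal.ofReal v ≤ osc u (1 / N) x := by
    rw [← he]; exact ENNReal.ofReal_le_ofReal (by linarith)
  exact absurd (hlt2.trans_le (h2.trans (mul_le_mul_left h3 _))) (lt_irrefl _)

namespace IsBranched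

variable {p : ℕ} {T : ℝ → ℝ} {c : Fin (p + 1) → ℝ}

lemma continuousAt_iterate (h : IsBranched T c) {x : ℝ} (hx : x ∈ Icc (0 : ℝ) 1) (n : ℕ)
    (hn : ∀ i < n, T^[i] x ∉ range c) : ContinuousAt T^[n] x := by
  induction n with
  | zero => exact continuousAt_id
  | succ n ih =>
    rw [Function.iterate_succ']
    exact (h.continuousAt (h.mapsTo.iterate n hx) (hn n (Nat.lt_succ_self n))).comp
      (ih fun i hi => hn i (hi.trans (Nat.lt_succ_self n)))

/-- Topological mixing on the support of the invariant density makes the images of any two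
functions that meet the density overlap. -/
lemma exists_pow_inf_ne_zero {α A C ρ : ℝ} (h : IsBranched T c)
    (hP : IsLasotaYorke α A C ρ h.transferL1) (hα : 0 < α) (hA : 0 < A) {d : L1}
    (hd : MemBV α A d) (hd0 : 0 ≤ d)
    (hmix : TopMixingOn T (range c) (leb.withDensity fun x => ENNReal.ofReal (d x)).support)
    {f g : L1} (hf : MemBV α A f) (hg : MemBV α A g) (hf0 : 0 ≤ f) (hg0 : 0 ≤ g)
    (hfd : f ⊓ d ≠ 0) (hgd : g ⊓ d ≠ 0) : ∃ N, ∀ k ≥ N, (h.transferL1 ^ k) f ⊓ g ≠ 0 := by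
  have key : ∀ f : L1, MemBV α A f → 0 ≤ f → f ⊓ d ≠ 0 → ∃ U : Set ℝ, IsOpen U ∧ U ⊆ Icc 0 1 ∧
      (U ∩ (leb.withDensity fun x => ENNReal.ofReal (d x)).support).Nonempty ∧
      ∃ r : ℝ, 0 < r ∧ ∀ᵐ y ∂leb, y ∈ U → r ≤ f y := by
    intro f hf hf0 hfd
    obtain ⟨N, j, hj, r, hr, hb⟩ := exists_cell_bound_below hα hA (hf.inf hd) (le_inf hf0 hd0) hfd
    have hN : 0 < N := Nat.zero_lt_of_lt hj
    have hN' : (0 : ℝ) < N := by exact_mod_cast hN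
    have hUsub : Ioo ((j : ℝ) / N) ((j + 1 : ℝ) / N) ⊆ cell N j := Ioo_subset_Ioc_self
    have hU1 : Ioo ((j : ℝ) / N) ((j + 1 : ℝ) / N) ⊆ Icc 0 1 := hUsub.trans (cell_subset_Icc hj)
    have hleb : leb.restrict (cell N j) = volume.restrict (cell N j) := by
      rw [leb, Measure.restrict_restrict (measurableSet_cell N j),
        inter_eq_left.2 (cell_subset_Icc hj)]
    have hb2 : ∀ᵐ y ∂leb, y ∈ Ioo ((j : ℝ) / N) ((j + 1 : ℝ) / N) → r ≤ f y ∧ r ≤ d y := by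
      rw [← hleb, ae_restrict_iff' (measurableSet_cell N j)] at hb
      filter_upwards [hb, Lp.coeFn_inf f d] with y h1 h2 hy
      have h3 := h1 (hUsub hy)
      rw [h2] at h3
      exact le_inf_iff.1 h3
    refine ⟨_, isOpen_Ioo, hU1, ?_, r, hr, hb2.mono fun y hy hyU => (hy hyU).1⟩
    apply Measure.nonempty_inter_support_of_pos
    rw [withDensity_apply']
    have h1 : ∫⁻ _ in Ioo ((j : ℝ) / N) ((j + 1 : ℝ) / N), ENNReal.ofReal r ∂leb ≤
        ∫⁻ x in Ioo ((j : ℝ) / N) ((j + 1 : ℝ) / N), ENNReal.ofReal (d x) ∂leb := by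
      apply lintegral_mono_ae
      rw [ae_restrict_iff' measurableSet_Ioo]
      filter_upwards [hb2] with y hy hyU
      exact ENNReal.ofReal_le_ofReal (hy hyU).2
    refine lt_of_lt_of_le ?_ h1
    rw [setLIntegral_const, leb, Measure.restrict_apply measurableSet_Ioo, inter_eq_left.2 hU1,
      Real.volume_Ioo, ← ENNReal.ofReal_mul hr.le, ENNReal.ofReal_pos]
    have : ((j : ℝ) + 1) / N - j / N = 1 / N := by rw [add_div]; ring
    rw [this]
    positivity
  obtain ⟨U, hUo, hU1, hUne, r, hr, hrf⟩ := key f hf hf0 hfd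
  obtain ⟨V, hVo, hV1, hVne, s, hs, hsg⟩ := key g hg hg0 hgd
  obtain ⟨N, hN⟩ := hmix U V hUo hVo hUne hVne
  refine ⟨N, fun k hk hzero => ?_⟩
  obtain ⟨x, ⟨hxU, -⟩, horb, hxV, -⟩ := hN k hk
  have hcont := h.continuousAt_iterate (hU1 hxU) k horb
  -- The points of `U` near `x` are mapped into `V`.
  obtain ⟨W, hWsub, hWo, hxW⟩ := mem_nhds_iff.1
    (inter_mem (hUo.mem_nhds hxU) (hcont.preimage_mem_nhds (hVo.mem_nhds hxV)))
  have hindm : AEStronglyMeasurable (V.indicator fun _ => (1 : ℝ)) leb :=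
    (stronglyMeasurable_const.indicator hVo.measurableSet).aestronglyMeasurable
  have hind : Integrable (V.indicator fun _ => (1 : ℝ)) leb :=
    (integrable_const 1).indicator hVo.measurableSet
  have hdual := h.integral_pow_transferL1_mul hP hα.le hA k hf hind
  have hL : ∫ x, (h.transferL1 ^ k) f x * V.indicator (fun _ => 1) x ∂leb = 0 := by
    apply integral_eq_zero_of_ae
    rw [inf_eq_zero_iff_ae (hP.pow_nonneg k hf0) hg0] at hzero
    filter_upwards [hzero, hsg] with y h1 h2
    by_cases hy : y ∈ V
    · rcases h1 with h1 | h1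
      · rw [h1, zero_mul]; rfl
      · have := h2 hy
        linarith
    · rw [indicator_of_notMem hy, mul_zero]; rfl
  rw [hL] at hdual
  have hWpos : 0 < leb.real W := by
    have hW1 : W ⊆ Icc 0 1 := fun y hy => hU1 (hWsub hy).1
    rw [Measure.real, ENNReal.toReal_pos_iff]
    refine ⟨?_, measure_lt_top _ _⟩
    rw [leb, Measure.restrict_apply hWo.measurableSet, inter_eq_left.2 hW1]
    exact hWo.measure_pos _ ⟨x, hxW⟩
  obtain ⟨M, -, hM⟩ := exists_ae_abs_le hα.le hA
  have hint : Integrable (fun x => f x * V.indicator (fun _ => (1 : ℝ)) (T^[k] x)) leb :=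
    integrable_mul_of_ae_bound (L1.aestronglyMeasurable_coeFn f) (hM f hf)
      (h.integrable_comp_iterate hind k)
  have hle : ∫ y, W.indicator (fun _ => r) y ∂leb ≤
      ∫ x, f x * V.indicator (fun _ => (1 : ℝ)) (T^[k] x) ∂leb := by
    refine integral_mono_ae ((integrable_const r).indicator hWo.measurableSet) hint ?_
    filter_upwards [hrf, (Lp.coeFn_nonneg f).2 hf0] with y h1 h2
    by_cases hy : y ∈ W
    · have h3 := hWsub hy
      rw [indicator_of_mem hy, indicator_of_mem (show T^[k] y ∈ V from h3.2), mul_one]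
      exact h1 h3.1
    · rw [indicator_of_notMem hy]
      exact mul_nonneg h2 (indicator_nonneg (fun _ _ => zero_le_one) _)
  rw [integral_indicator hWo.measurableSet, setIntegral_const, smul_eq_mul, ← hdual] at hle
  exact absurd hle (not_le.2 (mul_pos hWpos hr))

end IsBranched

lemma memBV_toL1 {α A : ℝ} {φ : ℝ → ℝ} (hφ : MemV α A φ) :
    MemBV α A (hφ.1.toL1 φ) ∧ bvNorm α A (hφ.1.toL1 φ) = (gbvNorm α A φ).toReal := by
  have h := gbvNorm_congr (α := α) (A := A) hφ.1.coeFn_toL1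
  rw [MemBV, bvNorm, h]
  refine ⟨?_, rfl⟩
  rw [gbvNorm]
  refine (ENNReal.add_lt_top.2 ⟨hφ.2, ?_⟩).ne
  exact (memLp_one_iff_integrable.2 hφ.1).eLpNorm_lt_top

lemma MemBV.memV {α A : ℝ} {f : L1} (hf : MemBV α A f) : MemV α A f :=
  ⟨L1.integrable_coeFn f, lt_of_le_of_lt le_self_add (lt_top_iff_ne_top.2 hf)⟩

/-- The constant function `1` as an element of `L¹`. -/
def oneL1 : L1 := (integrable_const (1 : ℝ) : Integrable (fun _ : ℝ => (1 : ℝ)) leb).toL1 _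

lemma coeFn_oneL1 : oneL1 =ᵐ[leb] fun _ => (1 : ℝ) := Integrable.coeFn_toL1 _

lemma oneL1_nonneg : 0 ≤ oneL1 := by
  rw [← Lp.coeFn_nonneg]
  filter_upwards [coeFn_oneL1] with x hx
  rw [hx]; exact zero_le_one

lemma mass_oneL1 : mass oneL1 = 1 := by
  rw [mass_apply, integral_congr_ae coeFn_oneL1]; simp

lemma memBV_oneL1 (α A : ℝ) : MemBV α A oneL1 ∧ bvNorm α A oneL1 ≤ 1 := by
  apply memBV_and_le zero_le_one
  rw [gbvNorm_coeFn, gbvSeminorm_congr coeFn_oneL1, gbvSeminorm_const, ← mass_eq_norm oneL1_nonneg,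
    mass_oneL1, zero_add]

namespace ConditionII

variable {α A ε : ℝ} {p : ℕ} {T : ℝ → ℝ → ℝ} {b : Fin (p + 1) → ℝ → ℝ} {μ : ℝ → Measure ℝ}

/-- The transfer operators satisfy a Lasota–Yorke inequality uniformly in the parameter. -/
lemma exists_isLasotaYorke (hII : ConditionII α A T b μ ε) (hT : ExpandingFamily α p T b μ) :
    ∃ C ρ : ℝ, ∀ a (ha : a ∈ Icc (0 : ℝ) 1), a ≤ ε →
      IsLasotaYorke α A C ρ (hT.isBranched ha).transferL1 := by
  obtain ⟨C, ρ, hC, hρ0, hρ1, h⟩ := hII.lasotaYorke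
  refine ⟨C, ρ, fun a ha haε => ⟨fun f hf => (hT.isBranched ha).transferL1_nonneg hf,
    (hT.isBranched ha).mass_transferL1, hC, hρ0, hρ1, fun n f hf => ?_⟩⟩
  have hC0 : 0 ≤ C := zero_le_one.trans hC
  have hbv := bvNorm_nonneg (α := α) (A := A) f
  rcases Nat.eq_zero_or_pos n with rfl | hn
  · refine ⟨hf, ?_⟩
    have h1 : 0 ≤ C * ‖f‖ := by positivity
    have h2 : bvNorm α A f ≤ C * bvNorm α A f := le_mul_of_one_le_left hbv hC
    rw [pow_zero, pow_zero, mul_one]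
    exact h2.trans (le_add_of_nonneg_right h1)
  · apply memBV_and_le (by positivity)
    rw [gbvNorm_congr ((hT.isBranched ha).coeFn_transferL1_pow n f),
      ENNReal.ofReal_add (by positivity) (by positivity),
      ENNReal.ofReal_mul (show 0 ≤ C * ρ ^ n by positivity), ENNReal.ofReal_mul (q := ‖f‖) hC0,
      hf.ofReal_bvNorm, ← eLpNorm_coeFn]
    exact h a ⟨ha.1, haε⟩ n hn f hf.memV

end ConditionII

namespace ExpandingFamily

variable {α A : ℝ} {p : ℕ} {T : ℝ → ℝ → ℝ} {b : Fin (p + 1) → ℝ → ℝ} {μ : ℝ → Measure ℝ}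

/-- The invariant measure has a density in `V_α`, with a norm bounded in terms of the constants of
the Lasota–Yorke inequality, and this is the only normalised nonnegative fixed point. -/
lemma exists_density (hT : ExpandingFamily α p T b μ) (hA : 0 < A) {C ρ : ℝ} {a : ℝ}
    (ha : a ∈ Icc (0 : ℝ) 1) (hP : IsLasotaYorke α A C ρ (hT.isBranched ha).transferL1) :
    ∃ d : L1, MemBV α A d ∧ bvNorm α A d ≤ 4 * C ∧ 0 ≤ d ∧ (hT.isBranched ha).transferL1 d = d ∧
      mass d = 1 ∧ μ a = leb.withDensity (fun x => ENNReal.ofReal (d x)) ∧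
      ∀ g : L1, 0 ≤ g → (hT.isBranched ha).transferL1 g = g → mass g = 1 → g = d := by
  obtain ⟨d, hd, hdC, hd0, hfix, hmass, -⟩ :=
    hP.exists_invariant hT.alpha_pos hA (memBV_oneL1 α A).1 oneL1_nonneg
  rw [mass_oneL1] at hmass
  have hC : 0 ≤ C := zero_le_one.trans hP.one_le
  have hμ : ∀ g : L1, 0 ≤ g → (hT.isBranched ha).transferL1 g = g → mass g = 1 →
      leb.withDensity (fun x => ENNReal.ofReal (g x)) = μ a := fun g h1 h2 h3 =>
    hT.acip_unique a ha _ ((hT.isBranched ha).isACIP_withDensity h1 h2 h3)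
  refine ⟨d, hd, ?_, hd0, hfix, hmass, (hμ d hd0 hfix hmass).symm, fun g h1 h2 h3 => ?_⟩
  · refine hdC.trans ?_
    have := (memBV_oneL1 α A).2
    exact mul_le_of_le_one_right (by positivity) this
  · have he := (hμ g h1 h2 h3).trans (hμ d hd0 hfix hmass).symm
    rw [withDensity_eq_iff_of_sigmaFinite
      (L1.measurable_coeFn g).ennreal_ofReal.aemeasurable
      (L1.measurable_coeFn d).ennreal_ofReal.aemeasurable] at he
    apply Lp.ext
    filter_upwards [he, (Lp.coeFn_nonneg g).2 h1, (Lp.coeFn_nonneg d).2 hd0] with x h4 h5 h6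
    exact (ENNReal.ofReal_eq_ofReal_iff h5 h6).1 h4

end ExpandingFamily

/-! ### Uniform decay of correlations -/

namespace IsLasotaYorke

variable {α A C ρ : ℝ} {P Q : L1 →L[ℝ] L1}

/-- Decay to zero of the individual orbits is uniform on the unit ball of `V_α`, which is compact
in `L¹`. -/
lemma exists_uniform_norm_pow_le (h : IsLasotaYorke α A C ρ P) (hα : 0 < α) (hA : 0 < A)
    (hlim : ∀ φ : L1, MemBV α A φ → mass φ = 0 → Tendsto (fun n => ‖(P ^ n) φ‖) atTop (𝓝 0))
    {η : ℝ} (hη : 0 < η) :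
    ∃ n : ℕ, ∀ φ : L1, MemBV α A φ → mass φ = 0 → ‖(P ^ n) φ‖ ≤ η * bvNorm α A φ := by
  have hcpt : IsCompact (gbvBall α A 1 ∩ {f : L1 | mass f = 0}) :=
    (isCompact_gbvBall hα hA zero_le_one).inter_right
      (isClosed_eq mass.continuous continuous_const)
  obtain ⟨n, hn⟩ := hcpt.elim_directed_cover (fun n : ℕ => {f : L1 | ‖(P ^ n) f‖ < η})
    (fun n => isOpen_lt (P ^ n).continuous.norm continuous_const) (by
      rintro f ⟨hf, hf0⟩
      have h1 := hlim f (memBV_of_mem_gbvBall zero_le_one hf).1 hf0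
      exact mem_iUnion.2 (h1.eventually_lt_const hη).exists)
    (directed_of_isDirected_le fun i j hij f hf => (h.norm_pow_le_of_le hij f).trans_lt hf)
  refine ⟨n, fun φ hφ hφ0 => ?_⟩
  rcases (bvNorm_nonneg (α := α) (A := A) φ).eq_or_lt with h0 | hpos
  · have h1 : ‖φ‖ = 0 := le_antisymm (by rw [h0]; exact hφ.norm_le) (norm_nonneg _)
    rw [norm_eq_zero.1 h1, map_zero, norm_zero]
    exact mul_nonneg hη.le (bvNorm_nonneg _)
  · have h1 := hφ.smul (bvNorm α A φ)⁻¹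
    rw [abs_of_pos (inv_pos.2 hpos), inv_mul_cancel₀ hpos.ne'] at h1
    have h2 := hn ⟨h1.1.mem_gbvBall h1.2, by
      change mass _ = 0
      rw [map_smul, hφ0, smul_zero]⟩
    have h3 : ‖(P ^ n) ((bvNorm α A φ)⁻¹ • φ)‖ < η := h2
    rw [map_smul, norm_smul, norm_inv, Real.norm_of_nonneg hpos.le, inv_mul_lt_iff₀ hpos] at h3
    linarith

/-- Telescoping comparison of the iterates of two operators. -/
lemma norm_pow_sub_pow_le (hP : IsLasotaYorke α A C ρ P) (hQ : IsLasotaYorke α A C ρ Q) {τ : ℝ}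
    (hτ : 0 ≤ τ) (hPQ : ∀ f : L1, MemBV α A f → ‖P f - Q f‖ ≤ τ * bvNorm α A f) (n : ℕ) {f : L1}
    (hf : MemBV α A f) : ‖(P ^ n) f - (Q ^ n) f‖ ≤ n * (τ * (2 * C * bvNorm α A f)) := by
  induction n with
  | zero => simp
  | succ n ih =>
    have e : (P ^ (n + 1)) f - (Q ^ (n + 1)) f =
        P ((P ^ n) f - (Q ^ n) f) + (P ((Q ^ n) f) - Q ((Q ^ n) f)) := by
      rw [pow_succ', pow_succ', mul_apply_eq_comp, mul_apply_eq_comp, map_sub]; abel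
    rw [e]
    have h1 : ‖P ((P ^ n) f - (Q ^ n) f)‖ ≤ ‖(P ^ n) f - (Q ^ n) f‖ := by
      have := hP.norm_pow_le 1 ((P ^ n) f - (Q ^ n) f)
      rwa [pow_one] at this
    have h2 := hPQ _ (hQ.bound n f hf).1
    have h3 := mul_le_mul_of_nonneg_left (hQ.bvNorm_pow_le n hf) hτ
    refine (norm_add_le _ _).trans ?_
    rw [Nat.cast_succ, add_mul, one_mul]
    linarith

/-- If some iterate is small in `L¹` on functions with integral zero, the Lasota–Yorke inequality
turns this into exponential decay in `V_α`. The rate depends only on the given constants. -/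
lemma exists_exponential_decay {α A C ρ : ℝ} (hC : 1 ≤ C) (hρ0 : 0 < ρ) (hρ1 : ρ < 1) (n : ℕ) :
    ∃ θ : ℝ, 0 < θ ∧ θ < 1 ∧ ∀ P : L1 →L[ℝ] L1, IsLasotaYorke α A C ρ P →
      (∀ φ : L1, MemBV α A φ → mass φ = 0 → ‖(P ^ n) φ‖ ≤ (4 * C)⁻¹ * bvNorm α A φ) →
      ∀ (φ : L1), MemBV α A φ → mass φ = 0 → ∀ k : ℕ,
        bvNorm α A ((P ^ k) φ) ≤ 4 * C * θ ^ k * bvNorm α A φ := by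
  have hCpos : 0 < C := zero_lt_one.trans_le hC
  obtain ⟨n₁, hn₁⟩ := exists_pow_lt_of_lt_one (show 0 < (8 * C * C)⁻¹ by positivity) hρ1
  set m := n₁ + n + 1 with hm
  have hmpos : 0 < m := Nat.succ_pos _
  set θ : ℝ := (1 / 2 : ℝ) ^ ((m : ℝ)⁻¹) with hθ
  have hθ0 : 0 < θ := Real.rpow_pos_of_pos (by norm_num) _
  have hθ1 : θ < 1 := Real.rpow_lt_one (by norm_num) (by norm_num) (by positivity)
  have hθm : θ ^ m = 1 / 2 := Real.rpow_inv_natCast_pow (by norm_num) hmpos.ne'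
  refine ⟨θ, hθ0, hθ1, fun P hP hsmall φ hφ hφ0 k => ?_⟩
  have hstep : ∀ f : L1, MemBV α A f → mass f = 0 →
      bvNorm α A ((P ^ m) f) ≤ 1 / 2 * bvNorm α A f := by
    intro f hf hf0
    have hbv := bvNorm_nonneg (α := α) (A := A) f
    have e : (P ^ m) f = (P ^ (n₁ + 1)) ((P ^ n) f) := by
      rw [← mul_apply_eq_comp, ← pow_add]; congr 2; omega
    rw [e]
    have hbv2 := bvNorm_nonneg (α := α) (A := A) ((P ^ n) f)
    have h1 := (hP.bound (n₁ + 1) _ (hP.bound n f hf).1).2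
    have h2 := hP.bvNorm_pow_le n hf
    have h3 := hsmall f hf hf0
    have h4 : ρ ^ (n₁ + 1) ≤ (8 * C * C)⁻¹ :=
      (pow_le_pow_of_le_one hρ0.le hρ1.le (Nat.le_succ n₁)).trans hn₁.le
    calc _ ≤ C * ρ ^ (n₁ + 1) * bvNorm α A ((P ^ n) f) + C * ‖(P ^ n) f‖ := h1
      _ ≤ C * (8 * C * C)⁻¹ * (2 * C * bvNorm α A f) +
            C * ((4 * C)⁻¹ * bvNorm α A f) := by gcongr
      _ = 1 / 2 * bvNorm α A f := by field_simp; ring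
  have hiter : ∀ q : ℕ, MemBV α A ((P ^ (m * q)) φ) ∧ mass ((P ^ (m * q)) φ) = 0 ∧
      bvNorm α A ((P ^ (m * q)) φ) ≤ (1 / 2) ^ q * bvNorm α A φ := by
    intro q
    refine ⟨(hP.bound _ φ hφ).1, by rw [hP.mass_pow, hφ0], ?_⟩
    induction q with
    | zero => simp
    | succ q ih =>
      have e : (P ^ (m * (q + 1))) φ = (P ^ m) ((P ^ (m * q)) φ) := by
        rw [← mul_apply_eq_comp, ← pow_add]; congr 2; ring
      rw [e]
      have := hstep _ (hP.bound (m * q) φ hφ).1 (by rw [hP.mass_pow, hφ0])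
      have hp : (1 / 2 : ℝ) ^ (q + 1) = (1 / 2) ^ q * (1 / 2) := pow_succ _ _
      rw [hp]
      linarith
  have hk : k = k % m + m * (k / m) := (Nat.mod_add_div k m).symm
  have e : (P ^ k) φ = (P ^ (k % m)) ((P ^ (m * (k / m))) φ) := by
    rw [← mul_apply_eq_comp, ← pow_add, ← hk]
  rw [e]
  have h1 := hiter (k / m)
  have h2 := hP.bvNorm_pow_le (k % m) h1.1
  have h3 : (1 / 2 : ℝ) ^ (k / m) ≤ 2 * θ ^ k := by
    have h4 : θ ^ m ≤ θ ^ (k % m) :=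
      pow_le_pow_of_le_one hθ0.le hθ1.le (Nat.mod_lt k hmpos).le
    rw [hθm] at h4
    have h5 : θ ^ k = θ ^ (k % m) * (1 / 2) ^ (k / m) := by
      conv_lhs => rw [hk, pow_add, pow_mul, hθm]
    rw [h5]
    have h6 : (0 : ℝ) < (1 / 2) ^ (k / m) := by positivity
    nlinarith
  have hbv := bvNorm_nonneg (α := α) (A := A) φ
  calc _ ≤ 2 * C * bvNorm α A ((P ^ (m * (k / m))) φ) := h2
    _ ≤ 2 * C * ((1 / 2) ^ (k / m) * bvNorm α A φ) := by gcongr; exact h1.2.2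
    _ ≤ 2 * C * ((2 * θ ^ k) * bvNorm α A φ) := by gcongr
    _ = _ := by ring

end IsLasotaYorke

lemma integral_withDensity_eq {d : L1} (hd0 : 0 ≤ d) (ψ : ℝ → ℝ) :
    ∫ x, ψ x ∂(leb.withDensity fun x => ENNReal.ofReal (d x)) = ∫ x, d x * ψ x ∂leb := by
  rw [integral_withDensity_eq_integral_toReal_smul (L1.measurable_coeFn d).ennreal_ofReal
    (Eventually.of_forall fun x => ENNReal.ofReal_lt_top)]
  apply integral_congr_ae
  filter_upwards [(Lp.coeFn_nonneg d).2 hd0] with x hx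
  rw [ENNReal.toReal_ofReal hx, smul_eq_mul]

namespace ConditionII

variable {α A ε : ℝ} {p : ℕ} {T : ℝ → ℝ → ℝ} {b : Fin (p + 1) → ℝ → ℝ} {μ : ℝ → Measure ℝ}

/-- Uniform decay of correlations: the `n` of the unperturbed map also serves the nearby ones. -/
theorem exists_uniformDecay (hII : ConditionII α A T b μ ε) (hT : ExpandingFamily α p T b μ)
    (hA : 0 < A) : ∃ ε' ∈ Ioc 0 ε, UniformDecay α A T μ ε' := by
  have hα := hT.alpha_pos
  obtain ⟨C, ρ, hLY⟩ := hII.exists_isLasotaYorke hT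
  obtain ⟨D, κ, hD, hκ, hDκ⟩ := hT.exists_norm_transferL1_sub_le hA
  obtain ⟨N, hN1, hN⟩ := exists_ae_abs_le hα.le hA
  have h0 : (0 : ℝ) ∈ Icc (0 : ℝ) 1 := ⟨le_rfl, zero_le_one⟩
  have hP0 := hLY 0 h0 hII.eps_pos.le
  have hC := hP0.one_le
  have hCpos : 0 < C := zero_lt_one.trans_le hC
  obtain ⟨d₀, hd₀, -, hd₀0, hfix₀, hmass₀, hμ₀, huniq₀⟩ := hT.exists_density hA h0 hP0
  have hmix := hII.mixing
  rw [hμ₀] at hmix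
  obtain ⟨n, hn⟩ := hP0.exists_uniform_norm_pow_le hα hA (fun φ hφ hφ0 =>
    hP0.tendsto_norm_pow hα hA hd₀ hd₀0 hfix₀ hmass₀ huniq₀
      (fun f g hf hg hf0 hg0 hfd hgd => (hT.isBranched h0).exists_pow_inf_ne_zero hP0 hα hA hd₀
        hd₀0 hmix hf hg hf0 hg0 hfd hgd) hφ hφ0) (show 0 < (8 * C)⁻¹ by positivity)
  obtain ⟨θ, hθ0, hθ1, hθ⟩ :=
    IsLasotaYorke.exists_exponential_decay (α := α) (A := A) hC hP0.rho_pos hP0.rho_lt n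
  -- Smallness of the `n`-th iterate survives a small change of the parameter.
  have hsmall : ∀ᶠ δ in 𝓝[>] (0 : ℝ), n * (D * δ ^ κ * (2 * C)) < (8 * C)⁻¹ := by
    have hc : Continuous fun δ : ℝ => n * (D * δ ^ κ * (2 * C)) := by
      have := Real.continuous_rpow_const hκ.le
      fun_prop
    have h1 := hc.tendsto 0
    rw [Real.zero_rpow hκ.ne'] at h1
    have h2 : (n : ℝ) * (D * 0 * (2 * C)) < (8 * C)⁻¹ := by
      rw [mul_zero, zero_mul, mul_zero]; positivity
    exact (h1.eventually_lt_const h2).filter_mono nhdsWithin_le_nhds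
  have hIoc : ∀ᶠ δ in 𝓝[>] (0 : ℝ), δ ∈ Ioc 0 ε := Ioc_mem_nhdsGT hII.eps_pos
  obtain ⟨ε', hε'small, hε'⟩ := (hsmall.and hIoc).exists
  refine ⟨ε', hε', max 1 (N * (4 * C * (1 + 4 * C))), θ, le_max_left _ _, hθ0, hθ1,
    fun a ha φ ψ hφ hψ k _ => ?_⟩
  have haε : a ≤ ε := ha.2.trans hε'.2
  have ha1 : a ∈ Icc (0 : ℝ) 1 := ⟨ha.1, haε.trans hII.eps_le⟩
  have hPa := hLY a ha1 haε
  set P := (hT.isBranched ha1).transferL1 with hP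
  have hsm : ∀ f : L1, MemBV α A f → mass f = 0 → ‖(P ^ n) f‖ ≤ (4 * C)⁻¹ * bvNorm α A f := by
    intro f hf hf0
    have hbv := bvNorm_nonneg (α := α) (A := A) f
    have h1 := hn f hf hf0
    have h2 := hPa.norm_pow_sub_pow_le hP0 (τ := D * |a - 0| ^ κ) (by positivity)
      (fun f hf => hDκ a ha1 0 h0 f hf) n hf
    have h3 : |a - 0| ^ κ ≤ ε' ^ κ := by
      rw [sub_zero, abs_of_nonneg ha.1]
      exact Real.rpow_le_rpow ha.1 ha.2 hκ.le
    have h4 : n * (D * |a - 0| ^ κ * (2 * C * bvNorm α A f)) ≤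
        (8 * C)⁻¹ * bvNorm α A f := by
      calc n * (D * |a - 0| ^ κ * (2 * C * bvNorm α A f))
          ≤ n * (D * ε' ^ κ * (2 * C * bvNorm α A f)) := by gcongr
        _ = n * (D * ε' ^ κ * (2 * C)) * bvNorm α A f := by ring
        _ ≤ _ := mul_le_mul_of_nonneg_right hε'small.le hbv
    have h5 := norm_le_norm_add_norm_sub' ((P ^ n) f) (((hT.isBranched h0).transferL1 ^ n) f)
    have h6 : (4 * C)⁻¹ = (8 * C)⁻¹ + (8 * C)⁻¹ := by field_simp; norm_num
    rw [h6, add_mul]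
    linarith
  obtain ⟨d, hd, hdC, hd0, hfix, hmass, hμ, -⟩ := hT.exists_density hA ha1 hPa
  set f : L1 := hφ.1.toL1 φ with hf
  obtain ⟨hfBV, hfnorm⟩ := memBV_toL1 hφ
  have hfae : f =ᵐ[leb] φ := hφ.1.coeFn_toL1
  set g : L1 := f - mass f • d with hg
  have hmf : |mass f| ≤ bvNorm α A f := (abs_mass_le f).trans hfBV.norm_le
  have hgBV : MemBV α A g ∧ bvNorm α A g ≤ (1 + 4 * C) * bvNorm α A f := by
    have h1 := hd.smul (mass f)
    have h2 := hfBV.sub h1.1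
    refine ⟨h2.1, h2.2.trans ?_⟩
    have h3 : |mass f| * bvNorm α A d ≤ bvNorm α A f * (4 * C) :=
      mul_le_mul hmf hdC (bvNorm_nonneg d) (bvNorm_nonneg f)
    linarith [h1.2]
  have hgm : mass g = 0 := by
    rw [hg, map_sub, map_smul, hmass, smul_eq_mul, mul_one, sub_self]
  have hdecay := hθ P hPa hsm g hgBV.1 hgm k
  have hPk := (hPa.bound k g hgBV.1).1
  have hdk : ∀ k : ℕ, (P ^ k) d = d := by
    intro k
    induction k with
    | zero => rfl
    | succ k ih => rw [pow_succ', mul_apply_eq_comp, ih, hfix]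
  have hbdd : ∀ {u : L1}, MemBV α A u → Integrable (fun x => u x * ψ x) leb := fun {u} hu =>
    integrable_mul_of_ae_bound (L1.aestronglyMeasurable_coeFn u) (hN u hu) hψ
  have hcorr : (∫ x, φ x * ψ ((T a)^[k] x) ∂leb) - (∫ x, φ x ∂leb) * ∫ x, ψ x ∂(μ a) =
      ∫ x, (P ^ k) g x * ψ x ∂leb := by
    have h1 : ∫ x, φ x * ψ ((T a)^[k] x) ∂leb = ∫ x, (P ^ k) f x * ψ x ∂leb := by
      rw [(hT.isBranched ha1).integral_pow_transferL1_mul hPa hα.le hA k hfBV hψ]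
      apply integral_congr_ae
      filter_upwards [hfae] with x hx
      rw [hx]
    have h2 : ∫ x, φ x ∂leb = mass f := by
      rw [mass_apply]; exact (integral_congr_ae hfae).symm
    rw [h1, h2, hμ, integral_withDensity_eq hd0, ← integral_const_mul,
      ← integral_sub (hbdd (hPa.bound k f hfBV).1) ((hbdd hd).const_mul _)]
    apply integral_congr_ae
    have h3 : (P ^ k) g = (P ^ k) f - mass f • d := by
      rw [hg, map_sub, map_smul, hdk]
    rw [h3]
    filter_upwards [Lp.coeFn_sub ((P ^ k) f) (mass f • d), Lp.coeFn_smul (mass f) d] with x h4 h5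
    rw [h4, Pi.sub_apply, h5, Pi.smul_apply, smul_eq_mul]
    ring
  rw [hcorr]
  have hψ0 : 0 ≤ ∫ x, |ψ x| ∂leb := integral_nonneg fun x => abs_nonneg _
  have hψint : |∫ x, (P ^ k) g x * ψ x ∂leb| ≤
      N * bvNorm α A ((P ^ k) g) * ∫ x, |ψ x| ∂leb := by
    rw [← integral_const_mul]
    refine (norm_integral_le_integral_norm _).trans
      (integral_mono_ae (hbdd hPk).norm (hψ.abs.const_mul _) ?_)
    filter_upwards [hN _ hPk] with x hx
    simp only [Real.norm_eq_abs, abs_mul]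
    exact mul_le_mul_of_nonneg_right hx (abs_nonneg _)
  have hbf := bvNorm_nonneg (α := α) (A := A) f
  refine hψint.trans ?_
  rw [← hfnorm]
  calc N * bvNorm α A ((P ^ k) g) * ∫ x, |ψ x| ∂leb
      ≤ N * (4 * C * θ ^ k * ((1 + 4 * C) * bvNorm α A f)) * ∫ x, |ψ x| ∂leb := by
        have h1 : bvNorm α A ((P ^ k) g) ≤ 4 * C * θ ^ k * ((1 + 4 * C) * bvNorm α A f) :=
          hdecay.trans (mul_le_mul_of_nonneg_left hgBV.2 (by positivity))
        gcongr
    _ = N * (4 * C * (1 + 4 * C)) * (bvNorm α A f * (∫ x, |ψ x| ∂leb) * θ ^ k) := by ring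
    _ ≤ max 1 (N * (4 * C * (1 + 4 * C))) * (bvNorm α A f * (∫ x, |ψ x| ∂leb) * θ ^ k) := by
        refine mul_le_mul_of_nonneg_right (le_max_right _ _) (by positivity)
    _ = _ := by ring

end ConditionII

/-! ### The variance of a bounded observable -/

section Invariant

variable {ν : Measure ℝ} {S : ℝ → ℝ} {u : ℝ → ℝ} {M : ℝ}

lemma comp_iterate_of_map_eq (hS : AEMeasurable S ν) (hinv : ν.map S = ν)
    (hu : AEStronglyMeasurable u ν) (hb : ∀ᵐ x ∂ν, |u x| ≤ M) (i : ℕ) :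
    AEStronglyMeasurable (fun x => u (S^[i] x)) ν ∧ (∀ᵐ x ∂ν, |u (S^[i] x)| ≤ M) ∧
      ∫ x, u (S^[i] x) ∂ν = ∫ x, u x ∂ν := by
  induction i with
  | zero => exact ⟨hu, hb, rfl⟩
  | succ i ih =>
    simp only [Function.iterate_succ_apply]
    obtain ⟨h1, h2, h3⟩ := ih
    have h1' : AEStronglyMeasurable (fun x => u (S^[i] x)) (ν.map S) := by rwa [hinv]
    refine ⟨h1'.comp_aemeasurable hS, ?_, ?_⟩
    · rw [← hinv] at h2
      exact ae_of_ae_map hS h2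
    · rw [← h3]
      conv_rhs => rw [← hinv, integral_map hS h1']

variable [IsProbabilityMeasure ν]

lemma integrable_mul_comp_iterate (hS : AEMeasurable S ν) (hinv : ν.map S = ν)
    (hu : AEStronglyMeasurable u ν) (hb : ∀ᵐ x ∂ν, |u x| ≤ M) (i : ℕ) :
    Integrable (fun x => u x * u (S^[i] x)) ν := by
  obtain ⟨h1, h2, -⟩ := comp_iterate_of_map_eq hS hinv hu hb i
  exact (Integrable.of_bound h1 M h2).bdd_mul (c := M) hu hb

lemma autocov_eq (hS : AEMeasurable S ν) (hinv : ν.map S = ν)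
    (hu : AEStronglyMeasurable u ν) (hb : ∀ᵐ x ∂ν, |u x| ≤ M) (i : ℕ) :
    autocov S ν u i = (∫ x, u x * u (S^[i] x) ∂ν) - (∫ x, u x ∂ν) ^ 2 := by
  obtain ⟨h1, h2, h3⟩ := comp_iterate_of_map_eq hS hinv hu hb i
  have hi := Integrable.of_bound h1 M h2
  have hu' := Integrable.of_bound hu M hb
  have hm := integrable_mul_comp_iterate hS hinv hu hb i
  rw [autocov]
  set m := ∫ x, u x ∂ν with hmdef
  have e : ∀ x, (u x - m) * (u (S^[i] x) - m) =
      u x * u (S^[i] x) - (m * u x + m * u (S^[i] x) - m ^ 2) := fun x => by ring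
  simp_rw [e]
  have hs : Integrable (fun x => m * u x + m * u (S^[i] x)) ν :=
    (hu'.const_mul m).add (hi.const_mul m)
  have hs' : Integrable (fun x => m * u x + m * u (S^[i] x) - m ^ 2) ν :=
    hs.sub (integrable_const _)
  rw [integral_sub hm hs', integral_sub hs (integrable_const _),
    integral_add (hu'.const_mul m) (hi.const_mul m), integral_const_mul, integral_const_mul, h3,
    integral_const, probReal_univ, one_smul, ← hmdef]
  ring

/-- The second moments of the Birkhoff sums are the sums of the partial sums of the series, so the
value of the series is a Cesàro limit of nonnegative numbers. -/
lemma integral_sq_add_two_mul_tsum_nonneg (hS : AEMeasurable S ν) (hinv : ν.map S = ν)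
    (hu : AEStronglyMeasurable u ν) (hb : ∀ᵐ x ∂ν, |u x| ≤ M)
    (hs : Summable fun i : ℕ => ∫ x, u x * u (S^[i + 1] x) ∂ν) :
    0 ≤ (∫ x, u x ^ 2 ∂ν) + 2 * ∑' i : ℕ, ∫ x, u x * u (S^[i + 1] x) ∂ν := by
  set g : ℕ → ℝ := fun i => ∫ x, u x * u (S^[i + 1] x) ∂ν with hg
  set B : ℕ → ℝ → ℝ := fun n x => ∑ i ∈ Finset.range n, u (S^[i] x) with hB
  have hBm : ∀ n, AEStronglyMeasurable (B n) ν := fun n =>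
    Finset.aestronglyMeasurable_fun_sum _ fun i _ => (comp_iterate_of_map_eq hS hinv hu hb i).1
  have hBb : ∀ n, ∀ᵐ x ∂ν, |B n x| ≤ n * M := by
    intro n
    have h1 : ∀ᵐ x ∂ν, ∀ i, |u (S^[i] x)| ≤ M :=
      ae_all_iff.2 fun i => (comp_iterate_of_map_eq hS hinv hu hb i).2.1
    filter_upwards [h1] with x hx
    refine (Finset.abs_sum_le_sum_abs _ _).trans ((Finset.sum_le_sum fun i _ => hx i).trans ?_)
    simp
  have hsq : ∀ n, ∫ x, B n x ^ 2 ∂ν = ∑ m ∈ Finset.range n,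
      ((∫ x, u x ^ 2 ∂ν) + 2 * ∑ i ∈ Finset.range m, g i) := by
    intro n
    induction n with
    | zero => simp [hB]
    | succ n ih =>
      obtain ⟨c1, c2, -⟩ := comp_iterate_of_map_eq hS hinv (hBm n) (hBb n) 1
      simp only [Function.iterate_one] at c1 c2
      have c3 : ∫ x, B n (S x) ^ 2 ∂ν = ∫ x, B n x ^ 2 ∂ν := by
        have h1 : AEStronglyMeasurable (fun x => B n x ^ 2) (ν.map S) := by
          rw [hinv]; exact (hBm n).pow 2
        conv_rhs => rw [← hinv, integral_map hS h1]
      have hsucc : ∀ x, B (n + 1) x = u x + B n (S x) := by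
        intro x
        simp only [hB]
        rw [Finset.sum_range_succ', add_comm]
        rfl
      have i1 : Integrable (fun x => u x ^ 2) ν := by
        simpa [sq] using integrable_mul_comp_iterate hS hinv hu hb 0
      have i2 : Integrable (fun x => u x * B n (S x)) ν :=
        (Integrable.of_bound c1 _ c2).bdd_mul (c := M) hu hb
      have i3 : Integrable (fun x => B n (S x) ^ 2) ν := by
        simp_rw [sq]
        exact (Integrable.of_bound c1 _ c2).bdd_mul (c := n * M) c1 c2
      have hmid : ∫ x, u x * B n (S x) ∂ν = ∑ i ∈ Finset.range n, g i := by
        rw [hg, ← integral_finsetSum _ fun i _ =>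
          integrable_mul_comp_iterate hS hinv hu hb (i + 1)]
        simp only [hB, Finset.mul_sum, Function.iterate_succ_apply]
      rw [Finset.sum_range_succ, ← ih, ← hmid]
      have e : ∀ x, B (n + 1) x ^ 2 = u x ^ 2 + 2 * (u x * B n (S x)) + B n (S x) ^ 2 := by
        intro x; rw [hsucc]; ring
      simp_rw [e]
      have i4 : Integrable (fun x => u x ^ 2 + 2 * (u x * B n (S x))) ν := i1.add (i2.const_mul 2)
      rw [integral_add i4 i3, integral_add i1 (i2.const_mul 2),
        integral_const_mul, c3]
      ring
  have hlim := (((hs.hasSum.tendsto_sum_nat).const_mul 2).const_add (∫ x, u x ^ 2 ∂ν)).cesaro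
  refine ge_of_tendsto' hlim fun n => mul_nonneg (by positivity) ?_
  rw [← hsq]
  exact integral_nonneg fun x => sq_nonneg _

end Invariant

/-! ### Comparison of exponentially decaying series -/

lemma abs_tsum_sub_le {g g' : ℕ → ℝ} {K ρ δ : ℝ} (hρ0 : 0 ≤ ρ) (hρ1 : ρ < 1)
    (hg : ∀ i, |g i| ≤ K * ρ ^ i) (hg' : ∀ i, |g' i| ≤ K * ρ ^ i) (n : ℕ)
    (h : ∀ i < n, |g i - g' i| ≤ δ) :
    |∑' i, g i - ∑' i, g' i| ≤ n * δ + 2 * K * ρ ^ n * (1 - ρ)⁻¹ := by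
  have hgeo := (summable_geometric_of_lt_one hρ0 hρ1).mul_left K
  have hs : Summable g := Summable.of_norm_bounded hgeo (f := g) hg
  have hs' : Summable g' := Summable.of_norm_bounded hgeo (f := g') hg'
  rw [← hs.tsum_sub hs', ← (hs.sub hs').sum_add_tsum_nat_add n]
  have h1 : |∑ i ∈ Finset.range n, (g i - g' i)| ≤ n * δ := by
    refine (Finset.abs_sum_le_sum_abs _ _).trans
      ((Finset.sum_le_sum fun i hi => h i (Finset.mem_range.1 hi)).trans ?_)
    simp
  have h2 : |∑' i, (g (i + n) - g' (i + n))| ≤ 2 * K * ρ ^ n * (1 - ρ)⁻¹ := by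
    refine tsum_of_norm_bounded (f := fun i => g (i + n) - g' (i + n))
      ((hasSum_geometric_of_lt_one hρ0 hρ1).mul_left (2 * K * ρ ^ n))
      fun i => ?_
    have h3 := norm_sub_le (g (i + n)) (g' (i + n))
    have h4 := hg (i + n)
    have h5 := hg' (i + n)
    rw [pow_add] at h4 h5
    simp only [Real.norm_eq_abs] at h3 ⊢
    linarith
  exact (abs_add_le _ _).trans (add_le_add h1 h2)

/-- Choosing `n` of order `1 / s` balances an exponentially small tail against a polynomially
growing error. -/
lemma exists_nat_balance {ρ : ℝ} (hρ0 : 0 ≤ ρ) (hρ1 : ρ < 1) :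
    ∃ K : ℝ, 0 ≤ K ∧ ∀ s : ℝ, 0 < s → s ≤ 1 →
      ∃ n : ℕ, 1 ≤ n ∧ n * ρ ^ n + n ^ 2 * s ^ 4 ≤ K * s := by
  have hlim := tendsto_pow_const_mul_const_pow_of_abs_lt_one 2
    (show |ρ| < 1 by rwa [abs_of_nonneg hρ0])
  obtain ⟨L, hL⟩ := hlim.bddAbove_range
  have hL' : ∀ n : ℕ, (n : ℝ) ^ 2 * ρ ^ n ≤ L := fun n => hL ⟨n, rfl⟩
  have hL0 : 0 ≤ L := by simpa using hL' 0
  refine ⟨L + 4, by positivity, fun s hs0 hs1 => ⟨⌈s⁻¹⌉₊, Nat.ceil_pos.2 (inv_pos.2 hs0), ?_⟩⟩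
  set n := ⌈s⁻¹⌉₊
  have h1 : s⁻¹ ≤ n := Nat.le_ceil _
  have h2 : (n : ℝ) < s⁻¹ + 1 := Nat.ceil_lt_add_one (inv_nonneg.2 hs0.le)
  have h3 : 1 ≤ n * s := by
    have := mul_le_mul_of_nonneg_right h1 hs0.le
    rwa [inv_mul_cancel₀ hs0.ne'] at this
  have h4 : n * s ≤ 2 := by
    have := mul_le_mul_of_nonneg_right h2.le hs0.le
    rw [add_mul, inv_mul_cancel₀ hs0.ne'] at this
    linarith
  have hn0 : (0 : ℝ) ≤ n := Nat.cast_nonneg n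
  have hρn : 0 ≤ n * ρ ^ n := by positivity
  have h5 : n * ρ ^ n ≤ L * s := by
    calc n * ρ ^ n ≤ n * ρ ^ n * (n * s) := le_mul_of_one_le_right hρn h3
      _ = (n ^ 2 * ρ ^ n) * s := by ring
      _ ≤ L * s := mul_le_mul_of_nonneg_right (hL' n) hs0.le
  have h6 : (n : ℝ) ^ 2 * s ^ 4 ≤ 4 * s := by
    have h7 : (n * s) ^ 2 ≤ 2 ^ 2 := pow_le_pow_left₀ (by positivity) h4 2
    have h8 : s ^ 2 ≤ s := by nlinarith
    calc (n : ℝ) ^ 2 * s ^ 4 = (n * s) ^ 2 * s ^ 2 := by ring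
      _ ≤ 2 ^ 2 * s := mul_le_mul h7 h8 (by positivity) (by positivity)
      _ = 4 * s := by norm_num
  linarith

lemma abs_sqrt_sub_sqrt_le {x y : ℝ} (hx : 0 ≤ x) (hy : 0 ≤ y) : |√x - √y| ≤ √|x - y| := by
  wlog h : y ≤ x generalizing x y
  · rw [abs_sub_comm, abs_sub_comm x]
    exact this hy hx (le_of_not_ge h)
  rw [abs_of_nonneg (sub_nonneg.2 (Real.sqrt_le_sqrt h)), abs_of_nonneg (sub_nonneg.2 h),
    sub_le_iff_le_add, Real.sqrt_le_iff]
  refine ⟨by positivity, ?_⟩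
  have h1 := Real.sq_sqrt (sub_nonneg.2 h)
  have h2 := Real.sq_sqrt hy
  nlinarith [mul_nonneg (Real.sqrt_nonneg (x - y)) (Real.sqrt_nonneg y)]

/-! ### Dependence of the variance on the parameter -/

/-- A branched map `S` with a Lasota–Yorke inequality (constants `C₁`, `ρ₁`) whose invariant
measure `ν` has the density `d ∈ V_α`, and whose correlations decay exponentially (constants
`C₂`, `ρ₂`). -/
structure IsExponentiallyMixing (α A C₁ ρ₁ C₂ ρ₂ : ℝ) {p : ℕ} {S : ℝ → ℝ} {c : Fin (p + 1) → ℝ}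
    (h : IsBranched S c) (ν : Measure ℝ) (d : L1) : Prop where
  lasotaYorke : IsLasotaYorke α A C₁ ρ₁ h.transferL1
  isACIP : IsACIP S ν
  memBV : MemBV α A d
  bvNorm_le : bvNorm α A d ≤ 4 * C₁
  nonneg : 0 ≤ d
  eq_withDensity : ν = leb.withDensity fun x => ENNReal.ofReal (d x)
  const_nonneg : 0 ≤ C₂
  rate_pos : 0 < ρ₂
  decay : ∀ φ ψ : ℝ → ℝ, MemV α A φ → Integrable ψ leb → ∀ n ≥ 1,
    |(∫ x, φ x * ψ (S^[n] x) ∂leb) - (∫ x, φ x ∂leb) * ∫ x, ψ x ∂ν| ≤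
      C₂ * (gbvNorm α A φ).toReal * (∫ x, |ψ x| ∂leb) * ρ₂ ^ n

lemma abs_integral_sub_integral_mul_le (f g : L1) {ψ : ℝ → ℝ} {K : ℝ}
    (hψ : AEStronglyMeasurable ψ leb) (hK : ∀ᵐ x ∂leb, |ψ x| ≤ K) :
    |(∫ x, f x * ψ x ∂leb) - ∫ x, g x * ψ x ∂leb| ≤ K * ‖f - g‖ := by
  have hi : ∀ u : L1, Integrable (fun x => u x * ψ x) leb := fun u => by
    simpa only [mul_comm] using integrable_mul_of_ae_bound hψ hK (L1.integrable_coeFn u)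
  rw [← integral_sub (hi f) (hi g), L1.norm_eq_integral_norm, ← integral_const_mul]
  refine (norm_integral_le_integral_norm _).trans
    (integral_mono_ae ((hi f).sub (hi g)).norm ((L1.integrable_coeFn (f - g)).norm.const_mul K) ?_)
  filter_upwards [hK, Lp.coeFn_sub f g] with x hx hfg
  rw [hfg, Pi.sub_apply, ← sub_mul, norm_mul, mul_comm]
  exact mul_le_mul_of_nonneg_right hx (norm_nonneg _)

lemma integral_abs_le_of_ae_bound {ψ : ℝ → ℝ} {K : ℝ} (hK : ∀ᵐ x ∂leb, |ψ x| ≤ K) :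
    ∫ x, |ψ x| ∂leb ≤ K := by
  have h1 : ∀ᵐ x ∂leb, ‖|ψ x|‖ ≤ K := by
    filter_upwards [hK] with x hx
    rwa [Real.norm_eq_abs, abs_abs]
  have h2 := norm_integral_le_of_norm_le_const h1
  rw [probReal_univ, mul_one] at h2
  exact (le_abs_self _).trans h2

namespace IsExponentiallyMixing

variable {α A C₁ ρ₁ C₂ ρ₂ τ : ℝ} {p p' : ℕ} {S S' : ℝ → ℝ} {c : Fin (p + 1) → ℝ}
  {c' : Fin (p' + 1) → ℝ} {h : IsBranched S c} {h' : IsBranched S' c'} {ν ν' : Measure ℝ}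
  {d d' : L1}

lemma ac (H : IsExponentiallyMixing α A C₁ ρ₁ C₂ ρ₂ h ν d) : ν ≪ leb := H.isACIP.ac

lemma aemeasurable (H : IsExponentiallyMixing α A C₁ ρ₁ C₂ ρ₂ h ν d) : AEMeasurable S ν :=
  h.aemeasurable.mono_ac H.ac

lemma integral_eq (H : IsExponentiallyMixing α A C₁ ρ₁ C₂ ρ₂ h ν d) (ψ : ℝ → ℝ) :
    ∫ x, ψ x ∂ν = ∫ x, d x * ψ x ∂leb := by
  rw [H.eq_withDensity, integral_withDensity_eq H.nonneg]

lemma abs_integral_le (H : IsExponentiallyMixing α A C₁ ρ₁ C₂ ρ₂ h ν d) {ψ : ℝ → ℝ} {K : ℝ}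
    (hK : ∀ᵐ x ∂leb, |ψ x| ≤ K) : |∫ x, ψ x ∂ν| ≤ K := by
  have := H.isACIP.isProb
  have h1 : ∀ᵐ x ∂ν, ‖ψ x‖ ≤ K := H.ac.ae_le hK
  have h2 := norm_integral_le_of_norm_le_const h1
  rwa [probReal_univ, mul_one] at h2

/-- The invariant measures of two maps whose transfer operators are `τ`-close: both integrals are
compared with the average of `ψ` over the image of Lebesgue measure after `n` steps. -/
lemma abs_integral_sub_le (hα : 0 ≤ α) (hA : 0 < A)
    (H : IsExponentiallyMixing α A C₁ ρ₁ C₂ ρ₂ h ν d)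
    (H' : IsExponentiallyMixing α A C₁ ρ₁ C₂ ρ₂ h' ν' d') (hτ : 0 ≤ τ)
    (hclose : ∀ f : L1, MemBV α A f → ‖h.transferL1 f - h'.transferL1 f‖ ≤ τ * bvNorm α A f)
    {ψ : ℝ → ℝ} {K : ℝ} (hψ : AEStronglyMeasurable ψ leb) (hK : ∀ᵐ x ∂leb, |ψ x| ≤ K) {n : ℕ}
    (hn : 1 ≤ n) :
    |(∫ x, ψ x ∂ν) - ∫ x, ψ x ∂ν'| ≤ K * (2 * C₂ * ρ₂ ^ n + n * τ * (2 * C₁)) := by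
  have hψi : Integrable ψ leb := Integrable.of_bound hψ K hK
  obtain ⟨h1V, h1le⟩ := memBV_oneL1 α A
  have hK0 : 0 ≤ ∫ x, |ψ x| ∂leb := integral_nonneg fun x => abs_nonneg _
  have hρ := H.rate_pos
  have hC := H.const_nonneg
  have key : ∀ {q : ℕ} {R : ℝ → ℝ} {e : Fin (q + 1) → ℝ} {g : IsBranched R e} {m : Measure ℝ}
      {w : L1}, IsExponentiallyMixing α A C₁ ρ₁ C₂ ρ₂ g m w →
      |(∫ x, (g.transferL1 ^ n) oneL1 x * ψ x ∂leb) - ∫ x, ψ x ∂m| ≤ K * (C₂ * ρ₂ ^ n) := by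
    intro q R e g m w G
    have h2 := G.decay _ ψ h1V.memV hψi n hn
    rw [← g.integral_pow_transferL1_mul G.lasotaYorke hα hA n h1V hψi, ← mass_apply, mass_oneL1,
      one_mul] at h2
    refine h2.trans ?_
    change C₂ * bvNorm α A oneL1 * _ * _ ≤ _
    calc C₂ * bvNorm α A oneL1 * (∫ x, |ψ x| ∂leb) * ρ₂ ^ n
        ≤ C₂ * 1 * K * ρ₂ ^ n := by
          gcongr
          exact integral_abs_le_of_ae_bound hK
      _ = K * (C₂ * ρ₂ ^ n) := by ring
  have k1 := key H
  have k2 := key H'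
  have k3 := abs_integral_sub_integral_mul_le ((h.transferL1 ^ n) oneL1) ((h'.transferL1 ^ n) oneL1)
    hψ hK
  have hKnn : 0 ≤ K := hK0.trans (integral_abs_le_of_ae_bound hK)
  have hC1 : 0 ≤ C₁ := zero_le_one.trans H.lasotaYorke.one_le
  have k4 : K * ‖(h.transferL1 ^ n) oneL1 - (h'.transferL1 ^ n) oneL1‖ ≤
      K * (n * τ * (2 * C₁)) := by
    refine mul_le_mul_of_nonneg_left ?_ hKnn
    refine (H.lasotaYorke.norm_pow_sub_pow_le H'.lasotaYorke hτ hclose n h1V).trans ?_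
    calc (n : ℝ) * (τ * (2 * C₁ * bvNorm α A oneL1)) ≤ n * (τ * (2 * C₁ * 1)) := by gcongr
      _ = n * τ * (2 * C₁) := by ring
  rw [abs_le] at k1 k2 k3 ⊢
  constructor <;> nlinarith

/-- The product of the density with a bounded observable lies in `V_α`, with a norm that does not
depend on the map. -/
lemma memV_mul {M N : ℝ} (hM : 0 < M) (hN1 : 1 ≤ N)
    (hN : ∀ f : L1, MemBV α A f → ∀ᵐ x ∂leb, |f x| ≤ N * bvNorm α A f)
    (H : IsExponentiallyMixing α A C₁ ρ₁ C₂ ρ₂ h ν d) {φ : ℝ → ℝ} (hφ : MemV α A φ)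
    (hφM : ∀ᵐ x ∂leb, |φ x| ≤ M) :
    MemV α A (fun x => d x * φ x) ∧ (gbvNorm α A fun x => d x * φ x).toReal ≤
      2 * M * (4 * C₁) + N * (4 * C₁) * (gbvNorm α A φ).toReal := by
  have hC1 : 0 < C₁ := zero_lt_one.trans_le H.lasotaYorke.one_le
  have hN0 : 0 < N := zero_lt_one.trans_le hN1
  have hdb : ∀ᵐ x ∂leb, |d x| ≤ N * (4 * C₁) := by
    filter_upwards [hN d H.memBV] with x hx
    exact hx.trans (mul_le_mul_of_nonneg_left H.bvNorm_le hN0.le)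
  have hint : Integrable (fun x => d x * φ x) leb :=
    integrable_mul_of_ae_bound (L1.aestronglyMeasurable_coeFn d) hdb hφ.1
  obtain ⟨hfV, hfn⟩ := memBV_toL1 hφ
  have hφtop : gbvNorm α A φ ≠ ⊤ := by
    rw [← gbvNorm_congr hφ.1.coeFn_toL1]; exact hfV
  have hsd : gbvSeminorm α A d ≤ ENNReal.ofReal (4 * C₁) := by
    calc gbvSeminorm α A d ≤ gbvNorm α A d := le_self_add
      _ = ENNReal.ofReal (bvNorm α A d) := H.memBV.ofReal_bvNorm.symm
      _ ≤ _ := ENNReal.ofReal_le_ofReal H.bvNorm_le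
  have hsφ : gbvSeminorm α A φ ≤ ENNReal.ofReal (gbvNorm α A φ).toReal := by
    rw [ENNReal.ofReal_toReal hφtop]; exact le_self_add
  have hs : gbvSeminorm α A (fun x => d x * φ x) ≤
      ENNReal.ofReal (M * (4 * C₁) + N * (4 * C₁) * (gbvNorm α A φ).toReal) := by
    refine (gbvSeminorm_mul_le (by positivity) hM hdb hφM).trans ?_
    rw [ENNReal.ofReal_add (by positivity) (by positivity), ENNReal.ofReal_mul hM.le,
      ENNReal.ofReal_mul (show 0 ≤ N * (4 * C₁) by positivity)]
    gcongr
  have hl : eLpNorm (fun x => d x * φ x) 1 leb ≤ ENNReal.ofReal (M * (4 * C₁)) := by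
    have h1 : ∀ᵐ x ∂leb, ‖d x * φ x‖ ≤ M * ‖d x‖ := by
      filter_upwards [hφM] with x hx
      rw [norm_mul, mul_comm]
      exact mul_le_mul_of_nonneg_right hx (norm_nonneg _)
    refine (eLpNorm_le_mul_eLpNorm_of_ae_le_mul h1 1).trans ?_
    rw [eLpNorm_coeFn, ← ENNReal.ofReal_mul hM.le]
    exact ENNReal.ofReal_le_ofReal
      (mul_le_mul_of_nonneg_left (H.memBV.norm_le.trans H.bvNorm_le) hM.le)
  refine ⟨⟨hint, hs.trans_lt ENNReal.ofReal_lt_top⟩, ?_⟩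
  apply ENNReal.toReal_le_of_le_ofReal (by positivity)
  calc gbvNorm α A (fun x => d x * φ x) ≤ _ := add_le_add hs hl
    _ = _ := by
      rw [← ENNReal.ofReal_add (by positivity) (by positivity)]
      congr 1; ring

lemma autocov_eq (H : IsExponentiallyMixing α A C₁ ρ₁ C₂ ρ₂ h ν d) {φ : ℝ → ℝ} {M : ℝ}
    (hφ : Integrable φ leb) (hφM : ∀ᵐ x ∂leb, |φ x| ≤ M) (i : ℕ) :
    autocov S ν φ i = (∫ x, φ x * φ (S^[i] x) ∂ν) - (∫ x, φ x ∂ν) ^ 2 := by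
  have := H.isACIP.isProb
  exact PiecewiseExpanding.autocov_eq H.aemeasurable H.isACIP.inv
    (hφ.aestronglyMeasurable.mono_ac H.ac) (H.ac.ae_le hφM) i

/-- Decay of correlations for the observables `d φ` and `φ`. Centering is not needed: the integral
of `d φ` against Lebesgue measure is the mean of `φ`. -/
lemma abs_autocov_le (H : IsExponentiallyMixing α A C₁ ρ₁ C₂ ρ₂ h ν d) {φ : ℝ → ℝ} {M B : ℝ}
    (hφ : Integrable φ leb) (hφM : ∀ᵐ x ∂leb, |φ x| ≤ M)
    (hV : MemV α A fun x => d x * φ x) (hB : (gbvNorm α A fun x => d x * φ x).toReal ≤ B) {n : ℕ}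
    (hn : 1 ≤ n) : |autocov S ν φ n| ≤ C₂ * B * M * ρ₂ ^ n := by
  have h1 := H.decay _ φ hV hφ n hn
  have h2 : ∫ x, φ x * φ (S^[n] x) ∂ν = ∫ x, d x * φ x * φ (S^[n] x) ∂leb := by
    rw [H.integral_eq]; simp only [mul_assoc]
  rw [H.autocov_eq hφ hφM, h2, sq]
  rw [← H.integral_eq] at h1
  have hC := H.const_nonneg
  have hρ := H.rate_pos
  refine h1.trans ?_
  have hK0 : 0 ≤ ∫ x, |φ x| ∂leb := integral_nonneg fun x => abs_nonneg _
  have := integral_abs_le_of_ae_bound hφM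
  have hB0 : 0 ≤ B := ENNReal.toReal_nonneg.trans hB
  gcongr

/-- Comparison of the autocovariances of two maps whose transfer operators are `τ`-close. -/
lemma abs_autocov_sub_le (hα : 0 ≤ α) (hA : 0 < A)
    (H : IsExponentiallyMixing α A C₁ ρ₁ C₂ ρ₂ h ν d)
    (H' : IsExponentiallyMixing α A C₁ ρ₁ C₂ ρ₂ h' ν' d') (hτ : 0 ≤ τ)
    (hclose : ∀ f : L1, MemBV α A f → ‖h.transferL1 f - h'.transferL1 f‖ ≤ τ * bvNorm α A f)
    {φ : ℝ → ℝ} {M B : ℝ} (hM : 0 ≤ M) (hφ : Integrable φ leb) (hφM : ∀ᵐ x ∂leb, |φ x| ≤ M)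
    (hV : MemV α A fun x => d' x * φ x) (hB : (gbvNorm α A fun x => d' x * φ x).toReal ≤ B)
    {i n : ℕ} (hin : i ≤ n) (hn : 1 ≤ n) :
    |autocov S ν φ i - autocov S' ν' φ i| ≤
      3 * M ^ 2 * (2 * C₂ * ρ₂ ^ n + n * τ * (2 * C₁)) + M * (n * τ * (2 * C₁ * B)) := by
  have hC1 : 0 ≤ C₁ := zero_le_one.trans H.lasotaYorke.one_le
  have hB0 : 0 ≤ B := ENNReal.toReal_nonneg.trans hB
  set E := 2 * C₂ * ρ₂ ^ n + n * τ * (2 * C₁) with hE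
  have hφi := h.integrable_comp_iterate hφ i
  have hbd : ∀ᵐ x ∂leb, |φ (S^[i] x)| ≤ M := by
    clear hin hφi
    induction i with
    | zero => exact hφM
    | succ i ih =>
      simp only [Function.iterate_succ_apply]
      exact h.ae_comp ih
  -- One term at a time: `k1` changes the measure, `k3` the map, `k2` and `k4` the mean.
  have hψ : AEStronglyMeasurable (fun x => φ x * φ (S^[i] x)) leb :=
    hφ.aestronglyMeasurable.mul hφi.aestronglyMeasurable
  have hψM : ∀ᵐ x ∂leb, |φ x * φ (S^[i] x)| ≤ M ^ 2 := by
    filter_upwards [hφM, hbd] with x h1 h2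
    rw [abs_mul, sq]
    exact mul_le_mul h1 h2 (abs_nonneg _) hM
  have k1 := abs_integral_sub_le hα hA H H' hτ hclose hψ hψM hn
  have k2 := abs_integral_sub_le hα hA H H' hτ hclose hφ.aestronglyMeasurable hφM hn
  rw [← hE] at k1 k2
  obtain ⟨hgV, hgn⟩ := memBV_toL1 hV
  set g : L1 := hV.1.toL1 _ with hg
  have hgae : g =ᵐ[leb] fun x => d' x * φ x := hV.1.coeFn_toL1
  have dual : ∀ {q : ℕ} {R : ℝ → ℝ} {e : Fin (q + 1) → ℝ} {r : IsBranched R e} {m : Measure ℝ}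
      {w : L1}, IsExponentiallyMixing α A C₁ ρ₁ C₂ ρ₂ r m w →
      ∫ x, φ x * φ (R^[i] x) ∂ν' = ∫ x, (r.transferL1 ^ i) g x * φ x ∂leb := by
    intro q R e r m w G
    rw [H'.integral_eq, r.integral_pow_transferL1_mul G.lasotaYorke hα hA i hgV hφ]
    apply integral_congr_ae
    filter_upwards [hgae] with x hx
    rw [hx, mul_assoc]
  have k3 : |(∫ x, φ x * φ (S^[i] x) ∂ν') - ∫ x, φ x * φ (S'^[i] x) ∂ν'| ≤
      M * (n * τ * (2 * C₁ * B)) := by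
    rw [dual H, dual H']
    refine (abs_integral_sub_integral_mul_le _ _ hφ.aestronglyMeasurable hφM).trans
      (mul_le_mul_of_nonneg_left ?_ hM)
    refine (H.lasotaYorke.norm_pow_sub_pow_le H'.lasotaYorke hτ hclose i hgV).trans ?_
    rw [hgn, mul_assoc (n : ℝ)]
    gcongr
  have k4 : |(∫ x, φ x ∂ν) ^ 2 - (∫ x, φ x ∂ν') ^ 2| ≤ 2 * M * (M * E) := by
    rw [sq_sub_sq, abs_mul]
    refine mul_le_mul ?_ k2 (abs_nonneg _) (by positivity)
    refine (abs_add_le _ _).trans ?_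
    linarith [H.abs_integral_le hφM, H'.abs_integral_le hφM]
  rw [H.autocov_eq hφ hφM, H'.autocov_eq hφ hφM]
  rw [abs_le] at k1 k3 k4 ⊢
  constructor <;> linarith

lemma summable_autocov {φ : ℝ → ℝ} {K ρ : ℝ} (hρ0 : 0 ≤ ρ) (hρ1 : ρ < 1)
    (hK : ∀ n ≥ 1, |autocov S ν φ n| ≤ K * ρ ^ n) :
    Summable fun i : ℕ => autocov S ν φ (i + 1) :=
  Summable.of_norm_bounded (((summable_geometric_of_lt_one hρ0 hρ1).mul_left K).comp_injective
    (add_left_injective 1)) (f := fun i : ℕ => autocov S ν φ (i + 1))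
    fun i => hK (i + 1) (Nat.le_add_left 1 i)

lemma varianceSeries_nonneg (H : IsExponentiallyMixing α A C₁ ρ₁ C₂ ρ₂ h ν d) {φ : ℝ → ℝ} {M : ℝ}
    (hφ : Integrable φ leb) (hφM : ∀ᵐ x ∂leb, |φ x| ≤ M)
    (hs : Summable fun i : ℕ => autocov S ν φ (i + 1)) : 0 ≤ varianceSeries S ν φ := by
  have := H.isACIP.isProb
  refine integral_sq_add_two_mul_tsum_nonneg (u := fun x => φ x - ∫ z, φ z ∂ν)
    (M := M + |∫ z, φ z ∂ν|) H.aemeasurable H.isACIP.inv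
    ((hφ.aestronglyMeasurable.mono_ac H.ac).sub aestronglyMeasurable_const) ?_ hs
  filter_upwards [H.ac.ae_le hφM] with x hx
  exact (abs_sub _ _).trans (by gcongr)

/-- The first `n` terms are compared one by one, the tails by their exponential smallness. -/
lemma abs_varianceSeries_sub_le (hα : 0 ≤ α) (hA : 0 < A) (hρ : ρ₂ < 1)
    (H : IsExponentiallyMixing α A C₁ ρ₁ C₂ ρ₂ h ν d)
    (H' : IsExponentiallyMixing α A C₁ ρ₁ C₂ ρ₂ h' ν' d') (hτ : 0 ≤ τ)
    (hclose : ∀ f : L1, MemBV α A f → ‖h.transferL1 f - h'.transferL1 f‖ ≤ τ * bvNorm α A f)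
    {φ : ℝ → ℝ} {M B : ℝ} (hM : 0 ≤ M) (hφ : Integrable φ leb) (hφM : ∀ᵐ x ∂leb, |φ x| ≤ M)
    (hV : MemV α A fun x => d x * φ x) (hB : (gbvNorm α A fun x => d x * φ x).toReal ≤ B)
    (hV' : MemV α A fun x => d' x * φ x) (hB' : (gbvNorm α A fun x => d' x * φ x).toReal ≤ B)
    {n : ℕ} (hn : 1 ≤ n) :
    |varianceSeries S ν φ - varianceSeries S' ν' φ| ≤
      (18 * M ^ 2 * C₂ + 4 * C₂ * B * M * (1 - ρ₂)⁻¹) * (n * ρ₂ ^ n) +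
      (18 * M ^ 2 * C₁ + 6 * C₁ * B * M) * (n ^ 2 * τ) := by
  have hC1 : 0 ≤ C₁ := zero_le_one.trans H.lasotaYorke.one_le
  have hC2 := H.const_nonneg
  have hρ0 := H.rate_pos
  have hB0 : 0 ≤ B := ENNReal.toReal_nonneg.trans hB
  have hn1 : (1 : ℝ) ≤ n := by exact_mod_cast hn
  set δ := 3 * M ^ 2 * (2 * C₂ * ρ₂ ^ n + n * τ * (2 * C₁)) + M * (n * τ * (2 * C₁ * B)) with hδ
  have hδ0 : 0 ≤ δ := by positivity
  have hd : ∀ i ≤ n, |autocov S ν φ i - autocov S' ν' φ i| ≤ δ := fun i hi =>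
    abs_autocov_sub_le hα hA H H' hτ hclose hM hφ hφM hV' hB' hi hn
  have hshift : ∀ {x : ℝ} {i : ℕ}, x ≤ C₂ * B * M * ρ₂ ^ (i + 1) → x ≤ C₂ * B * M * ρ₂ ^ i :=
    fun hx => hx.trans (mul_le_mul_of_nonneg_left
      (pow_le_pow_of_le_one hρ0.le hρ.le (Nat.le_succ _)) (by positivity))
  have hsum := abs_tsum_sub_le hρ0.le hρ (g := fun i => autocov S ν φ (i + 1))
    (g' := fun i => autocov S' ν' φ (i + 1)) (K := C₂ * B * M)
    (fun i => hshift (H.abs_autocov_le hφ hφM hV hB (Nat.le_add_left 1 i)))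
    (fun i => hshift (H'.abs_autocov_le hφ hφM hV' hB' (Nat.le_add_left 1 i))) n
    (fun i hi => hd (i + 1) hi)
  have hzero := hd 0 (Nat.zero_le n)
  have e : ∀ (R : ℝ → ℝ) (m : Measure ℝ),
      varianceSeries R m φ = autocov R m φ 0 + 2 * ∑' i : ℕ, autocov R m φ (i + 1) := by
    intro R m
    simp only [varianceSeries, autocov, sq, Function.iterate_zero, id]
  have hinv : 0 ≤ (1 - ρ₂)⁻¹ := inv_nonneg.2 (by linarith)
  have h1 : |varianceSeries S ν φ - varianceSeries S' ν' φ| ≤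
      3 * n * δ + 4 * C₂ * B * M * (1 - ρ₂)⁻¹ * ρ₂ ^ n := by
    rw [e, e]
    have h2 : δ ≤ n * δ := le_mul_of_one_le_left hδ0 hn1
    rw [abs_le] at hsum hzero ⊢
    constructor <;> linarith
  have h3 : ρ₂ ^ n ≤ n * ρ₂ ^ n := le_mul_of_one_le_left (by positivity) hn1
  have h4 : 4 * C₂ * B * M * (1 - ρ₂)⁻¹ * ρ₂ ^ n ≤
      4 * C₂ * B * M * (1 - ρ₂)⁻¹ * (n * ρ₂ ^ n) :=
    mul_le_mul_of_nonneg_left h3 (by positivity)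
  refine h1.trans ((add_le_add_right h4 _).trans (le_of_eq ?_))
  rw [hδ]; ring

end IsExponentiallyMixing

namespace UniformDecay

variable {α A ε ε' : ℝ} {p : ℕ} {T : ℝ → ℝ → ℝ} {b : Fin (p + 1) → ℝ → ℝ} {μ : ℝ → Measure ℝ}

/-- On an interval of uniform decay of correlations the variance is well defined, nonnegative and
Hölder continuous in the parameter. -/
theorem variance (hU : UniformDecay α A T μ ε') (hA : 0 < A) (hT : ExpandingFamily α p T b μ)
    (hII : ConditionII α A T b μ ε) (hε' : ε' ∈ Ioc 0 ε) {φ : ℝ → ℝ} (hφ : MemV α A φ) :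
    (∀ a ∈ Icc 0 ε', Summable (fun i : ℕ => autocov (T a) (μ a) φ (i + 1)) ∧
      0 ≤ varianceSeries (T a) (μ a) φ) ∧
    ∃ C κ : ℝ, 0 < κ ∧ ∀ a ∈ Icc 0 ε', ∀ a' ∈ Icc 0 ε',
      |sigma (T a) (μ a) φ - sigma (T a') (μ a') φ| ≤ C * |a - a'| ^ κ := by
  have hα := hT.alpha_pos
  obtain ⟨C₁, ρ₁, hLY⟩ := hII.exists_isLasotaYorke hT
  obtain ⟨D, κ, hD, hκ, hDκ⟩ := hT.exists_norm_transferL1_sub_le hA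
  obtain ⟨N, hN1, hN⟩ := exists_ae_abs_le hα.le hA
  obtain ⟨C₂, ρ₂, hC2, hρ0, hρ1, hdec⟩ := hU
  have hmem : ∀ a ∈ Icc 0 ε', a ∈ Icc (0 : ℝ) 1 := fun a ha =>
    ⟨ha.1, ha.2.trans (hε'.2.trans hII.eps_le)⟩
  have hC1 : 0 ≤ C₁ := zero_le_one.trans
    (hLY 0 ⟨le_rfl, zero_le_one⟩ hII.eps_pos.le).one_le
  have hdata : ∀ a (ha : a ∈ Icc 0 ε'), ∃ d : L1,
      IsExponentiallyMixing α A C₁ ρ₁ C₂ ρ₂ (hT.isBranched (hmem a ha)) (μ a) d := by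
    intro a ha
    have hPa := hLY a (hmem a ha) (ha.2.trans hε'.2)
    obtain ⟨d, hd, hdC, hd0, -, -, hμ, -⟩ := hT.exists_density hA (hmem a ha) hPa
    exact ⟨d, hPa, hT.acip a (hmem a ha), hd, hdC, hd0, hμ, zero_le_one.trans hC2, hρ0,
      fun φ ψ hφ hψ n hn => hdec a ha φ ψ hφ hψ n hn⟩
  choose d hd using hdata
  set M : ℝ := N * (gbvNorm α A φ).toReal + 1 with hMdef
  have hM : 0 < M := by
    have : 0 ≤ (gbvNorm α A φ).toReal := ENNReal.toReal_nonneg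
    positivity
  have hφM : ∀ᵐ x ∂leb, |φ x| ≤ M := by
    obtain ⟨h1, h2⟩ := memBV_toL1 hφ
    filter_upwards [hN _ h1, hφ.1.coeFn_toL1] with x hx he
    rw [he, h2] at hx
    linarith
  set B : ℝ := 2 * M * (4 * C₁) + N * (4 * C₁) * (gbvNorm α A φ).toReal with hBdef
  have hV := fun a ha => (hd a ha).memV_mul hM hN1 hN hφ hφM
  have hB0 : 0 ≤ B := by positivity
  have hsum : ∀ a ∈ Icc 0 ε', Summable (fun i : ℕ => autocov (T a) (μ a) φ (i + 1)) := fun a ha =>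
    IsExponentiallyMixing.summable_autocov hρ0.le hρ1 fun n hn =>
      (hd a ha).abs_autocov_le hφ.1 hφM (hV a ha).1 (hV a ha).2 hn
  have hnonneg : ∀ a ∈ Icc 0 ε', 0 ≤ varianceSeries (T a) (μ a) φ := fun a ha =>
    (hd a ha).varianceSeries_nonneg hφ.1 hφM (hsum a ha)
  refine ⟨fun a ha => ⟨hsum a ha, hnonneg a ha⟩, ?_⟩
  obtain ⟨K, hK0, hK⟩ := exists_nat_balance hρ0.le hρ1
  have hinv : 0 ≤ (1 - ρ₂)⁻¹ := inv_nonneg.2 (by linarith)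
  set G : ℝ := (18 * M ^ 2 * C₂ + 4 * C₂ * B * M * (1 - ρ₂)⁻¹) +
    (18 * M ^ 2 * C₁ + 6 * C₁ * B * M) * D with hG
  have hG0 : 0 ≤ G := by positivity
  refine ⟨√(G * K), κ / 4 * (1 / 2), by positivity, fun a ha a' ha' => ?_⟩
  rcases eq_or_ne a a' with rfl | hne
  · rw [sub_self, abs_zero]; positivity
  have ht0 : 0 < |a - a'| := abs_pos.2 (sub_ne_zero.2 hne)
  have ht1 : |a - a'| ≤ 1 := by
    have h1 := hmem a ha
    have h2 := hmem a' ha'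
    rw [abs_le]
    constructor <;> linarith [h1.1, h1.2, h2.1, h2.2]
  -- With cut-off `n ≈ 1 / s`, the error `n ^ 2 * |a - a'| ^ κ` is of order `s ^ 2`.
  set s : ℝ := |a - a'| ^ (κ / 4) with hs
  have hs0 : 0 < s := Real.rpow_pos_of_pos ht0 _
  have hs1 : s ≤ 1 := Real.rpow_le_one ht0.le ht1 (by positivity)
  have hs4 : s ^ 4 = |a - a'| ^ κ := by
    rw [hs, ← Real.rpow_natCast, ← Real.rpow_mul ht0.le]
    congr 1; push_cast; ring
  obtain ⟨n, hn, hbal⟩ := hK s hs0 hs1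
  have hcomp := IsExponentiallyMixing.abs_varianceSeries_sub_le hα.le hA hρ1 (hd a ha) (hd a' ha')
    (τ := D * s ^ 4) (by positivity)
    (fun f hf => by rw [hs4]; exact hDκ a (hmem a ha) a' (hmem a' ha') f hf)
    hM.le hφ.1 hφM (hV a ha).1 (hV a ha).2 (hV a' ha').1 (hV a' ha').2 hn
  have hvar : |varianceSeries (T a) (μ a) φ - varianceSeries (T a') (μ a') φ| ≤ G * K * s := by
    refine hcomp.trans ?_
    have h1 : (0 : ℝ) ≤ n * ρ₂ ^ n := by positivity
    have h2 : (0 : ℝ) ≤ n ^ 2 * s ^ 4 := by positivity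
    calc _ = (18 * M ^ 2 * C₂ + 4 * C₂ * B * M * (1 - ρ₂)⁻¹) * (n * ρ₂ ^ n) +
          (18 * M ^ 2 * C₁ + 6 * C₁ * B * M) * D * (n ^ 2 * s ^ 4) := by ring
      _ ≤ G * (n * ρ₂ ^ n) + G * (n ^ 2 * s ^ 4) := by
        refine add_le_add (mul_le_mul_of_nonneg_right ?_ h1) (mul_le_mul_of_nonneg_right ?_ h2)
        · exact le_add_of_nonneg_right (by positivity)
        · exact le_add_of_nonneg_left (by positivity)
      _ = G * (n * ρ₂ ^ n + n ^ 2 * s ^ 4) := by ring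
      _ ≤ G * (K * s) := mul_le_mul_of_nonneg_left hbal hG0
      _ = G * K * s := by ring
  have hroot : √s = |a - a'| ^ (κ / 4 * (1 / 2)) := by
    rw [Real.sqrt_eq_rpow, hs, ← Real.rpow_mul ht0.le]
  rw [← hroot, ← Real.sqrt_mul (by positivity)]
  exact (abs_sqrt_sub_sqrt_le (hnonneg a ha) (hnonneg a' ha')).trans (Real.sqrt_le_sqrt hvar)

end UniformDecay

end PiecewiseExpanding

end

theorem lemma4p5 {α A : ℝ} {p : ℕ} {T : ℝ → ℝ → ℝ} {b : Fin (p + 1) → ℝ → ℝ}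
    {μ : ℝ → MeasureTheory.Measure ℝ} {ε : ℝ} (hA : 0 < A)
    (hT : PiecewiseExpanding.ExpandingFamily α p T b μ)
    (hII : PiecewiseExpanding.ConditionII α A T b μ ε) :
    (∃ ε' ∈ Set.Ioc 0 ε, PiecewiseExpanding.UniformDecay α A T μ ε') ∧
    ∀ ε' ∈ Set.Ioc 0 ε, PiecewiseExpanding.UniformDecay α A T μ ε' →
      ∀ φ : ℝ → ℝ, PiecewiseExpanding.MemV α A φ →
        (∀ a ∈ Set.Icc 0 ε',
          Summable (fun i : ℕ => PiecewiseExpanding.autocov (T a) (μ a) φ (i + 1)) ∧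
          0 ≤ PiecewiseExpanding.varianceSeries (T a) (μ a) φ) ∧
        ∃ C κ : ℝ, 0 < κ ∧ ∀ a ∈ Set.Icc 0 ε', ∀ a' ∈ Set.Icc 0 ε',
          |PiecewiseExpanding.sigma (T a) (μ a) φ - PiecewiseExpanding.sigma (T a') (μ a') φ| ≤
            C * |a - a'| ^ κ :=
  ⟨hII.exists_uniformDecay hT hA, fun _ hε' hU _ hφ => hU.variance hA hT hII hε' hφ⟩
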